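/- **Setting.** Let $p\neq 2$ be a prime, $q$ a power of $p$, $K=\overline{\mathbb F}_q$, let $V_0$ be an $N$-dimensional $\mathbb F_q$-vector space with a non-degenerate alternating bilinear form $\mathcal B$, and let $V=K\otimes_{\mathbb F_q}V_0$ with the extended form. Let $\mathbf G=\mathrm{Sp}(V)$, with Lie algebra $\mathfrak g=\mathfrak{sp}(V)$. Let $F(c\otimes v)=c^q\otimes v$ on $V$, and let $F$ also denote the Frobenius endomorphisms $x\mapsto F\circ x\circ F^{-1}$ of $\mathbf G$ and of $\mathfrak g$. All topological notions refer to the Zariski topology, and $H^\circ$ is the identity component of $H$. Let $\mathcal P_{-1}(N)$ be the set of partitions of $N$ in which every odd part has even multiplicity, and for $\mu\in\mathcal P_{-1}(N)$ let $\mathcal O_\mu$ be the set of unipotent $u\in\mathbf G$ such that $u-1$ has Jordan blocks of sizes $\mu_1,\mu_2,\dots$. For a cocharacter $\lambda:\mathbb G_m\to\mathbf G$ let $\mathbf L(\lambda)=C_{\mathbf G}(\lambda(\mathbb G_m))$ and $\mathfrak g(\lambda,2)=\{x\in\mathfrak g:\lambda(t)x\lambda(t)^{-1}=t^2x \text{ for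 all } t\}$, and let $\mathfrak g(\lambda,2)_{\mathrm{reg}}$ be the open dense $\mathbf L(\lambda)$-orbit on $\mathfrak g(\lambda,2)$. A weighted Dynkin diagram is either the zero function or a function $\alpha\mapsto\alpha(h)$ on the root system of $\mathfrak{sp}_N(\mathbb C)$ with respect to the diagonal Cartan subalgebra, where $(e,h,f)$ is an $\mathfrak{sl}_2$-triple in $\mathfrak{sp}_N(\mathbb C)$ with $h$ diagonal and $\alpha(h)\geq 0$ for all simple roots $\alpha$. A Dynkin cocharacter of $\mathbf G$ is a $\mathbf G$-conjugate of a cocharacter $\lambda_d$ of the diagonal maximal torus (with respect to a symplectic basis of $V$) such that $\langle\alpha,\lambda_d\rangle=d(\alpha)$ for all roots $\alpha$, with $d$ a weighted Dynkin diagram. A Springer homeomorphism is a homeomorphism $\phi$ from the unipotent variety $\mathcal U(\mathbf G)$ to the nilpotent cone $\mathcal N(\mathbf G)\subseteq\mathfrak g$ that is $\mathbf G$-equivariant and commutes with $F$ (for example, a Springer isomorphism). Given $\phi$ and $u\in\mathcal U(\mathbf G)$, let $\mathcal D_u(\mathbf G)$ be the set of Dynkin cocharacters $\lambda$ with $\phi(u)\in\mathfrak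 g(\lambda,2)_{\mathrm{reg}}$, and let $\mathcal D_u(\mathbf G)^F$ be the set of those with $F(\lambda(t))=\lambda(t^q)$ for all $t\in\mathbb G_m$. Let $A_{\mathbf G}(u)=C_{\mathbf G}(u)/C_{\mathbf G}(u)^\circ$. For $u\in\mathcal U(\mathbf G)^F$, a subgroup $A\leq C_{\mathbf G}(u)$ and $\lambda\in\mathcal D_u(\mathbf G)^F$, the pair $(A,\lambda)$ is an *admissible covering of $A_{\mathbf G}(u)$* if 1. $A\subseteq\mathbf L(\lambda)^F$; 2. $A$ consists of semisimple elements; 3. $a\in C_{\mathbf L(\lambda)}(C_A(a))^\circ$ for all $a\in A$; 4. the natural map $A\to A_{\mathbf G}(u)$ is surjective, and its kernel $Z$ is central in $A$ and satisfies $Z\cap[A,A]=\{1\}$. **Proposition.** The unipotent conjugacy classes of $\mathbf G$ are exactly the sets $\mathcal O_\mu$ with $\mu\in\mathcal P_{-1}(N)$. For every $\mu\in\mathcal P_{-1}(N)$ the class $\mathcal O_\mu$ is $F$-stable, that is, $F(\mathcal O_\mu)=\mathcal O_\mu$. Moreover, for every Springer homeomorphism $\phi:\mathcal U(\mathbf G)\to\mathcal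 N(\mathbf G)$ and every $\mu\in\mathcal P_{-1}(N)$ there exist an element $u\in\mathcal O_\mu^F$, a finite $2$-group $A\leq C_{\mathbf G}(u)^F$, and a cocharacter $\lambda\in\mathcal D_u(\mathbf G)^F$ such that $(A,\lambda)$ is an admissible covering of $A_{\mathbf G}(u)$. -/

import Mathlib

open scoped TensorProduct Topology

noncomputable section

namespace SymplecticAdmissible

/-! ### The Zariski topology on vector spaces and linear groups -/

section Zariski

variable (K : Type*) [Field K] (E : Type*) [AddCommGroup E] [Module K E]

/-- The common zeros in `E` of a set of polynomials in linear functionals on `E`. -/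
def zeros (S : Set (MvPolynomial (Module.Dual K E) K)) : Set E :=
  {v | ∀ P ∈ S, MvPolynomial.eval (fun f : Module.Dual K E => f v) P = 0}

/-- The Zariski topology: the closed sets are the zero loci of polynomial functions. -/
@[reducible] def zariski : TopologicalSpace E :=
  TopologicalSpace.ofClosed {Z | ∃ S, Z = zeros K E S}
    ⟨Set.univ, by
      ext v
      simp only [zeros, Set.mem_empty_iff_false, Set.mem_ofPred_eq, false_iff, not_forall]
      exact ⟨1, Set.mem_univ _, by simp⟩⟩
    (by
      intro 𝒜 h𝒜
      refine ⟨⋃₀ {S | zeros K E S ∈ 𝒜}, ?_⟩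
      ext v
      constructor
      · rintro hv P ⟨S, hS, hP⟩
        exact hv _ hS P hP
      · intro hv Z hZ
        obtain ⟨S, rfl⟩ := h𝒜 hZ
        exact fun P hP => hv P ⟨S, hZ, hP⟩)
    (by
      rintro _ ⟨S, rfl⟩ _ ⟨T, rfl⟩
      refine ⟨{R | ∃ P ∈ S, ∃ Q ∈ T, R = P * Q}, ?_⟩
      ext v
      constructor
      · rintro (hv | hv) _ ⟨P, hP, Q, hQ, rfl⟩
        · simp [hv P hP]
        · simp [hv Q hQ]
      · intro hv
        by_contra hcon
        simp only [Set.mem_union, zeros, Set.mem_ofPred_eq, not_or, not_forall] at hcon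
        obtain ⟨⟨P, hP, hP0⟩, ⟨Q, hQ, hQ0⟩⟩ := hcon
        have := hv _ ⟨P, hP, Q, hQ, rfl⟩
        rw [map_mul, mul_eq_zero] at this
        exact this.elim hP0 hQ0)

variable {K E}

theorem isClosed_zariski_iff {Z : Set E} :
    IsClosed[zariski K E] Z ↔ ∃ S, Z = zeros K E S := by
  rw [← @isOpen_compl_iff _ _ (zariski K E)]
  change Zᶜᶜ ∈ _ ↔ _
  rw [compl_compl]
  rfl

/-- Linear maps are continuous for the Zariski topologies. -/
theorem continuous_zariski_linear {E' : Type*} [AddCommGroup E'] [Module K E']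
    (f : E →ₗ[K] E') : Continuous[zariski K E, zariski K E'] f := by
  let _ := zariski K E
  let _ := zariski K E'
  refine continuous_iff_isClosed.2 fun Z hZ => ?_
  obtain ⟨S, rfl⟩ := isClosed_zariski_iff.1 hZ
  refine isClosed_zariski_iff.2 ⟨(MvPolynomial.rename fun g => g.comp f) '' S, ?_⟩
  ext v
  simp [zeros, MvPolynomial.eval_rename, Function.comp_def]

end Zariski

section Groups

variable {K : Type*} [Field K] {V : Type*} [AddCommGroup V] [Module K V]

/-- The Zariski topology on `GL(V)`, as a principal open subset of `End(V)`. -/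
@[reducible] def zariskiGL (K V : Type*) [Field K] [AddCommGroup V] [Module K V] :
    TopologicalSpace (LinearMap.GeneralLinearGroup K V) :=
  (zariski K (Module.End K V)).induced Units.val

theorem continuous_mul_mul (a b : LinearMap.GeneralLinearGroup K V) :
    Continuous[zariskiGL K V, zariskiGL K V] fun g => a * g * b := by
  let _ := zariski K (Module.End K V)
  let _ := zariskiGL K V
  refine continuous_induced_rng.2 ?_
  exact (continuous_zariski_linear
    ((LinearMap.mulLeft K (a : Module.End K V)).comp
      (LinearMap.mulRight K (b : Module.End K V)))).comp continuous_induced_dom |>.congr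
        fun g => by simp [mul_assoc]

/-- The underlying set of the identity component `H°`. -/
def identityComponentSet (H : Subgroup (LinearMap.GeneralLinearGroup K V)) :
    Set (LinearMap.GeneralLinearGroup K V) :=
  @connectedComponentIn _ (zariskiGL K V) (H : Set (LinearMap.GeneralLinearGroup K V)) 1

theorem identityComponentSet_translate {H : Subgroup (LinearMap.GeneralLinearGroup K V)}
    {a b x : LinearMap.GeneralLinearGroup K V} (ha : a ∈ H) (hb : b ∈ H)
    (hx : x ∈ identityComponentSet H) (h1 : a * x * b = 1)
    {y : LinearMap.GeneralLinearGroup K V} (hy : y ∈ identityComponentSet H) :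
    a * y * b ∈ identityComponentSet H := by
  let _ := zariskiGL K V
  have hpre : IsPreconnected (identityComponentSet H) := isPreconnected_connectedComponentIn
  have hsub : identityComponentSet H ⊆ H := connectedComponentIn_subset _ _
  have := (hpre.image _ (continuous_mul_mul a b).continuousOn).subset_connectedComponentIn
    (F := (H : Set (LinearMap.GeneralLinearGroup K V))) ⟨x, hx, h1⟩
    (by
      rintro _ ⟨z, hz, rfl⟩
      exact H.mul_mem (H.mul_mem ha (hsub hz)) hb)
  exact this ⟨y, hy, rfl⟩

theorem identityComponentSet_subset (H : Subgroup (LinearMap.GeneralLinearGroup K V)) :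
    identityComponentSet H ⊆ H :=
  @connectedComponentIn_subset _ (zariskiGL K V) _ _

theorem one_mem_identityComponentSet (H : Subgroup (LinearMap.GeneralLinearGroup K V)) :
    1 ∈ identityComponentSet H :=
  @mem_connectedComponentIn _ (zariskiGL K V) _ _ H.one_mem

theorem inv_mem_identityComponentSet {H : Subgroup (LinearMap.GeneralLinearGroup K V)}
    {x : LinearMap.GeneralLinearGroup K V} (hx : x ∈ identityComponentSet H) :
    x⁻¹ ∈ identityComponentSet H := by
  simpa using identityComponentSet_translate (H.inv_mem (identityComponentSet_subset H hx))
    H.one_mem hx (by simp) (one_mem_identityComponentSet H)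

/-- The identity component `H°` of a linear group `H`. -/
def identityComponent (H : Subgroup (LinearMap.GeneralLinearGroup K V)) :
    Subgroup (LinearMap.GeneralLinearGroup K V) where
  carrier := identityComponentSet H
  one_mem' := one_mem_identityComponentSet H
  inv_mem' := inv_mem_identityComponentSet
  mul_mem' := by
    intro x y hx hy
    simpa using identityComponentSet_translate (identityComponentSet_subset H hx) H.one_mem
      (inv_mem_identityComponentSet hx) (by simp) hy

instance identityComponent_normal (H : Subgroup (LinearMap.GeneralLinearGroup K V)) :
    ((identityComponent H).subgroupOf H).Normal where
  conj_mem := by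
    rintro n hn g
    rw [Subgroup.mem_subgroupOf] at hn ⊢
    exact identityComponentSet_translate g.2 (H.inv_mem g.2) (one_mem_identityComponentSet H)
      (by simp) hn

/-- The component group `H / H°`. -/
abbrev ComponentGroup (H : Subgroup (LinearMap.GeneralLinearGroup K V)) : Type _ :=
  H ⧸ (identityComponent H).subgroupOf H

/-! ### The symplectic group, its Lie algebra, unipotent and nilpotent elements -/

/-- The isometry group of a bilinear form; it is `Sp(V)` when the form is alternating and
non-degenerate. -/
def Sp (B : LinearMap.BilinForm K V) : Subgroup (LinearMap.GeneralLinearGroup K V) where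
  carrier := {g | ∀ v w, B (g.val v) (g.val w) = B v w}
  one_mem' := by intro v w; simp
  mul_mem' := by
    intro a b ha hb v w
    simp only [Units.val_mul, Module.End.mul_apply]
    rw [ha, hb]
  inv_mem' := by
    intro a ha v w
    have h := ha (a⁻¹.val v) (a⁻¹.val w)
    simp only [← Module.End.mul_apply, ← Units.val_mul, mul_inv_cancel, Units.val_one,
      Module.End.one_apply] at h
    exact h.symm

/-- The unipotent variety of `Sp(V)`. -/
def unipotentVariety (B : LinearMap.BilinForm K V) :
    Set (LinearMap.GeneralLinearGroup K V) :=
  {g | g ∈ Sp B ∧ IsNilpotent (g.val - 1)}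

/-- The nilpotent cone of `𝔰𝔭(V)`; the Lie algebra consists of the endomorphisms that are
skew-adjoint for the form. -/
def nilpotentCone (B : LinearMap.BilinForm K V) : Set (Module.End K V) :=
  {x | x ∈ skewAdjointLieSubalgebra B ∧ IsNilpotent x}

/-- The unipotent classes of `Sp(V)`: the `Sp(V)`-conjugacy classes of unipotent elements. -/
def unipotentClasses (B : LinearMap.BilinForm K V) :
    Set (Set (LinearMap.GeneralLinearGroup K V)) :=
  {O | ∃ u ∈ unipotentVariety B, O = {x | ∃ g ∈ Sp B, x = g * u * g⁻¹}}

/-- `x` is nilpotent with Jordan blocks of sizes given by the multiset `parts`. -/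
def HasJordanType (x : Module.End K V) (parts : Multiset ℕ) : Prop :=
  ∃ (r : ℕ) (m : Fin r → ℕ) (b : Module.Basis (Σ s : Fin r, Fin (m s)) K V),
    Finset.univ.val.map m = parts ∧
    ∀ (s : Fin r) (i : Fin (m s)),
      x (b ⟨s, i⟩) = if h : (i : ℕ) + 1 < m s then b ⟨s, ⟨i + 1, h⟩⟩ else 0

/-- `𝒫_ε(N)`: the partitions of `N` in which every part `m` with `(-1)^m = ε` has even
multiplicity. -/
def signedPartitions (ε : ℤ) (N : ℕ) : Set N.Partition :=
  {μ | ∀ m : ℕ, (-1 : ℤ) ^ m = ε → Even (μ.parts.count m)}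

/-- `𝒪_μ`: the elements `u` of `Sp(V)` such that `u - 1` is nilpotent of Jordan type `μ`. -/
def jordanClass (B : LinearMap.BilinForm K V) {N : ℕ} (μ : N.Partition) :
    Set (LinearMap.GeneralLinearGroup K V) :=
  {u | u ∈ Sp B ∧ HasJordanType (u.val - 1) μ.parts}

/-- The centraliser `C_H(S)` of a set `S` in a group `H`. -/
def centralizerIn (H : Subgroup (LinearMap.GeneralLinearGroup K V))
    (S : Set (LinearMap.GeneralLinearGroup K V)) :
    Subgroup (LinearMap.GeneralLinearGroup K V) :=
  H ⊓ Subgroup.centralizer S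

/-! ### Cocharacters and weighted Dynkin diagrams -/

/-- `lam : 𝔾_m → H` is a homomorphism of algebraic groups: its matrix coefficients are Laurent
polynomials. -/
def IsCocharacter (H : Subgroup (LinearMap.GeneralLinearGroup K V))
    (lam : Kˣ →* LinearMap.GeneralLinearGroup K V) : Prop :=
  (∀ t, lam t ∈ H) ∧
  ∀ (ξ : Module.Dual K V) (v : V), ∃ P : LaurentPolynomial K,
    ∀ t : Kˣ, ξ ((lam t).val v) = P.eval₂ (RingHom.id K) t

/-- `L(lam) = C_G(lam)` for `G = Sp(V)`. -/
def leviOf (B : LinearMap.BilinForm K V) (lam : Kˣ →* LinearMap.GeneralLinearGroup K V) :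
    Subgroup (LinearMap.GeneralLinearGroup K V) :=
  centralizerIn (Sp B) (Set.range lam)

/-- The weight space `𝔤(lam, i)` of the Lie algebra `𝔤` of `Sp(V)`. -/
def weightSpace (B : LinearMap.BilinForm K V)
    (lam : Kˣ →* LinearMap.GeneralLinearGroup K V) (i : ℤ) : Set (Module.End K V) :=
  {x | x ∈ skewAdjointLieSubalgebra B ∧
    ∀ t : Kˣ, (lam t).val * x * (lam t)⁻¹.val = ((t ^ i : Kˣ) : K) • x}

/-- The orbit of `x` under the adjoint action of `L(lam)`. -/
def leviOrbit (B : LinearMap.BilinForm K V)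
    (lam : Kˣ →* LinearMap.GeneralLinearGroup K V) (x : Module.End K V) :
    Set (Module.End K V) :=
  {y | ∃ l ∈ leviOf B lam, y = l.val * x * l⁻¹.val}

/-- `𝔤(lam, i)_reg`, the open dense `L(lam)`-orbit in `𝔤(lam, i)`, given as the set of
elements whose orbit is open and dense. -/
def regularPart (B : LinearMap.BilinForm K V)
    (lam : Kˣ →* LinearMap.GeneralLinearGroup K V) (i : ℤ) : Set (Module.End K V) :=
  {x | x ∈ weightSpace B lam i ∧
    (∃ U, IsOpen[zariski K (Module.End K V)] U ∧
      leviOrbit B lam x = U ∩ weightSpace B lam i) ∧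
    weightSpace B lam i ⊆
      @closure _ (zariski K (Module.End K V)) (leviOrbit B lam x)}

/-- The roots `±ε_i ± ε_j` (`i ≠ j`) and `±2ε_i` of `Sp_{2n}` with respect to the diagonal torus
`diag(t_1, …, t_n, t_1⁻¹, …, t_n⁻¹)`, in the character lattice `ℤⁿ` with basis `ε_i`. -/
def rootsC (n : ℕ) : Set (Fin n → ℤ) :=
  {α | (∃ i j : Fin n, i ≠ j ∧ ∃ s t : ℤˣ,
      α = Pi.single i (s : ℤ) + Pi.single j (t : ℤ)) ∨
    ∃ (i : Fin n) (s : ℤˣ), α = Pi.single i (2 * (s : ℤ))}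

/-- The simple roots `ε_i - ε_{i+1}` (`1 ≤ i < n`) and `2ε_n`. -/
def simpleRootsC (n : ℕ) : Set (Fin n → ℤ) :=
  {α | (∃ i j : Fin n, (i : ℕ) + 1 = j ∧ α = Pi.single i 1 - Pi.single j 1) ∨
    ∃ i : Fin n, (i : ℕ) + 1 = n ∧ α = Pi.single i 2}

/-- Weighted Dynkin diagrams of type `C_n`: the zero function, and the functions `α ↦ α(h)` on
the roots, for the `𝔰𝔩₂`-triples `(h, e, f)` in `𝔰𝔭_{2n}(ℂ)` such that `h` is diagonal and the
value at each simple root is `≥ 0`. -/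
def IsWeightedDynkinDiagram (n : ℕ) (d : rootsC n → ℤ) : Prop :=
  d = 0 ∨
  ∃ (h e f : LieAlgebra.Symplectic.sp (Fin n) ℂ) (a : Fin n → ℂ),
    IsSl2Triple h e f ∧
    (h : Matrix (Fin n ⊕ Fin n) (Fin n ⊕ Fin n) ℂ) =
      Matrix.diagonal (Sum.elim a fun i => -a i) ∧
    (∀ α : rootsC n, (d α : ℂ) = ∑ i, (α.1 i : ℂ) * a i) ∧
    ∀ α : rootsC n, α.1 ∈ simpleRootsC n → 0 ≤ d α

/-- A symplectic basis of `V`. -/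
def IsSymplecticBasis (B : LinearMap.BilinForm K V) {n : ℕ}
    (b : Module.Basis (Fin n ⊕ Fin n) K V) : Prop :=
  ∀ i j : Fin n, B (b (Sum.inl i)) (b (Sum.inl j)) = 0 ∧
    B (b (Sum.inr i)) (b (Sum.inr j)) = 0 ∧
    B (b (Sum.inl i)) (b (Sum.inr j)) = if i = j then 1 else 0

/-- Dynkin cocharacters of `Sp(V)`, i.e. the conjugates of the cocharacters `λ_d`, where `λ_d` is
the cocharacter of the diagonal torus with `⟨α, λ_d⟩ = d(α)` for all roots `α`.  Since `Sp(V)`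
permutes the symplectic bases simply transitively, conjugating `λ_d` amounts to letting the
symplectic basis that defines the diagonal torus vary. -/
def IsDynkinCocharacter (B : LinearMap.BilinForm K V)
    (lam : Kˣ →* LinearMap.GeneralLinearGroup K V) : Prop :=
  IsCocharacter (Sp B) lam ∧
  ∃ (n : ℕ) (b : Module.Basis (Fin n ⊕ Fin n) K V) (d : rootsC n → ℤ) (c : Fin n → ℤ),
    IsSymplecticBasis B b ∧ IsWeightedDynkinDiagram n d ∧
    (∀ α : rootsC n, ∑ i, α.1 i * c i = d α) ∧
    ∀ (t : Kˣ) (i : Fin n),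
      (lam t).val (b (Sum.inl i)) = ((t ^ c i : Kˣ) : K) • b (Sum.inl i) ∧
      (lam t).val (b (Sum.inr i)) = ((t ^ (-c i) : Kˣ) : K) • b (Sum.inr i)

/-- The set `𝒟_e(G)` of Dynkin cocharacters of the nilpotent element `e`, `G = Sp(V)`. -/
def dynkinCocharacters (B : LinearMap.BilinForm K V) (e : Module.End K V) :
    Set (Kˣ →* LinearMap.GeneralLinearGroup K V) :=
  {lam | IsDynkinCocharacter B lam ∧ e ∈ regularPart B lam 2}

end Groups

/-! ### Frobenius endomorphisms -/

section Frobenius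

variable (k K V₀ : Type*) [Field k] [Fintype k] [Field K] [Algebra k K]
  [Algebra.IsAlgebraic k K] [AddCommGroup V₀] [Module k V₀]

/-- The Frobenius endomorphism `c ⊗ v ↦ c^q ⊗ v` of `V = K ⊗ V₀`, where `q = #k`. -/
def frobV : (K ⊗[k] V₀) ≃ₗ[k] (K ⊗[k] V₀) :=
  TensorProduct.congr (FiniteField.frobeniusAlgEquivOfAlgebraic k K).toLinearEquiv
    (LinearEquiv.refl k V₀)

theorem frobV_tmul (c : K) (v : V₀) :
    frobV k K V₀ (c ⊗ₜ v) = (c ^ Fintype.card k) ⊗ₜ v := rfl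

theorem frobV_smul (c : K) (v : K ⊗[k] V₀) :
    frobV k K V₀ (c • v) = c ^ Fintype.card k • frobV k K V₀ v := by
  induction v with
  | zero => simp
  | tmul a w => simp [TensorProduct.smul_tmul', frobV_tmul, mul_pow]
  | add x y hx hy => simp only [smul_add, map_add, hx, hy]

/-- The Frobenius endomorphism `x ↦ F ∘ x ∘ F⁻¹` of `End(V)`, `V = K ⊗ V₀`. -/
def frobEnd : Module.End K (K ⊗[k] V₀) →* Module.End K (K ⊗[k] V₀) where
  toFun x :=
    { toFun := fun v => frobV k K V₀ (x ((frobV k K V₀).symm v))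
      map_add' := by intro v w; simp
      map_smul' := by
        intro c v
        obtain ⟨c, rfl⟩ := (FiniteField.frobeniusAlgEquivOfAlgebraic k K).surjective c
        obtain ⟨v, rfl⟩ := (frobV k K V₀).surjective v
        have h : (FiniteField.frobeniusAlgEquivOfAlgebraic k K) c = c ^ Fintype.card k := rfl
        have h' : (frobV k K V₀).symm (c ^ Fintype.card k • frobV k K V₀ v) = c • v := by
          rw [LinearEquiv.symm_apply_eq, frobV_smul]
        rw [h, RingHom.id_apply, h', map_smul, frobV_smul, LinearEquiv.symm_apply_apply] }
  map_one' := by ext v; simp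
  map_mul' x y := by ext v; simp

/-- The Frobenius endomorphism `g ↦ F ∘ g ∘ F⁻¹` of `GL(V)`, `V = K ⊗ V₀`. -/
def frobGL :
    LinearMap.GeneralLinearGroup K (K ⊗[k] V₀) →*
      LinearMap.GeneralLinearGroup K (K ⊗[k] V₀) :=
  Units.map (frobEnd k K V₀)

variable {k K V₀}

/-- A Springer homeomorphism `𝒰(G) → 𝒩(G)` for `G = Sp(V)`: a homeomorphism for the Zariski
topologies that is equivariant for `G` and for the Frobenius endomorphisms. -/
structure SpringerHomeomorphism (B : LinearMap.BilinForm K (K ⊗[k] V₀)) where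
  toEquiv : unipotentVariety B ≃ nilpotentCone B
  continuous_toFun :
    Continuous[(zariskiGL K (K ⊗[k] V₀)).induced Subtype.val,
      (zariski K (Module.End K (K ⊗[k] V₀))).induced Subtype.val] toEquiv
  continuous_invFun :
    Continuous[(zariski K (Module.End K (K ⊗[k] V₀))).induced Subtype.val,
      (zariskiGL K (K ⊗[k] V₀)).induced Subtype.val] toEquiv.symm
  map_conj : ∀ g ∈ Sp B, ∀ u v : unipotentVariety B, v.1 = g * u.1 * g⁻¹ →
    (toEquiv v).1 = g.val * (toEquiv u).1 * g⁻¹.val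
  map_frob : ∀ u v : unipotentVariety B, v.1 = frobGL k K V₀ u.1 →
    (toEquiv v).1 = frobEnd k K V₀ (toEquiv u).1

/-- The cocharacter `lam` is fixed by `F`, i.e. `F ∘ lam = lam ∘ F_q` with `F_q(t) = t^q`. -/
def IsRationalCocharacter
    (lam : Kˣ →* LinearMap.GeneralLinearGroup K (K ⊗[k] V₀)) : Prop :=
  ∀ t : Kˣ, frobGL k K V₀ (lam t) = lam (t ^ Fintype.card k)

/-- The set `𝒟_u(G)^F` of `F`-fixed Dynkin cocharacters of the unipotent element `u`. -/
def rationalDynkinCocharacters {B : LinearMap.BilinForm K (K ⊗[k] V₀)}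
    (φ : SpringerHomeomorphism B) (u : unipotentVariety B) :
    Set (Kˣ →* LinearMap.GeneralLinearGroup K (K ⊗[k] V₀)) :=
  {lam | lam ∈ dynkinCocharacters B (φ.toEquiv u).1 ∧ IsRationalCocharacter lam}

/-- `(A, lam)` is an admissible pair for the rational unipotent element `u` of `G = Sp(V)`. -/
structure IsAdmissiblePair {B : LinearMap.BilinForm K (K ⊗[k] V₀)}
    (φ : SpringerHomeomorphism B) (u : unipotentVariety B)
    (A : Subgroup (LinearMap.GeneralLinearGroup K (K ⊗[k] V₀)))
    (lam : Kˣ →* LinearMap.GeneralLinearGroup K (K ⊗[k] V₀)) : Prop where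
  rational : frobGL k K V₀ u.1 = u.1
  le_centralizer : A ≤ centralizerIn (Sp B) {u.1}
  dynkin : lam ∈ rationalDynkinCocharacters φ u
  le_levi : ∀ a ∈ A, a ∈ leviOf B lam ∧ frobGL k K V₀ a = a
  semisimple : ∀ a ∈ A, Module.End.IsSemisimple a.val
  mem_component : ∀ a ∈ A, a ∈ identityComponent
    (centralizerIn (leviOf B lam) (centralizerIn A {a} : Set _))

/-- The restriction to `A` of the natural map `C_G(u) → A_G(u) = C_G(u) / C_G(u)°`. -/
def toComponentGroup {B : LinearMap.BilinForm K (K ⊗[k] V₀)} {u : unipotentVariety B}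
    {A : Subgroup (LinearMap.GeneralLinearGroup K (K ⊗[k] V₀))}
    (hA : A ≤ centralizerIn (Sp B) {u.1}) :
    A →* ComponentGroup (centralizerIn (Sp B) {u.1}) :=
  (QuotientGroup.mk' _).comp (Subgroup.inclusion hA)

/-- `(A, lam)` is an admissible covering of the full component group `A_G(u)`: it is an admissible
pair, `A → A_G(u)` is onto, and its kernel is central in `A` and meets `[A, A]` trivially. -/
structure IsAdmissibleCovering {B : LinearMap.BilinForm K (K ⊗[k] V₀)}
    (φ : SpringerHomeomorphism B) (u : unipotentVariety B)
    (A : Subgroup (LinearMap.GeneralLinearGroup K (K ⊗[k] V₀)))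
    (lam : Kˣ →* LinearMap.GeneralLinearGroup K (K ⊗[k] V₀)) : Prop
    extends IsAdmissiblePair φ u A lam where
  surjective : Function.Surjective (toComponentGroup le_centralizer)
  ker_le_center : (toComponentGroup le_centralizer).ker ≤ Subgroup.center A
  ker_inf_commutator : (toComponentGroup le_centralizer).ker ⊓ commutator A = ⊥

end Frobenius

end SymplecticAdmissible

end

/-!
The idea is to read off everything from one basis.  Let `e` be a nilpotent element of `𝔰𝔭(V)`.
Since the characteristic is not two, `V` is an orthogonal sum of `e`-stable subspaces of two kinds:
a single Jordan string of even length, or a pair of Jordan strings of equal odd length, with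
explicit pairings (`exists_isNormalForm`).  The combinatorial type of such a normal form is a
`StringData`; it is determined by the Jordan type, and the types that occur are exactly the
partitions in which odd parts have even multiplicity.  Two normal forms of the same type are related
by an isometry, so `Sp(V)`-classes of nilpotent elements are classified by their Jordan type; the
Cayley transform `e ↦ (1 + e) (1 - e)⁻¹` carries this over to unipotent elements
(`unipotentClasses_eq`).  Every type has a model over the finite field `k`, so every class contains
a rational element and is stable under Frobenius (`image_frobGL_conj`).

For a Springer homeomorphism `φ` and a class `𝒪_μ`, the nilpotent class `φ(𝒪_μ)` contains an element
`e` with a normal form over `k`, and `u = φ⁻¹(e)` is rational.  By equivariance and injectivity of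
`φ`, the centralisers of `u` and `e` agree, whatever `φ` is.  The cocharacter `lam` gives the `a`-th
element of a string of length `l` the weight `2 a + 1 - l`.

* It is a Dynkin cocharacter: over `ℂ` the model of the normal form completes to an `𝔰𝔩₂`-triple
  whose middle element has these weights (`StringData.isWeightedDynkinDiagram`), and enumerating the
  basis by decreasing weight turns the normal form into a symplectic basis.
* `e` is in the open dense orbit of `L(lam)` on `𝔤(lam, 2)`: an element `y` of `𝔤(lam, 2)` for which
  the maps `y ^ n` from weight `-n` to weight `n` are injective has a homogeneous normal form, whose
  type is determined by the dimensions of the weight spaces, so it is conjugate to `e` under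
  `L(lam)`; and this condition on `y` is the nonvanishing of a determinant
  (`IsNormalForm.mem_regularPart`).

The group `A` consists of the operators that act by a sign on each string of even length and
trivially on the strings of odd length.  It is an elementary abelian `2`-group of rational
semisimple elements commuting with `e` and with `lam`.  Each of its elements lies on a
one-parameter group of operators diagonal in the same basis, hence centralising `A` and `lam`
(`IsNormalForm.signGL_mem_identityComponent`); this is the connectedness condition.

The group `A` maps onto the component group of the centraliser of `e`
(`IsNormalForm.exists_signGL_inv_mul_mem`).  If `g` and `g'` centralise `e` and `g + g'` is
invertible, then `g` and `g'` lie in the same component: `z = g⁻¹ g'` does not have the eigenvalue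
`-1`, and `c ↦ (z + c) (1 + c z)⁻¹` is a rational curve in the centraliser that joins `z` to `1`.
An endomorphism commuting with `e` is invertible as soon as it is invertible on the kernel of `e`.
Given `x` in the centraliser, one finds an element `g` that acts on the kernel of `e` by a block
matrix with blocks `±1` and blocks in `SL₂` without the eigenvalue `-1`, such that `x + g` is
invertible there (`exists_det_blockMat_add_ne_zero`); and `g + a` is invertible for the element `a`
of `A` with the same signs.
-/

noncomputable section

namespace SymplecticAdmissible

/-! ### String data and normal forms -/

/-- The combinatorial type of a nilpotent element of a symplectic Lie algebra: one Jordan string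
of even length `2 p i + 2` for each `i : I`, and a pair of Jordan strings of odd length
`2 q j + 1` for each `j : J`. -/
structure StringData where
  /-- The index type of the strings of even length. -/
  I : Type
  /-- The index type of the pairs of strings of odd length. -/
  J : Type
  [fintypeI : Fintype I]
  [fintypeJ : Fintype J]
  [decEqI : DecidableEq I]
  [decEqJ : DecidableEq J]
  /-- The string `i` has length `2 p i + 2`. -/
  p : I → ℕ
  /-- The two strings of the pair `j` have length `2 q j + 1`. -/
  q : J → ℕ

attribute [instance] StringData.fintypeI StringData.fintypeJ StringData.decEqI StringData.decEqJ

namespace StringData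

/-- The strings of a string datum. -/
abbrev Str (D : StringData) : Type := D.I ⊕ D.J × Bool

/-- The length of a string. -/
def len (D : StringData) : D.Str → ℕ :=
  Sum.elim (fun i => 2 * D.p i + 2) fun j => 2 * D.q j.1 + 1

/-- The string that pairs non-trivially with a given string. -/
def swap (D : StringData) : D.Str → D.Str :=
  Sum.map id fun j => (j.1, !j.2)

/-- The sign in the pairing of a string with its partner. -/
def sgn (D : StringData) : D.Str → ℤˣ :=
  Sum.elim (fun _ => 1) fun j => if j.2 then -1 else 1

@[simp] theorem swap_swap (D : StringData) (s : D.Str) : D.swap (D.swap s) = s := by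
  rcases s with i | ⟨j, x⟩ <;> simp [swap]

@[simp] theorem len_swap (D : StringData) (s : D.Str) : D.len (D.swap s) = D.len s := by
  rcases s with i | ⟨j, x⟩ <;> simp [swap, len]

theorem len_pos (D : StringData) (s : D.Str) : 0 < D.len s := by
  rcases s with i | ⟨j, x⟩ <;> simp [len]

theorem sgn_swap (D : StringData) (s : D.Str) :
    D.sgn (D.swap s) = (-1) ^ (D.len s + 1) * -D.sgn s := by
  rcases s with i | ⟨j, x⟩
  · simp [swap, sgn, len, pow_add, pow_mul]
  · cases x <;> simp [swap, sgn, len, pow_add, pow_mul]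

/-- The index set of the basis formed by all elements of all strings. -/
abbrev Idx (D : StringData) : Type := Σ s : D.Str, Fin (D.len s)

/-- The basis index dual to a given one. -/
def opp (D : StringData) (x : D.Idx) : D.Idx :=
  ⟨D.swap x.1, ⟨D.len x.1 - 1 - x.2, by have := D.len_pos x.1; rw [len_swap]; omega⟩⟩

/-- The value of the form on a basis vector and its dual. -/
def eta (D : StringData) (x : D.Idx) : ℤˣ := (-1) ^ (x.2 : ℕ) * D.sgn x.1

/-- The weight of a basis vector for the cocharacter attached to the normal form. -/
def wt (D : StringData) (x : D.Idx) : ℤ := 2 * (x.2 : ℕ) + 1 - D.len x.1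

theorem idx_ext {D : StringData} {x y : D.Idx} (h : x.1 = y.1) (h' : (x.2 : ℕ) = y.2) :
    x = y := by
  obtain ⟨s, a⟩ := x
  obtain ⟨t, b⟩ := y
  obtain rfl : s = t := h
  obtain rfl : a = b := Fin.ext h'
  rfl

theorem eq_opp_iff {D : StringData} {x y : D.Idx} :
    y = D.opp x ↔ y.1 = D.swap x.1 ∧ (x.2 : ℕ) + y.2 + 1 = D.len x.1 := by
  have hx := x.2.2
  constructor
  · rintro rfl
    refine ⟨rfl, ?_⟩
    simp only [opp]
    omega
  · rintro ⟨h, h'⟩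
    refine idx_ext h ?_
    simp only [opp]
    omega

@[simp] theorem opp_opp (D : StringData) (x : D.Idx) : D.opp (D.opp x) = x := by
  symm
  rw [eq_opp_iff]
  have hx := x.2.2
  refine ⟨by simp [opp], ?_⟩
  simp only [opp, len_swap]
  omega

theorem eq_opp_comm {D : StringData} {x y : D.Idx} : y = D.opp x ↔ x = D.opp y :=
  ⟨fun h => by rw [h, opp_opp], fun h => by rw [h, opp_opp]⟩

theorem wt_opp (D : StringData) (x : D.Idx) : D.wt (D.opp x) = -D.wt x := by
  have hx := x.2.2
  simp only [wt, opp, len_swap]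
  omega

theorem eta_opp (D : StringData) (x : D.Idx) : D.eta (D.opp x) = -D.eta x := by
  have hx := x.2.2
  obtain ⟨c, hc⟩ : ∃ c, D.len x.1 = x.2 + c + 1 := ⟨D.len x.1 - x.2 - 1, by omega⟩
  have hc' : D.len x.1 - 1 - x.2 = c := by omega
  have h2 : ((-1 : ℤˣ) ^ c) * (-1) ^ c = 1 := by rw [← mul_pow]; simp
  have hp : (-1 : ℤˣ) ^ (D.len x.1 + 1) = (-1) ^ (x.2 : ℕ) * (-1) ^ c := by
    rw [show D.len x.1 + 1 = x.2 + c + 2 by omega, pow_add, pow_add]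
    simp
  simp only [eta, opp, sgn_swap, hc', hp]
  calc _ = ((-1 : ℤˣ) ^ c * (-1) ^ c) * ((-1) ^ (x.2 : ℕ) * -D.sgn x.1) := by
        simp only [mul_neg]; ac_rfl
    _ = _ := by rw [h2]; simp

/-- The multiset of the lengths of the strings. -/
def parts (D : StringData) : Multiset ℕ := Finset.univ.val.map D.len

theorem count_parts (D : StringData) (n : ℕ) :
    D.parts.count n = Fintype.card {s // D.len s = n} := by
  rw [parts, Multiset.count_map, Fintype.card_subtype]
  simp only [eq_comm]
  rfl

theorem card_len_even (D : StringData) (n : ℕ) :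
    Fintype.card {s // D.len s = 2 * n + 2} = Fintype.card {i // D.p i = n} := by
  refine (Fintype.card_of_bijective (f := fun i : {i // D.p i = n} =>
    (⟨Sum.inl i.1, by simp [len, i.2]⟩ : {s // D.len s = 2 * n + 2})) ⟨?_, ?_⟩).symm
  · rintro ⟨i, hi⟩ ⟨j, hj⟩ hij
    simpa using hij
  · rintro ⟨i | ⟨j, x⟩, hs⟩
    · exact ⟨⟨i, by simp [len] at hs; omega⟩, rfl⟩
    · simp [len] at hs; omega

theorem card_len_odd (D : StringData) (n : ℕ) :
    Fintype.card {s // D.len s = 2 * n + 1} = Fintype.card ({j // D.q j = n} × Bool) := by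
  refine (Fintype.card_of_bijective (f := fun j : {j // D.q j = n} × Bool =>
    (⟨Sum.inr (j.1.1, j.2), by simp [len, j.1.2]⟩ : {s // D.len s = 2 * n + 1})) ⟨?_, ?_⟩).symm
  · rintro ⟨⟨i, hi⟩, x⟩ ⟨⟨j, hj⟩, y⟩ hij
    simpa using hij
  · rintro ⟨i | ⟨j, x⟩, hs⟩
    · simp [len] at hs; omega
    · exact ⟨⟨⟨j, by simp [len] at hs; omega⟩, x⟩, rfl⟩

theorem card_idx (D : StringData) : Fintype.card D.Idx = ∑ s, D.len s := by
  simp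

end StringData

theorem intUnit_cast_mul_self {R : Type*} [Ring R] (z : ℤˣ) :
    (((z : ℤ) : R)) * ((z : ℤ) : R) = 1 := by
  rcases Int.units_eq_one_or z with rfl | rfl <;> simp

theorem intUnit_cast_ne_zero {R : Type*} [Ring R] [Nontrivial R] (z : ℤˣ) :
    ((z : ℤ) : R) ≠ 0 := by
  rcases Int.units_eq_one_or z with rfl | rfl <;> simp

section NormalForm

variable {R : Type*} [Field R] {V : Type*} [AddCommGroup V] [Module R V]

/-- `e` is skew-adjoint for the form `B`. -/
def IsSkew (B : LinearMap.BilinForm R V) (e : Module.End R V) : Prop :=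
  ∀ v w, B (e v) w = -B v (e w)

theorem IsSkew.pow_left {B : LinearMap.BilinForm R V} {e : Module.End R V} (he : IsSkew B e)
    (a : ℕ) (v w : V) : B ((e ^ a) v) w = (-1) ^ a * B v ((e ^ a) w) := by
  induction a generalizing v w with
  | zero => simp
  | succ a ih =>
    rw [pow_succ', Module.End.mul_apply, he, ih, ← Module.End.mul_apply, ← pow_succ, pow_succ']
    rw [pow_succ]
    ring

theorem IsSkew.pow_pow {B : LinearMap.BilinForm R V} {e : Module.End R V} (he : IsSkew B e)
    (a b : ℕ) (v w : V) :
    B ((e ^ a) v) ((e ^ b) w) = (-1) ^ a * B v ((e ^ (a + b)) w) := by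
  rw [he.pow_left, pow_add, Module.End.mul_apply]

/-- The vectors `v s` head strings for `e` with the pairings prescribed by the string datum `D`. -/
structure IsStrings (B : LinearMap.BilinForm R V) (e : Module.End R V) (D : StringData)
    (v : D.Str → V) : Prop where
  pow_eq_zero : ∀ s, (e ^ D.len s) (v s) = 0
  form : ∀ s s' n, B (v s) ((e ^ n) (v s')) =
    if s' = D.swap s ∧ n + 1 = D.len s then ((D.sgn s : ℤ) : R) else 0

/-- The vectors `v s` head the strings of a normal form of the skew nilpotent element `e`: together
the strings exhaust `V`. -/
structure IsNormalForm (B : LinearMap.BilinForm R V) (e : Module.End R V) (D : StringData)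
    (v : D.Str → V) : Prop extends IsStrings B e D v where
  finrank_eq : Module.finrank R V = ∑ s, D.len s

/-- The family of all elements of all strings. -/
def chain (e : Module.End R V) {D : StringData} (v : D.Str → V) (x : D.Idx) : V :=
  (e ^ (x.2 : ℕ)) (v x.1)

variable {B : LinearMap.BilinForm R V} {e : Module.End R V} {D : StringData} {v : D.Str → V}

theorem IsStrings.form_chain (h : IsStrings B e D v) (he : IsSkew B e) (x y : D.Idx) :
    B (chain e v x) (chain e v y) = if y = D.opp x then ((D.eta x : ℤ) : R) else 0 := by
  rw [chain, chain, he.pow_pow, h.form]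
  simp only [StringData.eq_opp_iff, StringData.eta]
  split_ifs <;> simp

theorem IsStrings.linearIndependent_chain (h : IsStrings B e D v) (he : IsSkew B e) :
    LinearIndependent R (chain e v) := by
  rw [Fintype.linearIndependent_iff]
  intro c hc y
  have h0 : B (chain e v (D.opp y)) (∑ x, c x • chain e v x) = 0 := by rw [hc, map_zero]
  simp only [map_sum, map_smul, h.form_chain he, StringData.opp_opp, smul_eq_mul, mul_ite,
    mul_zero, Finset.sum_ite_eq', Finset.mem_univ, if_true] at h0
  exact (mul_eq_zero.1 h0).resolve_right (intUnit_cast_ne_zero _)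

/-- String data with the same number of strings of each length differ by a relabelling. -/
theorem StringData.exists_equiv {D D' : StringData}
    (h : ∀ n, Fintype.card {s // D.len s = n} = Fintype.card {s // D'.len s = n}) :
    ∃ f : D'.Str ≃ D.Str, (∀ s, D.len (f s) = D'.len s) ∧
      (∀ s, D.swap (f s) = f (D'.swap s)) ∧ ∀ s, D.sgn (f s) = D'.sgn s := by
  have hI : ∀ n, Nonempty ({i // D'.p i = n} ≃ {i // D.p i = n}) := fun n => by
    rw [← Fintype.card_eq, ← StringData.card_len_even, ← StringData.card_len_even, h]
  have hJ : ∀ n, Nonempty ({j // D'.q j = n} ≃ {j // D.q j = n}) := fun n => by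
    rw [← Fintype.card_eq]
    have := h (2 * n + 1)
    rw [StringData.card_len_odd, StringData.card_len_odd, Fintype.card_prod,
      Fintype.card_prod] at this
    simpa using this.symm
  let gI : D'.I ≃ D.I := (Equiv.sigmaFiberEquiv D'.p).symm.trans
    ((Equiv.sigmaCongrRight fun n => (hI n).some).trans (Equiv.sigmaFiberEquiv D.p))
  let gJ : D'.J ≃ D.J := (Equiv.sigmaFiberEquiv D'.q).symm.trans
    ((Equiv.sigmaCongrRight fun n => (hJ n).some).trans (Equiv.sigmaFiberEquiv D.q))
  have hgI : ∀ i, D.p (gI i) = D'.p i := fun i => ((hI (D'.p i)).some ⟨i, rfl⟩).2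
  have hgJ : ∀ j, D.q (gJ j) = D'.q j := fun j => ((hJ (D'.q j)).some ⟨j, rfl⟩).2
  refine ⟨Equiv.sumCongr gI (Equiv.prodCongr gJ (Equiv.refl _)), ?_, ?_, ?_⟩ <;>
  · rintro (i | ⟨j, x⟩) <;>
    simp [StringData.len, StringData.swap, StringData.sgn, hgI, hgJ]

theorem IsNormalForm.reindex {D' : StringData} (h : IsNormalForm B e D v)
    (hD : ∀ n, Fintype.card {s // D.len s = n} = Fintype.card {s // D'.len s = n}) :
    ∃ f : D'.Str ≃ D.Str, (∀ s, D.len (f s) = D'.len s) ∧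
      IsNormalForm B e D' fun s => v (f s) := by
  obtain ⟨f, h1, h2, h3⟩ := StringData.exists_equiv hD
  refine ⟨f, h1, ⟨fun s => ?_, fun s s' n => ?_⟩, ?_⟩
  · rw [← h1, h.pow_eq_zero]
  · rw [h.form, h1, h2, h3]
    simp
  · rw [h.finrank_eq, ← f.sum_comp]
    simp [h1]

variable [FiniteDimensional R V]

/-- The basis given by a normal form. -/
def IsNormalForm.basis (h : IsNormalForm B e D v) (he : IsSkew B e) :
    Module.Basis D.Idx R V :=
  Module.Basis.mk (h.linearIndependent_chain he)
    (((h.linearIndependent_chain he).span_eq_top_of_card_eq_finrank'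
      (by rw [D.card_idx, h.finrank_eq])).ge)

@[simp] theorem IsNormalForm.basis_apply (h : IsNormalForm B e D v) (he : IsSkew B e)
    (x : D.Idx) : h.basis he x = chain e v x := by
  simp [IsNormalForm.basis]

theorem IsNormalForm.nondegenerate (h : IsNormalForm B e D v) (he : IsSkew B e)
    (hB : B.IsAlt) : B.Nondegenerate := by
  have key : ∀ w, (∀ u, B u w = 0) → w = 0 := by
    intro w hw
    apply (h.basis he).ext_elem
    intro y
    have h0 := hw (chain e v (D.opp y))
    rw [← (h.basis he).sum_repr w] at h0
    simp only [map_sum, map_smul, h.basis_apply, h.form_chain he, StringData.opp_opp, smul_eq_mul,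
      mul_ite, mul_zero, Finset.sum_ite_eq', Finset.mem_univ, if_true] at h0
    simpa using (mul_eq_zero.1 h0).resolve_right (intUnit_cast_ne_zero _)
  refine ⟨fun w hw => key w fun u => ?_, key⟩
  rw [← LinearMap.IsAlt.neg hB w u, hw, neg_zero]

theorem IsNormalForm.isAlt (h : IsNormalForm B e D v) (he : IsSkew B e) (h2 : (2 : R) ≠ 0) :
    B.IsAlt := by
  have key : B = -B.flip := by
    refine (h.basis he).ext fun x => (h.basis he).ext fun y => ?_
    simp only [LinearMap.neg_apply, LinearMap.BilinForm.flip_apply, h.basis_apply,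
      h.form_chain he, StringData.eq_opp_comm (x := y)]
    split_ifs with hxy
    · rw [hxy, StringData.eta_opp]; simp
    · simp
  intro x
  have := congrArg (fun C : LinearMap.BilinForm R V => C x x) key
  simp only [LinearMap.neg_apply, LinearMap.BilinForm.flip_apply] at this
  have h3 : (2 : R) * B x x = 0 := by linear_combination this
  exact (mul_eq_zero.1 h3).resolve_left h2

/-- Two normal forms with the same string datum are related by an isometry. -/
theorem IsNormalForm.exists_isometry {V' : Type*} [AddCommGroup V'] [Module R V']
    [FiniteDimensional R V'] {B' : LinearMap.BilinForm R V'} {e' : Module.End R V'}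
    {v' : D.Str → V'} (h : IsNormalForm B e D v) (he : IsSkew B e)
    (h' : IsNormalForm B' e' D v') (he' : IsSkew B' e') :
    ∃ f : V ≃ₗ[R] V', (∀ x y, B' (f x) (f y) = B x y) ∧ (∀ x, f (e x) = e' (f x)) ∧
      ∀ x, f (chain e v x) = chain e' v' x := by
  let f := (h.basis he).equiv (h'.basis he') (Equiv.refl _)
  have hf : ∀ x, f (chain e v x) = chain e' v' x := fun x => by
    rw [← h.basis_apply he, Module.Basis.equiv_apply, h'.basis_apply, Equiv.refl_apply]
  have hf' : ∀ s n, f ((e ^ n) (v s)) = (e' ^ n) (v' s) := by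
    intro s n
    by_cases hn : n < D.len s
    · exact hf ⟨s, n, hn⟩
    · obtain ⟨c, rfl⟩ := Nat.exists_eq_add_of_le (not_lt.1 hn)
      rw [add_comm, pow_add, pow_add, Module.End.mul_apply, Module.End.mul_apply, h.pow_eq_zero,
        h'.pow_eq_zero]
      simp
  refine ⟨f, ?_, ?_, hf⟩
  · have : B'.compl₁₂ f.toLinearMap f.toLinearMap = B := by
      refine (h.basis he).ext fun x => (h.basis he).ext fun y => ?_
      simp only [LinearMap.compl₁₂_apply, LinearEquiv.coe_coe, h.basis_apply, hf,
        h.form_chain he, h'.form_chain he']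
    intro x y
    conv_rhs => rw [← this]
    rfl
  · have : f.toLinearMap ∘ₗ e = e' ∘ₗ f.toLinearMap := by
      refine (h.basis he).ext fun x => ?_
      simp only [LinearMap.comp_apply, LinearEquiv.coe_coe, h.basis_apply, hf]
      simp only [chain]
      rw [← Module.End.mul_apply, ← Module.End.mul_apply, ← pow_succ', ← pow_succ', hf']
    exact fun x => LinearMap.congr_fun this x

end NormalForm

/-! ### Existence of normal forms -/

namespace StringData

/-- The disjoint union of two string data. -/
@[reducible] def add (D D' : StringData) : StringData where
  I := D.I ⊕ D'.I
  J := D.J ⊕ D'.J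
  p := Sum.elim D.p D'.p
  q := Sum.elim D.q D'.q

/-- Combine string heads for two data into string heads for their disjoint union. -/
def addHeads {X : Type*} {D D' : StringData} (v : D.Str → X) (v' : D'.Str → X) :
    (D.add D').Str → X
  | Sum.inl (Sum.inl i) => v (Sum.inl i)
  | Sum.inl (Sum.inr i) => v' (Sum.inl i)
  | Sum.inr (Sum.inl j, x) => v (Sum.inr (j, x))
  | Sum.inr (Sum.inr j, x) => v' (Sum.inr (j, x))

/-- The datum consisting of a single string of length `2 n + 2`. -/
@[reducible] def single (n : ℕ) : StringData where
  I := Unit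
  J := Empty
  p := fun _ => n
  q := Empty.elim

/-- The datum consisting of a single pair of strings of length `2 n + 1`. -/
@[reducible] def pair (n : ℕ) : StringData where
  I := Empty
  J := Unit
  p := Empty.elim
  q := fun _ => n

/-- The empty datum. -/
@[reducible] def empty : StringData where
  I := Empty
  J := Empty
  p := Empty.elim
  q := Empty.elim

theorem sum_len_add (D D' : StringData) :
    ∑ s, (D.add D').len s = ∑ s, D.len s + ∑ s, D'.len s := by
  simp only [Fintype.sum_sum_type, Fintype.sum_prod_type, len, Sum.elim_inl, Sum.elim_inr]
  ring

end StringData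

section

variable {R : Type*} [Field R]

section

variable {V : Type*} [AddCommGroup V] [Module R V]
  {B : LinearMap.BilinForm R V} {e : Module.End R V}

theorem IsStrings.add {D D' : StringData} {v : D.Str → V} {v' : D'.Str → V}
    (h : IsStrings B e D v) (h' : IsStrings B e D' v')
    (horth : ∀ s s' n, B (v s) ((e ^ n) (v' s')) = 0)
    (horth' : ∀ s s' n, B (v' s') ((e ^ n) (v s)) = 0) :
    IsStrings B e (D.add D') (StringData.addHeads v v') where
  pow_eq_zero := by
    rintro ((i | i) | ⟨j | j, x⟩)
    · exact h.pow_eq_zero (Sum.inl i)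
    · exact h'.pow_eq_zero (Sum.inl i)
    · exact h.pow_eq_zero (Sum.inr (j, x))
    · exact h'.pow_eq_zero (Sum.inr (j, x))
  form := by
    rintro ((i | i) | ⟨j | j, x⟩) ((i' | i') | ⟨j' | j', x'⟩) n <;>
    simp [StringData.addHeads, h.form, h'.form, horth, horth', StringData.len, StringData.sgn,
      StringData.swap]

theorem IsSkew.apply_self_eq_zero (h2 : (2 : R) ≠ 0) (hB : B.IsAlt) (he : IsSkew B e) (v : V)
    {n : ℕ} (hn : Even n) : B v ((e ^ n) v) = 0 := by
  have h1 := he.pow_left n v v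
  rw [← hB.neg_eq v ((e ^ n) v), hn.neg_one_pow] at h1
  have h3 : (2 : R) * B v ((e ^ n) v) = 0 := by linear_combination -h1
  exact (mul_eq_zero.1 h3).resolve_left h2

theorem IsSkew.apply_comm (hB : B.IsAlt) (he : IsSkew B e) (v w : V) (n : ℕ) :
    B w ((e ^ n) v) = (-1) ^ (n + 1) * B v ((e ^ n) w) := by
  rw [← hB.neg_eq ((e ^ n) v) w, he.pow_left]
  ring

theorem pow_apply_eq_zero_of_le {m n : ℕ} (hm : e ^ m = 0) (hn : m ≤ n) (v : V) :
    (e ^ n) v = 0 := by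
  rw [pow_eq_zero_of_le hn hm, LinearMap.zero_apply]

/-- A vector `v` with `B v (e ^ M v) = 1`, where `e ^ (M + 1) = 0` and `M` is odd, can be corrected
so that `B v (e ^ n v) = 0` for all other `n`; the pairings are killed from the top degree down. -/
theorem exists_head_single (h2 : (2 : R) ≠ 0) (hB : B.IsAlt) (he : IsSkew B e) {M : ℕ}
    (hM : Odd M) (hMe : e ^ (M + 1) = 0) {v₀ : V} (hv₀ : B v₀ ((e ^ M) v₀) = 1) :
    ∃ v, ∀ n, B v ((e ^ n) v) = if n = M then 1 else 0 := by
  have key : ∀ j, ∃ v, B v ((e ^ M) v) = 1 ∧ ∀ n, M ≤ n + j → n < M → B v ((e ^ n) v) = 0 := by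
    intro j
    induction j with
    | zero => exact ⟨v₀, hv₀, fun n h h' => by omega⟩
    | succ j ih =>
      obtain ⟨v, hv, hvn⟩ := ih
      by_cases hj : M < j + 1
      · exact ⟨v, hv, fun n _ h' => hvn n (by omega) h'⟩
      obtain ⟨n₀, hn₀⟩ := Nat.exists_eq_add_of_le (not_lt.1 hj)
      rcases Nat.even_or_odd n₀ with hev | hodd
      · refine ⟨v, hv, fun n h h' => ?_⟩
        by_cases hn : n = n₀
        · rw [hn, he.apply_self_eq_zero h2 hB v hev]
        · exact hvn n (by omega) h'
      have hj' : Even (j + 1) := by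
        rw [hn₀, Nat.odd_add] at hM
        exact Nat.not_odd_iff_even.1 fun h => Nat.not_even_iff_odd.2 hodd (hM.1 h)
      have expand : ∀ (c : R) n, B (v + c • (e ^ (j + 1)) v) ((e ^ n) (v + c • (e ^ (j + 1)) v)) =
          B v ((e ^ n) v) + 2 * c * B v ((e ^ (j + 1 + n)) v) +
            c ^ 2 * B v ((e ^ (j + 1 + (j + 1 + n))) v) := by
        intro c n
        simp only [map_add, map_smul, LinearMap.add_apply, LinearMap.smul_apply, smul_eq_mul]
        rw [he.pow_pow, hj'.neg_one_pow, ← Module.End.mul_apply, ← pow_add, add_comm n (j + 1),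
          he.pow_pow, hj'.neg_one_pow]
        ring
      refine ⟨v + (-B v ((e ^ n₀) v) / 2) • (e ^ (j + 1)) v, ?_, fun n h h' => ?_⟩
      · rw [expand, hv, pow_apply_eq_zero_of_le (n := j + 1 + M) hMe (by omega),
          pow_apply_eq_zero_of_le (n := j + 1 + (j + 1 + M)) hMe (by omega)]
        simp
      · rw [expand, pow_apply_eq_zero_of_le (n := j + 1 + (j + 1 + n)) hMe (by omega)]
        by_cases hn : n = n₀
        · subst hn
          rw [← hn₀, hv]
          field_simp
          simp
        · rw [hvn n (by omega) h', pow_apply_eq_zero_of_le (n := j + 1 + n) hMe (by omega)]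
          simp
  obtain ⟨v, hv, hvn⟩ := key M
  refine ⟨v, fun n => ?_⟩
  split_ifs with hn
  · rw [hn, hv]
  · rcases lt_or_ge n M with h | h
    · exact hvn n (by omega) h
    · rw [pow_apply_eq_zero_of_le hMe (by omega), map_zero]

/-- The analogue of `exists_head_single` for a pair of strings of odd length `M + 1`. -/
theorem exists_head_pair (h2 : (2 : R) ≠ 0) (hB : B.IsAlt) (he : IsSkew B e) {M : ℕ}
    (hM : Even M) (hMe : e ^ (M + 1) = 0) {v₀ w₀ : V} (hv₀ : B v₀ ((e ^ M) w₀) = 1) :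
    ∃ v w, (∀ n, B v ((e ^ n) w) = if n = M then 1 else 0) ∧ (∀ n, B v ((e ^ n) v) = 0) ∧
      ∀ n, B w ((e ^ n) w) = 0 := by
  have key : ∀ j, ∃ v w, B v ((e ^ M) w) = 1 ∧ ∀ n, M ≤ n + j → n < M →
      B v ((e ^ n) w) = 0 ∧ B v ((e ^ n) v) = 0 ∧ B w ((e ^ n) w) = 0 := by
    intro j
    induction j with
    | zero => exact ⟨v₀, w₀, hv₀, fun n h h' => by omega⟩
    | succ j ih =>
      obtain ⟨v, w, hv, hvn⟩ := ih
      by_cases hj : M < j + 1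
      · exact ⟨v, w, hv, fun n _ h' => hvn n (by omega) h'⟩
      obtain ⟨n₀, hn₀⟩ := Nat.exists_eq_add_of_le (not_lt.1 hj)
      have hwv : B w ((e ^ M) v) = -1 := by
        rw [he.apply_comm hB, hv, hM.add_one.neg_one_pow, mul_one]
      have hvv := he.apply_self_eq_zero h2 hB v hM
      have hww := he.apply_self_eq_zero h2 hB w hM
      -- the correction of `v` along `w` and of `w` along both heads; `δ = 0` when `j + 1` is even
      obtain ⟨β, hβ⟩ : ∃ β : R, B v ((e ^ n₀) v) + β * (1 - (-1) ^ (j + 1)) = 0 := by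
        rcases Nat.even_or_odd (j + 1) with h | h
        · have : Even n₀ := by
            rw [hn₀, Nat.even_add] at hM
            exact hM.1 h
          exact ⟨0, by rw [he.apply_self_eq_zero h2 hB v this]; ring⟩
        · refine ⟨-B v ((e ^ n₀) v) / 2, ?_⟩
          rw [h.neg_one_pow]
          field_simp
          ring
      obtain ⟨δ, hδ⟩ : ∃ δ : R, B w ((e ^ n₀) w) + δ * (-1 + (-1) ^ (j + 1)) = 0 := by
        rcases Nat.even_or_odd (j + 1) with h | h
        · have : Even n₀ := by
            rw [hn₀, Nat.even_add] at hM
            exact hM.1 h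
          exact ⟨0, by rw [he.apply_self_eq_zero h2 hB w this]; ring⟩
        · refine ⟨B w ((e ^ n₀) w) / 2, ?_⟩
          rw [h.neg_one_pow]
          field_simp
          ring
      have expand : ∀ (x y x' y' : V) n, M ≤ n + (j + 1) →
          B (x + (e ^ (j + 1)) x') ((e ^ n) (y + (e ^ (j + 1)) y')) =
          B x ((e ^ n) y) + B x ((e ^ (j + 1 + n)) y') +
            (-1) ^ (j + 1) * B x' ((e ^ (j + 1 + n)) y) := by
        intro x y x' y' n hn
        simp only [map_add, LinearMap.add_apply]
        rw [he.pow_pow, ← Module.End.mul_apply, ← pow_add, add_comm n (j + 1),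
          he.pow_pow, pow_apply_eq_zero_of_le (n := j + 1 + (j + 1 + n)) hMe (by omega)]
        simp only [map_zero, add_zero, mul_zero]
        ring
      refine ⟨v + (e ^ (j + 1)) (β • w),
        w + (e ^ (j + 1)) (-B v ((e ^ n₀) w) • w + δ • v), ?_, fun n h h' => ?_⟩
      · rw [expand _ _ _ _ _ (by omega), hv, pow_apply_eq_zero_of_le hMe (by omega),
          pow_apply_eq_zero_of_le hMe (by omega)]
        simp
      · rw [expand _ _ _ _ _ h, expand _ _ _ _ _ h, expand _ _ _ _ _ h]
        by_cases hn : n = n₀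
        · subst hn
          rw [← hn₀]
          simp only [map_add, map_smul, LinearMap.add_apply, LinearMap.smul_apply, smul_eq_mul,
            hv, hwv, hvv, hww]
          refine ⟨by ring, ?_, ?_⟩
          · linear_combination hβ
          · linear_combination hδ
        · obtain ⟨h3, h4, h5⟩ := hvn n (by omega) h'
          rw [h3, h4, h5]
          simp only [pow_apply_eq_zero_of_le (n := j + 1 + n) hMe (by omega), map_zero, mul_zero,
            add_zero, and_self]
  obtain ⟨v, w, hv, hvn⟩ := key M
  refine ⟨v, w, fun n => ?_, fun n => ?_, fun n => ?_⟩
  · split_ifs with hn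
    · rw [hn, hv]
    · rcases lt_or_ge n M with h | h
      · exact (hvn n (by omega) h).1
      · rw [pow_apply_eq_zero_of_le hMe (by omega), map_zero]
  · rcases lt_trichotomy n M with h | rfl | h
    · exact (hvn n (by omega) h).2.1
    · exact he.apply_self_eq_zero h2 hB v hM
    · rw [pow_apply_eq_zero_of_le hMe (by omega), map_zero]
  · rcases lt_trichotomy n M with h | rfl | h
    · exact (hvn n (by omega) h).2.2
    · exact he.apply_self_eq_zero h2 hB w hM
    · rw [pow_apply_eq_zero_of_le hMe (by omega), map_zero]

/-- The strings of maximal length: unless `V = 0` there is a single string or a pair of strings. -/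
theorem exists_strings (h2 : (2 : R) ≠ 0) (hB : B.IsAlt) (hBn : B.Nondegenerate)
    (he : IsSkew B e) (hnil : IsNilpotent e) (hsq : (∀ x : R, IsSquare x) ∨ e = 0)
    [Nontrivial V] :
    ∃ (D : StringData) (v : D.Str → V), IsStrings B e D v ∧ 0 < ∑ s, D.len s := by
  obtain ⟨M, hM0, hMe⟩ : ∃ M, e ^ M ≠ 0 ∧ e ^ (M + 1) = 0 := by
    classical
    refine ⟨nilpotencyClass e - 1, pow_pred_nilpotencyClass hnil, ?_⟩
    rw [Nat.sub_add_cancel (pos_nilpotencyClass_iff.2 hnil)]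
    exact pow_nilpotencyClass hnil
  obtain ⟨v, w, hvw⟩ : ∃ v w, B v ((e ^ M) w) ≠ 0 := by
    by_contra! h
    exact hM0 (LinearMap.ext fun w => hBn.2 _ fun v => h v w)
  rcases Nat.even_or_odd M with hM | hM
  · obtain ⟨v, w, h1, h3, h4⟩ := exists_head_pair h2 hB he hM hMe (v₀ := v)
      (w₀ := (B v ((e ^ M) w))⁻¹ • w) (by simp [hvw])
    obtain ⟨q, rfl⟩ := hM
    have h5 : ∀ n, B w ((e ^ n) v) = if n = q + q then -1 else 0 := fun n => by
      rw [he.apply_comm hB, h1]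
      split_ifs with hn
      · rw [hn, Odd.neg_one_pow ⟨q, by ring⟩, mul_one]
      · simp
    refine ⟨StringData.pair q, Sum.elim Empty.elim fun j => if j.2 then w else v,
      ⟨?_, ?_⟩, ?_⟩
    · rintro (i | ⟨j, x⟩)
      · exact i.elim
      · exact pow_apply_eq_zero_of_le hMe (by simp [StringData.len]; omega) _
    · rintro (i | ⟨j, x⟩) (i' | ⟨j', x'⟩) n
      · exact i.elim
      · exact i.elim
      · exact i'.elim
      · have hn : n = q + q ↔ n = 2 * q := by omega
        cases x <;> cases x' <;>
        simp [StringData.swap, StringData.len, StringData.sgn, h1, h3, h4, h5, hn]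
    · simp [StringData.len]
  · obtain ⟨v, hv⟩ : ∃ v, B v ((e ^ M) v) ≠ 0 := by
      by_contra! h
      have h1 := h (v + w)
      simp only [map_add, LinearMap.add_apply, h v, h w, he.apply_comm hB v w,
        hM.add_one.neg_one_pow] at h1
      have h3 : (2 : R) * B v ((e ^ M) w) = 0 := by linear_combination h1
      exact hvw ((mul_eq_zero.1 h3).resolve_left h2)
    have hsq' : ∀ x : R, IsSquare x := hsq.resolve_right fun h => hM0 (by
      rw [h, zero_pow hM.pos.ne'])
    obtain ⟨c, hc⟩ := hsq' (B v ((e ^ M) v))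
    have hc0 : c ≠ 0 := by rintro rfl; exact hv (by simpa using hc)
    obtain ⟨v, h1⟩ := exists_head_single h2 hB he hM hMe (v₀ := c⁻¹ • v) (by
      simp only [map_smul, LinearMap.smul_apply, smul_eq_mul, hc]
      field_simp)
    obtain ⟨p, rfl⟩ := hM
    refine ⟨StringData.single p, fun _ => v, ⟨?_, ?_⟩, ?_⟩
    · rintro (i | ⟨j, x⟩)
      · exact pow_apply_eq_zero_of_le hMe (by simp [StringData.len]) _
      · exact j.elim
    · rintro (i | ⟨j, x⟩) (i' | ⟨j', x'⟩) n
      · simp [StringData.swap, StringData.len, StringData.sgn, h1]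
      · exact j'.elim
      · exact j.elim
      · exact j.elim
    · simp [StringData.len]

end

/-- A skew nilpotent endomorphism of a symplectic space has a normal form if the field has all
square roots.  No square roots are needed for the zero endomorphism, for which the statement gives
a symplectic basis. -/
theorem exists_isNormalForm (h2 : (2 : R) ≠ 0) :
    ∀ (n : ℕ) {V : Type*} [AddCommGroup V] [Module R V] [FiniteDimensional R V]
      {B : LinearMap.BilinForm R V} {e : Module.End R V}, Module.finrank R V = n →
      B.IsAlt → B.Nondegenerate → IsSkew B e → IsNilpotent e →
      ((∀ x : R, IsSquare x) ∨ e = 0) →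
      ∃ (D : StringData) (v : D.Str → V), IsNormalForm B e D v := by
  intro n
  induction n using Nat.strong_induction_on with
  | _ n ih =>
  intro V _ _ _ B e hn hB hBn he hnil hsq
  rcases subsingleton_or_nontrivial V with hV | hV
  · refine ⟨StringData.empty, fun _ => 0, ⟨fun s => by simp, fun s => ?_⟩, ?_⟩
    · rcases s with i | ⟨j, x⟩
      · exact i.elim
      · exact j.elim
    · rw [Module.finrank_zero_of_subsingleton]
      simp
  obtain ⟨D, v, hv, hpos⟩ := exists_strings h2 hB hBn he hnil hsq
  let W := Submodule.span R (Set.range (chain e v))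
  have hWmem : ∀ x, x ∈ B.orthogonal W ↔ ∀ s k, B ((e ^ k) (v s)) x = 0 := by
    intro x
    rw [LinearMap.BilinForm.mem_orthogonal_iff]
    constructor
    · intro h s k
      by_cases hk : k < D.len s
      · exact h _ (Submodule.subset_span ⟨⟨s, k, hk⟩, rfl⟩)
      · obtain ⟨c, rfl⟩ := Nat.exists_eq_add_of_le (not_lt.1 hk)
        rw [add_comm, pow_add, Module.End.mul_apply, hv.pow_eq_zero]
        simp
    · intro h w hw
      have : W ≤ LinearMap.ker (B.flip x) := by
        rw [Submodule.span_le]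
        rintro _ ⟨y, rfl⟩
        exact h _ _
      exact this hw
  have hdisj : Disjoint W (B.orthogonal W) := by
    rw [Submodule.disjoint_def]
    intro x hx hx'
    obtain ⟨c, rfl⟩ := (Submodule.mem_span_range_iff_exists_fun R).1 hx
    refine Finset.sum_eq_zero fun y _ => ?_
    have h0 : B (chain e v (D.opp y)) (∑ x, c x • chain e v x) = 0 :=
      (hWmem _).1 hx' _ _
    simp only [map_sum, map_smul, hv.form_chain he, StringData.opp_opp, smul_eq_mul, mul_ite,
      mul_zero, Finset.sum_ite_eq', Finset.mem_univ, if_true] at h0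
    rw [(mul_eq_zero.1 h0).resolve_right (intUnit_cast_ne_zero _), zero_smul]
  have hfin : Module.finrank R W = ∑ s, D.len s := by
    rw [finrank_span_eq_card (hv.linearIndependent_chain he), D.card_idx]
  have hfin' : Module.finrank R (B.orthogonal W) = n - ∑ s, D.len s := by
    rw [LinearMap.BilinForm.finrank_orthogonal hBn, hfin, hn]
  have hle : ∑ s, D.len s ≤ n := by
    rw [← hfin, ← hn]
    exact Submodule.finrank_le _
  have hnd : (B.restrict (B.orthogonal W)).Nondegenerate := by
    apply LinearMap.BilinForm.nondegenerate_restrict_of_disjoint_orthogonal _ hB.isRefl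
    rw [LinearMap.BilinForm.orthogonal_orthogonal hBn hB.isRefl]
    exact hdisj.symm
  have hstab : ∀ x ∈ B.orthogonal W, e x ∈ B.orthogonal W := by
    intro x hx
    rw [hWmem] at hx ⊢
    intro s k
    have := he ((e ^ k) (v s)) x
    rw [← Module.End.mul_apply, ← pow_succ', hx] at this
    exact neg_eq_zero.1 this.symm
  have hpow : ∀ k (x : B.orthogonal W), (((e.restrict hstab) ^ k) x : V) = (e ^ k) x := by
    intro k x
    rw [Module.End.pow_restrict k]
    rfl
  obtain ⟨D', v', hv'⟩ := ih (n - ∑ s, D.len s) (by omega) hfin'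
    (B := B.restrict (B.orthogonal W)) (e := e.restrict hstab) (fun x => hB x) hnd
    (fun x y => he x y) (by
      obtain ⟨k, hk⟩ := hnil
      exact ⟨k, LinearMap.ext fun x => Subtype.ext (by rw [hpow, hk]; rfl)⟩)
    (hsq.imp id fun h => LinearMap.ext fun x => Subtype.ext (by simp [h]))
  have horth : ∀ s s' k, B (v s) ((e ^ k) (v' s')) = 0 := by
    intro s s' k
    have h1 := (hWmem _).1 (v' s').2 s k
    rw [he.pow_left] at h1
    exact (mul_eq_zero.1 h1).resolve_left (by simp)
  refine ⟨D.add D', StringData.addHeads v fun s => (v' s : V), hv.add ⟨fun s => ?_, ?_⟩ horth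
    (fun s s' k => ?_), ?_⟩
  · rw [← hpow, hv'.pow_eq_zero]
    rfl
  · intro s s' k
    rw [← hv'.form, ← hpow]
    rfl
  · rw [he.apply_comm hB, horth, mul_zero]
  · rw [hn, StringData.sum_len_add, ← hv'.finrank_eq, hfin']
    omega

end

/-! ### The model of a normal form -/

section Model

variable (R : Type*) [Field R] (D : StringData)

/-- The form of the standard model of a string datum. -/
def modelForm : LinearMap.BilinForm R (D.Idx → R) :=
  Matrix.toBilin' (Matrix.of fun x y => if y = D.opp x then ((D.eta x : ℤ) : R) else 0)

/-- The nilpotent endomorphism of the standard model of a string datum. -/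
def modelRaise : Module.End R (D.Idx → R) :=
  (Pi.basisFun R D.Idx).constr R fun x =>
    if h : (x.2 : ℕ) + 1 < D.len x.1 then Pi.single ⟨x.1, ⟨x.2 + 1, h⟩⟩ 1 else 0

/-- The string heads of the standard model of a string datum. -/
def modelHead (s : D.Str) : D.Idx → R := Pi.single ⟨s, ⟨0, D.len_pos s⟩⟩ 1

variable {D}

theorem modelForm_single (x y : D.Idx) :
    modelForm R D (Pi.single x 1) (Pi.single y 1) =
      if y = D.opp x then ((D.eta x : ℤ) : R) else 0 := by
  rw [modelForm, Matrix.toBilin'_single, Matrix.of_apply]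

theorem modelRaise_single (x : D.Idx) :
    modelRaise R D (Pi.single x 1) =
      if h : (x.2 : ℕ) + 1 < D.len x.1 then Pi.single ⟨x.1, ⟨x.2 + 1, h⟩⟩ 1 else 0 := by
  rw [modelRaise, ← Pi.basisFun_apply, Module.Basis.constr_basis]

variable (D)

theorem isSkew_model : IsSkew (modelForm R D) (modelRaise R D) := by
  have : (modelForm R D).comp (modelRaise R D) LinearMap.id =
      -(modelForm R D).comp LinearMap.id (modelRaise R D) := by
    refine (Pi.basisFun R D.Idx).ext fun x => (Pi.basisFun R D.Idx).ext fun y => ?_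
    simp only [LinearMap.BilinForm.comp_apply, LinearMap.neg_apply, Pi.basisFun_apply,
      modelRaise_single, LinearMap.id_apply]
    have hx := x.2.2
    have hy := y.2.2
    by_cases h : y.1 = D.swap x.1 ∧ (x.2 : ℕ) + 1 + y.2 + 1 = D.len x.1
    · have hl : D.len y.1 = D.len x.1 := by rw [h.1, D.len_swap]
      have h1 : (x.2 : ℕ) + 1 < D.len x.1 := by omega
      have h2 : (y.2 : ℕ) + 1 < D.len y.1 := by omega
      have h3 : (⟨y.1, ⟨y.2 + 1, h2⟩⟩ : D.Idx) = D.opp x :=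
        StringData.eq_opp_iff.2 ⟨h.1, by simp only; omega⟩
      rw [dif_pos h1, dif_pos h2, modelForm_single, if_pos (StringData.eq_opp_iff.2 h),
        modelForm_single, if_pos h3]
      simp [StringData.eta, pow_succ]
    · have h1 : ∀ h', ¬ y = D.opp ⟨x.1, ⟨x.2 + 1, h'⟩⟩ := fun h' => by
        rwa [StringData.eq_opp_iff]
      have h2 : ∀ h', ¬ (⟨y.1, ⟨y.2 + 1, h'⟩⟩ : D.Idx) = D.opp x := fun h' => by
        rw [StringData.eq_opp_iff]
        rintro ⟨h3, h4⟩
        exact h ⟨h3, by simp only at h4; omega⟩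
      split_ifs <;> simp [modelForm_single, h1, h2]
  intro v w
  exact congrArg (fun C : LinearMap.BilinForm R (D.Idx → R) => C v w) this

theorem modelRaise_pow (s : D.Str) (n : ℕ) :
    (modelRaise R D ^ n) (modelHead R D s) =
      if h : n < D.len s then Pi.single ⟨s, ⟨n, h⟩⟩ 1 else 0 := by
  induction n with
  | zero => simp [modelHead, D.len_pos]
  | succ n ih =>
    rw [pow_succ', Module.End.mul_apply, ih]
    split_ifs with h1 h3 h3
    · rw [modelRaise_single, dif_pos h3]
    · rw [modelRaise_single, dif_neg h3]
    · omega
    · simp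

theorem isNormalForm_model : IsNormalForm (modelForm R D) (modelRaise R D) D (modelHead R D) where
  pow_eq_zero s := by rw [modelRaise_pow, dif_neg (lt_irrefl _)]
  form s s' n := by
    rw [modelRaise_pow]
    split_ifs with h1 h2 h2
    · rw [modelHead, modelForm_single, if_pos (StringData.eq_opp_iff.2 ⟨h2.1, by simpa using h2.2⟩)]
      simp [StringData.eta]
    · rw [modelHead, modelForm_single, if_neg]
      rw [StringData.eq_opp_iff]
      exact fun h => h2 ⟨h.1, by simpa using h.2⟩
    · rw [h2.1, D.len_swap] at h1
      omega
    · simp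
  finrank_eq := by simp

end Model

/-! ### Jordan types -/

section Jordan

variable {K : Type*} [Field K] {V : Type*} [AddCommGroup V] [Module K V]

/-- The elements of a family of Jordan strings are linearly independent if the last elements of
the strings are. -/
theorem linearIndependent_strings {x : Module.End K V} {S : Type*} [Fintype S] {m : S → ℕ}
    {w : S → V} (h0 : ∀ s, (x ^ m s) (w s) = 0)
    (hli : LinearIndependent K fun s => (x ^ (m s - 1)) (w s)) :
    LinearIndependent K fun y : Σ s, Fin (m s) => (x ^ (y.2 : ℕ)) (w y.1) := by
  classical
  rw [Fintype.linearIndependent_iff] at hli ⊢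
  intro c hc
  -- the coefficients at distance `N` from the end of the strings vanish, by induction on `N`
  -- downwards
  have key : ∀ d N, (∑ s, m s) ≤ N + d → ∀ y : Σ s, Fin (m s), N ≤ m y.1 - 1 - y.2 → c y = 0 := by
    intro d
    induction d with
    | zero =>
      intro N hN y hy
      have h1 : m y.1 ≤ ∑ s, m s := Finset.single_le_sum (fun _ _ => Nat.zero_le _)
        (Finset.mem_univ _)
      have := y.2.2
      omega
    | succ d ih =>
      intro N hN y hy
      rcases Nat.lt_or_ge N (m y.1 - 1 - y.2) with hlt | hge
      · exact ih (N + 1) (by omega) y hlt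
      have hyN : m y.1 - 1 - y.2 = N := le_antisymm hge hy
      have h1 := congrArg (x ^ N) hc
      rw [map_sum, map_zero, Fintype.sum_sigma] at h1
      let c' : S → K := fun s => if h : N < m s then c ⟨s, ⟨m s - 1 - N, by omega⟩⟩ else 0
      have h2 : ∑ s, c' s • (x ^ (m s - 1)) (w s) = 0 := by
        rw [← h1]
        refine Finset.sum_congr rfl fun s _ => ?_
        have hterm : ∀ a : Fin (m s), (x ^ N) (c ⟨s, a⟩ • (x ^ (a : ℕ)) (w s)) =
            if (a : ℕ) + N + 1 = m s then c ⟨s, a⟩ • (x ^ (m s - 1)) (w s) else 0 := by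
          intro a
          have ha := a.2
          rw [map_smul, ← Module.End.mul_apply, ← pow_add]
          split_ifs with hs
          · rw [show N + (a : ℕ) = m s - 1 by omega]
          · rcases Nat.lt_or_ge ((a : ℕ) + N + 1) (m s) with h3 | h3
            · rw [ih (N + 1) (by omega) ⟨s, a⟩ (by simp only; omega), zero_smul]
            · obtain ⟨k, hk⟩ := Nat.exists_eq_add_of_le (show m s ≤ N + a by omega)
              rw [hk, add_comm, pow_add, Module.End.mul_apply, h0, map_zero, smul_zero]
        rw [Finset.sum_congr rfl fun a _ => hterm a]
        by_cases hs : N < m s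
        · rw [Finset.sum_eq_single (⟨m s - 1 - N, by omega⟩ : Fin (m s))]
          · rw [if_pos (by simp only; omega)]
            simp only [c', dif_pos hs]
          · intro a _ ha
            rw [if_neg]
            intro h3
            exact ha (Fin.ext (by simp only; omega))
          · simp
        · simp only [c', dif_neg hs, zero_smul]
          symm
          refine Finset.sum_eq_zero fun a _ => ?_
          rw [if_neg]
          omega
      have h3 := hli c' h2 y.1
      have hy2 := y.2.2
      simp only [c'] at h3
      rw [dif_pos (by omega)] at h3
      rw [← h3]
      congr 1
      exact Sigma.ext rfl (heq_of_eq (Fin.ext (by simp only; omega)))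
  exact fun y => key _ 0 (Nat.le_add_left _ _) y (Nat.zero_le _)

theorem hasJordanType_of_strings [FiniteDimensional K V] {x : Module.End K V} {S : Type*}
    [Fintype S] {m : S → ℕ} {w : S → V} (h0 : ∀ s, (x ^ m s) (w s) = 0)
    (hli : LinearIndependent K fun s => (x ^ (m s - 1)) (w s))
    (hfin : Module.finrank K V = ∑ s, m s) :
    HasJordanType x (Finset.univ.val.map m) := by
  let f := (Fintype.equivFin S).symm
  have hli' := linearIndependent_strings (x := x) (m := fun i => m (f i)) (w := fun i => w (f i))
    (fun i => h0 _) (hli.comp f f.injective)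
  have hcard : Fintype.card (Σ i, Fin (m (f i))) = Module.finrank K V := by
    rw [hfin, Fintype.card_sigma, ← f.sum_comp]
    simp
  refine ⟨Fintype.card S, fun i => m (f i), Module.Basis.mk hli'
    (hli'.span_eq_top_of_card_eq_finrank' hcard).ge, ?_, ?_⟩
  · rw [← Multiset.map_univ_val_equiv f, Multiset.map_map]
    rfl
  · intro s i
    split_ifs with h
    · simp only [Module.Basis.mk_apply]
      rw [← Module.End.mul_apply, ← pow_succ']
    · have h1 : (i : ℕ) < m (f s) := i.2
      have h3 : ¬ (i : ℕ) + 1 < m (f s) := h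
      simp only [Module.Basis.mk_apply]
      rw [← Module.End.mul_apply, ← pow_succ', show (i : ℕ) + 1 = m (f s) by omega, h0]

theorem HasJordanType.conj {x : Module.End K V} {P : Multiset ℕ} (h : HasJordanType x P)
    {V' : Type*} [AddCommGroup V'] [Module K V'] {x' : Module.End K V'} (f : V ≃ₗ[K] V')
    (hf : ∀ v, f (x v) = x' (f v)) : HasJordanType x' P := by
  obtain ⟨r, m, b, hP, hb⟩ := h
  refine ⟨r, m, b.map f, hP, fun s i => ?_⟩
  rw [Module.Basis.map_apply, ← hf, hb]
  split_ifs <;> simp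

theorem HasJordanType.finrank_range_pow {x : Module.End K V} {P : Multiset ℕ}
    (h : HasJordanType x P) (j : ℕ) :
    Module.finrank K (LinearMap.range (x ^ j)) = (P.map fun a => a - j).sum := by
  obtain ⟨r, m, b, rfl, hb⟩ := h
  have hpow : ∀ j s (i : Fin (m s)), (x ^ j) (b ⟨s, i⟩) =
      if h : (i : ℕ) + j < m s then b ⟨s, ⟨i + j, h⟩⟩ else 0 := by
    intro j s i
    induction j with
    | zero => simp
    | succ j ih =>
      rw [pow_succ', Module.End.mul_apply, ih]
      by_cases h : (i : ℕ) + j < m s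
      · rw [dif_pos h, hb]
        rfl
      · rw [dif_neg h, dif_neg (by omega), map_zero]
  let c : (Σ s, Fin (m s - j)) → V := fun y => b ⟨y.1, ⟨y.2 + j, by have := y.2.2; omega⟩⟩
  have hc : LinearIndependent K c := by
    refine b.linearIndependent.comp
      (fun y : Σ s, Fin (m s - j) => (⟨y.1, ⟨y.2 + j, by have := y.2.2; omega⟩⟩ :
        Σ s, Fin (m s))) ?_
    rintro ⟨s, a⟩ ⟨s', a'⟩ h
    obtain ⟨rfl, h⟩ := Sigma.mk.inj_iff.1 h
    have := congrArg Fin.val (eq_of_heq h)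
    simp only [Nat.add_right_cancel_iff] at this
    rw [Fin.ext this]
  have hspan : LinearMap.range (x ^ j) = Submodule.span K (Set.range c) := by
    apply le_antisymm
    · rw [LinearMap.range_eq_map, ← b.span_eq, Submodule.map_span, Submodule.span_le]
      rintro _ ⟨_, ⟨⟨s, i⟩, rfl⟩, rfl⟩
      rw [SetLike.mem_coe, hpow]
      split_ifs with h
      · exact Submodule.subset_span ⟨⟨s, ⟨i, by omega⟩⟩, rfl⟩
      · exact Submodule.zero_mem _
    · rw [Submodule.span_le]
      rintro _ ⟨⟨s, i⟩, rfl⟩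
      refine ⟨b ⟨s, ⟨i, by have := i.2; omega⟩⟩, ?_⟩
      rw [hpow, dif_pos (by have := i.2; simp only; omega)]
  rw [hspan, finrank_span_eq_card hc, Fintype.card_sigma, Multiset.map_map]
  simp only [Fintype.card_fin]
  rfl

/-- The multiplicity of `j + 1` is a second difference of the function `j ↦ ∑ max (a - j) 0`, which
gives the ranks of the powers. -/
theorem count_add_sum_tsub (P : Multiset ℕ) (j : ℕ) :
    P.count (j + 1) + 2 * (P.map fun a => a - (j + 1)).sum =
      (P.map fun a => a - j).sum + (P.map fun a => a - (j + 2)).sum := by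
  induction P using Multiset.induction with
  | empty => simp
  | cons a P ih =>
    simp only [Multiset.count_cons, Multiset.map_cons, Multiset.sum_cons]
    split_ifs <;> omega

/-- The positive parts of the Jordan type of `x` are determined by the ranks of the powers of
`x`. -/
theorem HasJordanType.count_eq {x : Module.End K V} {P P' : Multiset ℕ}
    (h : HasJordanType x P) (h' : HasJordanType x P') (n : ℕ) :
    P.count (n + 1) = P'.count (n + 1) := by
  have h1 := count_add_sum_tsub P n
  have h2 := count_add_sum_tsub P' n
  simp only [← h.finrank_range_pow] at h1
  simp only [← h'.finrank_range_pow] at h2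
  omega

theorem HasJordanType.unique {x : Module.End K V} {P P' : Multiset ℕ}
    (h : HasJordanType x P) (h' : HasJordanType x P') (h0 : 0 ∉ P) (h0' : 0 ∉ P') : P = P' := by
  ext n
  rcases n with _ | n
  · rw [Multiset.count_eq_zero_of_notMem h0, Multiset.count_eq_zero_of_notMem h0']
  · exact h.count_eq h' n

end Jordan

theorem StringData.zero_notMem_parts (D : StringData) : 0 ∉ D.parts := by
  rw [StringData.parts, Multiset.mem_map]
  rintro ⟨s, _, hs⟩
  exact (D.len_pos s).ne' hs

theorem StringData.even_count_parts (D : StringData) {n : ℕ} (hn : (-1 : ℤ) ^ n = -1) :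
    Even (D.parts.count n) := by
  rcases Nat.even_or_odd' n with ⟨a, rfl | rfl⟩
  · rw [Even.neg_one_pow ⟨a, by ring⟩] at hn
    norm_num at hn
  · rw [D.count_parts, D.card_len_odd, Fintype.card_prod, Fintype.card_bool]
    exact even_two.mul_left _

/-- Every multiset of positive integers in which the odd integers have even multiplicity comes
from a string datum. -/
theorem StringData.exists_parts_eq {P : Multiset ℕ} (h0 : 0 ∉ P)
    (hP : ∀ n, (-1 : ℤ) ^ n = -1 → Even (P.count n)) : ∃ D : StringData, D.parts = P := by
  have hcard : ∀ (f : ℕ → ℕ) (n : ℕ), n < P.sum + 1 →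
      Fintype.card {x : Σ n : Fin (P.sum + 1), Fin (f n) // (x.1 : ℕ) = n} = f n := by
    intro f n hn
    rw [← Fintype.card_fin (f n)]
    refine (Fintype.card_of_bijective (f := fun i : Fin (f n) =>
      (⟨⟨⟨n, hn⟩, i⟩, rfl⟩ : {x : Σ n : Fin (P.sum + 1), Fin (f n) // (x.1 : ℕ) = n}))
      ⟨?_, ?_⟩).symm
    · intro i j hij
      simpa using hij
    · rintro ⟨⟨⟨m, hm⟩, i⟩, rfl⟩
      exact ⟨i, rfl⟩
  have hcard' : ∀ (f : ℕ → ℕ) (n : ℕ), ¬ n < P.sum + 1 →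
      Fintype.card {x : Σ n : Fin (P.sum + 1), Fin (f n) // (x.1 : ℕ) = n} = 0 := by
    intro f n hn
    rw [Fintype.card_eq_zero_iff]
    exact ⟨fun x => hn (by rw [← x.2]; exact x.1.1.2)⟩
  have hbig : ∀ n, P.sum < n → P.count n = 0 := by
    intro n hn
    rw [Multiset.count_eq_zero]
    exact fun h => absurd (Multiset.le_sum_of_mem h) (by omega)
  let f : ℕ → ℕ := fun n => P.count (2 * n + 2)
  let g : ℕ → ℕ := fun n => P.count (2 * n + 1) / 2
  refine ⟨⟨Σ n : Fin (P.sum + 1), Fin (f n), Σ n : Fin (P.sum + 1), Fin (g n),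
    fun x => x.1, fun x => x.1⟩, ?_⟩
  ext n
  rcases Nat.even_or_odd' n with ⟨a, rfl | rfl⟩
  · rcases a with _ | a
    · rw [Multiset.count_eq_zero_of_notMem h0,
        Multiset.count_eq_zero_of_notMem (StringData.zero_notMem_parts _)]
    · rw [StringData.count_parts, show 2 * (a + 1) = 2 * a + 2 by ring, StringData.card_len_even]
      by_cases ha : a < P.sum + 1
      · exact hcard f a ha
      · rw [hbig _ (by omega)]
        exact hcard' f a ha
  · rw [StringData.count_parts, StringData.card_len_odd, Fintype.card_prod, Fintype.card_bool]
    by_cases ha : a < P.sum + 1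
    · rw [hcard g a ha]
      exact Nat.div_mul_cancel (hP _ (by rw [Odd.neg_one_pow ⟨a, rfl⟩])).two_dvd
    · rw [hcard' g a ha, hbig _ (by omega), zero_mul]

/-! ### Unipotent and nilpotent elements -/

section Cayley

variable {K : Type*} [Field K] {V : Type*} [AddCommGroup V] [Module K V]
  {B : LinearMap.BilinForm K V}

theorem mem_nilpotentCone_iff {e : Module.End K V} :
    e ∈ nilpotentCone B ↔ IsSkew B e ∧ IsNilpotent e := by
  have : e ∈ skewAdjointLieSubalgebra B ↔ IsSkew B e := by
    change e ∈ B.skewAdjointSubmodule ↔ _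
    rw [LinearMap.mem_skewAdjointSubmodule]
    constructor
    · intro h v w
      rw [← map_neg]
      exact h v w
    · intro h v w
      rw [h v w, Pi.neg_apply, map_neg]
  exact and_congr_left fun _ => this

/-- `u` is the Cayley transform `(1 + e) (1 - e)⁻¹` of `e`. -/
structure IsCayley (u : LinearMap.GeneralLinearGroup K V) (e : Module.End K V) : Prop where
  mul_eq : (1 - e) * u.val = 1 + e
  comm : Commute e u.val

theorem IsCayley.unique {u u' : LinearMap.GeneralLinearGroup K V} {e : Module.End K V}
    (h : IsCayley u e) (h' : IsCayley u' e) (he : IsNilpotent e) : u = u' := by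
  apply Units.ext
  exact (he.isUnit_one_sub).mul_left_cancel (h.mul_eq.trans h'.mul_eq.symm)

theorem IsCayley.conj {u : LinearMap.GeneralLinearGroup K V} {e : Module.End K V}
    (h : IsCayley u e) (g : LinearMap.GeneralLinearGroup K V) :
    IsCayley (g * u * g⁻¹) (g.val * e * g⁻¹.val) := by
  have hg : g⁻¹.val * g.val = 1 := Units.inv_mul g
  have hg' : g.val * g⁻¹.val = 1 := Units.mul_inv g
  constructor
  · calc (1 - g.val * e * g⁻¹.val) * (g * u * g⁻¹).val
        = g.val * u.val * g⁻¹.val - g.val * e * (g⁻¹.val * g.val) * u.val * g⁻¹.val := by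
          simp only [Units.val_mul]; noncomm_ring
      _ = g.val * ((1 - e) * u.val) * g⁻¹.val := by rw [hg]; noncomm_ring
      _ = g.val * g⁻¹.val + g.val * e * g⁻¹.val := by rw [h.mul_eq]; noncomm_ring
      _ = _ := by rw [hg']
  · change _ * _ = _ * _
    calc g.val * e * g⁻¹.val * (g * u * g⁻¹).val
        = g.val * e * (g⁻¹.val * g.val) * u.val * g⁻¹.val := by
          simp only [Units.val_mul]; noncomm_ring
      _ = g.val * (e * u.val) * g⁻¹.val := by rw [hg]; noncomm_ring
      _ = g.val * u.val * 1 * e * g⁻¹.val := by rw [h.comm.eq]; noncomm_ring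
      _ = g.val * u.val * (g⁻¹.val * g.val) * e * g⁻¹.val := by rw [hg]
      _ = _ := by simp only [Units.val_mul]; noncomm_ring

theorem exists_isCayley_of_nilpotent {e : Module.End K V} (he : IsSkew B e)
    (hnil : IsNilpotent e) : ∃ u ∈ unipotentVariety B, IsCayley u e := by
  obtain ⟨a, ha⟩ := hnil.isUnit_one_sub
  obtain ⟨b, hb⟩ := hnil.isUnit_one_add
  have hae : Commute e a⁻¹.val := by
    have : Commute e a.val := by
      rw [ha]; exact (Commute.one_right e).sub_right (Commute.refl e)
    exact this.units_inv_right
  have hbe : Commute e b.val := by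
    rw [hb]; exact (Commute.one_right e).add_right (Commute.refl e)
  have hcomm : Commute e (a⁻¹ * b).val := by
    rw [Units.val_mul]; exact hae.mul_right hbe
  have hmul : (1 - e) * (a⁻¹ * b).val = 1 + e := by
    rw [← ha, ← hb, ← Units.val_mul, mul_inv_cancel_left]
  have hmul' : (a⁻¹ * b).val * (1 - e) = 1 + e := by
    rw [← hmul]
    exact (((Commute.one_right _).sub_right hcomm.symm).eq)
  refine ⟨a⁻¹ * b, ⟨?_, ?_⟩, hmul, hcomm⟩
  · intro v w
    have hv : ∀ v, ∃ v', (1 - e) v' = v := fun v => ⟨a⁻¹.val v, by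
      rw [← ha, ← Module.End.mul_apply, Units.mul_inv, Module.End.one_apply]⟩
    obtain ⟨v', rfl⟩ := hv v
    obtain ⟨w', rfl⟩ := hv w
    have hu : ∀ x, (a⁻¹ * b).val ((1 - e) x) = (1 + e) x := LinearMap.congr_fun hmul'
    rw [hu, hu]
    simp only [LinearMap.add_apply, LinearMap.sub_apply, Module.End.one_apply, map_add, map_sub]
    rw [he v' w']
    ring
  · have h1 : (a⁻¹ * b).val - 1 = e * (1 + (a⁻¹ * b).val) := by
      have h2 : (a⁻¹ * b).val - e * (a⁻¹ * b).val = 1 + e := by rw [← hmul]; noncomm_ring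
      linear_combination (norm := noncomm_ring) h2
    rw [h1]
    exact ((Commute.one_right e).add_right hcomm).isNilpotent_mul_right hnil

theorem exists_isCayley_of_unipotent (h2 : (2 : K) ≠ 0) {u : LinearMap.GeneralLinearGroup K V}
    (hu : u ∈ unipotentVariety B) : ∃ e, IsSkew B e ∧ IsNilpotent e ∧ IsCayley u e := by
  obtain ⟨hu1, hu2⟩ := hu
  have h2u : IsUnit (algebraMap K (Module.End K V) 2) := (isUnit_iff_ne_zero.2 h2).map _
  obtain ⟨a, ha⟩ : IsUnit (u.val + 1) := by
    have := hu2.isUnit_add_left_of_commute h2u (Algebra.commute_algebraMap_right _ _)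
    rwa [show algebraMap K (Module.End K V) 2 + (u.val - 1) = u.val + 1 by
      rw [map_ofNat, ← one_add_one_eq_two]; abel] at this
  have hcu : Commute u.val a.val := by
    rw [ha]; exact (Commute.refl _).add_right (Commute.one_right _)
  have hca : Commute (u.val - 1) a⁻¹.val :=
    (hcu.sub_left (Commute.one_left _)).units_inv_right
  have h3 : ((u.val - 1) * a⁻¹.val) * (u.val + 1) = u.val - 1 := by
    rw [← ha, mul_assoc, Units.inv_mul, mul_one]
  refine ⟨(u.val - 1) * a⁻¹.val, ?_, hca.isNilpotent_mul_right hu2, ?_, ?_⟩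
  · intro v w
    have hv : ∀ v, ∃ v', (u.val + 1) v' = v := fun v => ⟨a⁻¹.val v, by
      rw [← ha, ← Module.End.mul_apply, Units.mul_inv, Module.End.one_apply]⟩
    obtain ⟨v', rfl⟩ := hv v
    obtain ⟨w', rfl⟩ := hv w
    have hu : ∀ x, ((u.val - 1) * a⁻¹.val) ((u.val + 1) x) = (u.val - 1) x :=
      LinearMap.congr_fun h3
    rw [hu, hu]
    simp only [LinearMap.add_apply, LinearMap.sub_apply, Module.End.one_apply, map_add, map_sub]
    have := hu1 v' w'
    linear_combination 2 * this
  · linear_combination (norm := noncomm_ring) -h3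
  · exact ((((Commute.refl _).sub_right (Commute.one_right _))).mul_right
      hcu.units_inv_right).symm

/-- The Cayley transform preserves the Jordan type: `u - 1 = e (u + 1)`, and `u + 1` commutes with
`e` and acts by the scalar `2` on the kernel of `e`. -/
theorem IsCayley.hasJordanType [FiniteDimensional K V] (h2 : (2 : K) ≠ 0)
    {u : LinearMap.GeneralLinearGroup K V} {e : Module.End K V} {D : StringData}
    {v : D.Str → V} (h : IsCayley u e) (he : IsSkew B e) (hv : IsNormalForm B e D v) :
    HasJordanType (u.val - 1) D.parts := by
  have hu : u.val - 1 = e * (u.val + 1) := by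
    linear_combination (norm := noncomm_ring) h.mul_eq
  have hcomm : Commute e (u.val + 1) := h.comm.add_right (Commute.one_right _)
  have hpow : ∀ n, (u.val - 1) ^ n = (u.val + 1) ^ n * e ^ n := fun n => by
    rw [hu, hcomm.mul_pow, (hcomm.pow_pow n n).eq]
  have hker : ∀ n z, e z = 0 → ((u.val + 1) ^ n) z = (2 : K) ^ n • z := by
    intro n z hz
    induction n with
    | zero => simp
    | succ n ih =>
      have h1 : (u.val + 1) z = (2 : K) • z := by
        have h3 := LinearMap.congr_fun hu z
        rw [hcomm.eq, Module.End.mul_apply, hz, map_zero] at h3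
        simp only [LinearMap.sub_apply, Module.End.one_apply, sub_eq_zero] at h3
        rw [LinearMap.add_apply, h3, Module.End.one_apply, two_smul]
      rw [pow_succ, Module.End.mul_apply, h1, map_smul, ih, smul_smul, pow_succ']
  refine hasJordanType_of_strings (w := v) (fun s => ?_) ?_ hv.finrank_eq
  · rw [hpow, Module.End.mul_apply, hv.pow_eq_zero, map_zero]
  · have h1 : LinearIndependent K fun s => (e ^ (D.len s - 1)) (v s) :=
      (hv.linearIndependent_chain he).comp
        (fun s => (⟨s, ⟨D.len s - 1, by have := D.len_pos s; omega⟩⟩ : D.Idx))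
        fun s t hst => congrArg Sigma.fst hst
    convert h1.units_smul fun s => (Units.mk0 (2 : K) h2) ^ (D.len s - 1) using 1
    ext s
    rw [hpow, Module.End.mul_apply, hker]
    · simp [Units.smul_def]
    · rw [← Module.End.mul_apply, ← pow_succ', Nat.sub_add_cancel (D.len_pos s), hv.pow_eq_zero]

end Cayley

/-! ### Classification of nilpotent and unipotent elements -/

section Classification

variable {K : Type*} [Field K] {V : Type*} [AddCommGroup V] [Module K V]
  {B : LinearMap.BilinForm K V}

/-- A linear automorphism as an element of the general linear group. -/
abbrev toGL (f : V ≃ₗ[K] V) : LinearMap.GeneralLinearGroup K V :=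
  (LinearMap.GeneralLinearGroup.generalLinearEquiv K V).symm f

theorem toGL_val (f : V ≃ₗ[K] V) (v : V) : (toGL f).val v = f v := rfl

theorem eq_conj_iff {g : LinearMap.GeneralLinearGroup K V} {x y : Module.End K V} :
    y = g.val * x * g⁻¹.val ↔ ∀ v, y (g.val v) = g.val (x v) := by
  constructor
  · rintro rfl v
    simp only [Module.End.mul_apply]
    rw [← Module.End.mul_apply (g⁻¹.val), Units.inv_mul, Module.End.one_apply]
  · intro h
    have : y * g.val = g.val * x := LinearMap.ext h
    rw [← this, mul_assoc, Units.mul_inv, mul_one]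

theorem IsNormalForm.isNilpotent [FiniteDimensional K V] {e : Module.End K V} {D : StringData}
    {v : D.Str → V} (h : IsNormalForm B e D v) (he : IsSkew B e) : IsNilpotent e := by
  refine ⟨∑ s, D.len s, (h.basis he).ext fun x => ?_⟩
  rw [h.basis_apply, chain, ← Module.End.mul_apply, ← pow_add, LinearMap.zero_apply]
  have h1 : D.len x.1 ≤ ∑ s, D.len s :=
    Finset.single_le_sum (fun _ _ => Nat.zero_le _) (Finset.mem_univ _)
  obtain ⟨c, hc⟩ := Nat.exists_eq_add_of_le (show D.len x.1 ≤ (∑ s, D.len s) + x.2 by omega)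
  rw [hc, add_comm, pow_add, Module.End.mul_apply, h.pow_eq_zero, map_zero]

theorem IsNormalForm.map {e : Module.End K V} {D : StringData}
    {v : D.Str → V} (h : IsNormalForm B e D v) {V' : Type*} [AddCommGroup V'] [Module K V']
    {B' : LinearMap.BilinForm K V'} {e' : Module.End K V'} (f : V ≃ₗ[K] V')
    (hf : ∀ x y, B' (f x) (f y) = B x y) (hfe : ∀ x, f (e x) = e' (f x)) :
    IsNormalForm B' e' D fun s => f (v s) := by
  have hpow : ∀ n x, (e' ^ n) (f x) = f ((e ^ n) x) := by
    intro n x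
    induction n with
    | zero => simp
    | succ n ih => rw [pow_succ', pow_succ', Module.End.mul_apply, ih, ← hfe, Module.End.mul_apply]
  refine ⟨⟨fun s => ?_, fun s s' n => ?_⟩, ?_⟩
  · rw [hpow, h.pow_eq_zero, map_zero]
  · rw [hpow, hf, h.form]
  · rw [← f.finrank_eq, h.finrank_eq]

/-- In a normal form of the zero endomorphism all strings have length one. -/
theorem IsNormalForm.len_eq_one {D : StringData} {v : D.Str → V}
    (h : IsNormalForm B 0 D v) (s : D.Str) : D.len s = 1 := by
  have h1 := h.form s (D.swap s) (D.len s - 1)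
  have hpos := D.len_pos s
  rw [if_pos ⟨rfl, Nat.sub_add_cancel hpos⟩] at h1
  by_contra hne
  rw [zero_pow (by omega), LinearMap.zero_apply, map_zero] at h1
  exact intUnit_cast_ne_zero _ h1.symm

/-- Symplectic spaces of the same dimension are isometric. -/
theorem exists_isometry (h2 : (2 : K) ≠ 0) [FiniteDimensional K V] (hB : B.IsAlt)
    (hBn : B.Nondegenerate) {V' : Type*} [AddCommGroup V'] [Module K V']
    [FiniteDimensional K V'] {B' : LinearMap.BilinForm K V'} (hB' : B'.IsAlt)
    (hBn' : B'.Nondegenerate) (hdim : Module.finrank K V = Module.finrank K V') :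
    ∃ f : V ≃ₗ[K] V', ∀ x y, B' (f x) (f y) = B x y := by
  have hz : IsSkew B 0 := fun v w => by simp
  have hz' : IsSkew B' 0 := fun v w => by simp
  obtain ⟨D, v, hv⟩ := exists_isNormalForm h2 _ rfl hB hBn hz IsNilpotent.zero (Or.inr rfl)
  obtain ⟨D', v', hv'⟩ := exists_isNormalForm h2 _ rfl hB' hBn' hz' IsNilpotent.zero (Or.inr rfl)
  have hD : ∀ n, Fintype.card {s // D.len s = n} = Fintype.card {s // D'.len s = n} := by
    intro n
    simp only [Fintype.card_subtype, hv.len_eq_one, hv'.len_eq_one]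
    have h1 := hv.finrank_eq
    have h1' := hv'.finrank_eq
    simp only [hv.len_eq_one, hv'.len_eq_one, Finset.sum_const, smul_eq_mul, mul_one] at h1 h1'
    by_cases hn : 1 = n
    · simp only [hn, Finset.filter_true]
      rw [← h1, ← h1', hdim]
    · simp only [hn, Finset.filter_false]
      rfl
  obtain ⟨f, -, hf⟩ := hv.reindex hD
  obtain ⟨g, hg, -⟩ := hf.exists_isometry hz hv' hz'
  exact ⟨g, hg⟩

/-- Every string datum of the right size occurs in a given symplectic space. -/
theorem exists_isNormalForm_of_sum_len (h2 : (2 : K) ≠ 0) [FiniteDimensional K V] (hB : B.IsAlt)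
    (hBn : B.Nondegenerate) (D : StringData) (hD : Module.finrank K V = ∑ s, D.len s) :
    ∃ (e : Module.End K V) (v : D.Str → V), IsSkew B e ∧ IsNormalForm B e D v := by
  have hm := isNormalForm_model K D
  have hs := isSkew_model K D
  have halt := hm.isAlt hs h2
  obtain ⟨f, hf⟩ := exists_isometry h2 halt (hm.nondegenerate hs halt) hB hBn
    (by rw [hm.finrank_eq, hD])
  have hf' : ∀ x y, modelForm K D (f.symm x) (f.symm y) = B x y := fun x y => by
    rw [← hf, f.apply_symm_apply, f.apply_symm_apply]
  refine ⟨f.toLinearMap ∘ₗ modelRaise K D ∘ₗ f.symm.toLinearMap, fun s => f (modelHead K D s),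
    fun x y => ?_, hm.map f hf fun x => by simp⟩
  rw [← hf', ← hf']
  simpa using hs (f.symm x) (f.symm y)

theorem IsNormalForm.exists_conj [FiniteDimensional K V] {e e' : Module.End K V}
    {D : StringData} {v v' : D.Str → V} (h : IsNormalForm B e D v) (he : IsSkew B e)
    (h' : IsNormalForm B e' D v') (he' : IsSkew B e') :
    ∃ g ∈ Sp B, e' = g.val * e * g⁻¹.val := by
  obtain ⟨f, hf, hfe, -⟩ := h.exists_isometry he h' he'
  exact ⟨toGL f, hf, eq_conj_iff.2 fun v => (hfe v).symm⟩

theorem injective_one_sub {e : Module.End K V} (hnil : IsNilpotent e) :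
    Function.Injective (1 - e : Module.End K V) := by
  obtain ⟨a, ha⟩ := hnil.isUnit_one_sub
  intro x y hxy
  rw [← ha] at hxy
  have := congrArg a⁻¹.val hxy
  rwa [← Module.End.mul_apply, ← Module.End.mul_apply, Units.inv_mul] at this

theorem HasJordanType.isNilpotent [FiniteDimensional K V] {x : Module.End K V} {P : Multiset ℕ}
    (h : HasJordanType x P) : IsNilpotent x := by
  refine ⟨P.sum, ?_⟩
  have h1 := h.finrank_range_pow P.sum
  have h3 : (P.map fun a => a - P.sum).sum = 0 := by
    rw [Multiset.sum_eq_zero_iff]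
    intro b hb
    obtain ⟨a, ha, rfl⟩ := Multiset.mem_map.1 hb
    have := Multiset.le_sum_of_mem ha
    omega
  rw [h3, Submodule.finrank_eq_zero, LinearMap.range_eq_bot] at h1
  exact h1

theorem HasJordanType.conj_sub_one {u : LinearMap.GeneralLinearGroup K V} {P : Multiset ℕ}
    (h : HasJordanType (u.val - 1) P) (g : LinearMap.GeneralLinearGroup K V) :
    HasJordanType ((g * u * g⁻¹).val - 1) P := by
  refine h.conj (LinearMap.GeneralLinearGroup.generalLinearEquiv K V g) fun v => ?_
  change g.val ((u.val - 1) v) = ((g * u * g⁻¹).val - 1) (g.val v)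
  have : (g * u * g⁻¹).val (g.val v) = g.val (u.val v) := eq_conj_iff.1 rfl v
  rw [LinearMap.sub_apply, LinearMap.sub_apply, this, map_sub]
  rfl

theorem mem_unipotentVariety_of_mem_jordanClass [FiniteDimensional K V] {N : ℕ}
    {μ : N.Partition} {u : LinearMap.GeneralLinearGroup K V} (hu : u ∈ jordanClass B μ) :
    u ∈ unipotentVariety B :=
  ⟨hu.1, hu.2.isNilpotent⟩

theorem jordanClass_conj {N : ℕ} {μ : N.Partition} {u g : LinearMap.GeneralLinearGroup K V}
    (hu : u ∈ jordanClass B μ) (hg : g ∈ Sp B) : g * u * g⁻¹ ∈ jordanClass B μ :=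
  ⟨(Sp B).mul_mem ((Sp B).mul_mem hg hu.1) ((Sp B).inv_mem hg), hu.2.conj_sub_one g⟩

theorem _root_.Nat.Partition.zero_notMem_parts {N : ℕ} (μ : N.Partition) : 0 ∉ μ.parts :=
  fun h => lt_irrefl _ (μ.parts_pos h)

variable [FiniteDimensional K V]

/-- A unipotent element of `Sp(V)` is the Cayley transform of a nilpotent element in normal
form. -/
theorem exists_isNormalForm_of_unipotent (h2 : (2 : K) ≠ 0) (hsq : ∀ x : K, IsSquare x)
    (hB : B.IsAlt) (hBn : B.Nondegenerate) {u : LinearMap.GeneralLinearGroup K V}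
    (hu : u ∈ unipotentVariety B) :
    ∃ (e : Module.End K V) (D : StringData) (v : D.Str → V), IsSkew B e ∧ IsCayley u e ∧
      IsNormalForm B e D v ∧ HasJordanType (u.val - 1) D.parts := by
  obtain ⟨e, he, hnil, hc⟩ := exists_isCayley_of_unipotent h2 hu
  obtain ⟨D, v, hv⟩ := exists_isNormalForm h2 _ rfl hB hBn he hnil (Or.inl hsq)
  exact ⟨e, D, v, he, hc, hv, hc.hasJordanType h2 he hv⟩

/-- Unipotent elements of `Sp(V)` with the same Jordan type are conjugate. -/
theorem exists_conj_of_hasJordanType (h2 : (2 : K) ≠ 0) (hsq : ∀ x : K, IsSquare x)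
    (hB : B.IsAlt) (hBn : B.Nondegenerate) {u u' : LinearMap.GeneralLinearGroup K V}
    (hu : u ∈ unipotentVariety B) (hu' : u' ∈ unipotentVariety B) {P : Multiset ℕ}
    (hP : 0 ∉ P) (h : HasJordanType (u.val - 1) P) (h' : HasJordanType (u'.val - 1) P) :
    ∃ g ∈ Sp B, u' = g * u * g⁻¹ := by
  obtain ⟨e, D, v, he, hc, hv, hj⟩ := exists_isNormalForm_of_unipotent h2 hsq hB hBn hu
  obtain ⟨e', D', v', he', hc', hv', hj'⟩ := exists_isNormalForm_of_unipotent h2 hsq hB hBn hu'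
  have hD : ∀ n, Fintype.card {s // D.len s = n} = Fintype.card {s // D'.len s = n} := by
    intro n
    rw [← D.count_parts, ← D'.count_parts, hj.unique h D.zero_notMem_parts hP,
      hj'.unique h' D'.zero_notMem_parts hP]
  obtain ⟨f, -, hf⟩ := hv.reindex hD
  obtain ⟨g, hg, hge⟩ := hf.exists_conj he hv' he'
  refine ⟨g, hg, hc'.unique ?_ (hv'.isNilpotent he')⟩
  rw [hge]
  exact hc.conj g

theorem jordanClass_eq_conj (h2 : (2 : K) ≠ 0) (hsq : ∀ x : K, IsSquare x)
    (hB : B.IsAlt) (hBn : B.Nondegenerate) {N : ℕ} {μ : N.Partition}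
    {u : LinearMap.GeneralLinearGroup K V} (hu : u ∈ jordanClass B μ) :
    jordanClass B μ = {x | ∃ g ∈ Sp B, x = g * u * g⁻¹} := by
  ext x
  constructor
  · intro hx
    exact exists_conj_of_hasJordanType h2 hsq hB hBn
      (mem_unipotentVariety_of_mem_jordanClass hu) (mem_unipotentVariety_of_mem_jordanClass hx)
      μ.zero_notMem_parts hu.2 hx.2
  · rintro ⟨g, hg, rfl⟩
    exact jordanClass_conj hu hg

/-- The Jordan type of a string datum, as a partition. -/
theorem StringData.exists_partition (D : StringData) {N : ℕ} (hN : N = ∑ s, D.len s) :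
    ∃ μ ∈ signedPartitions (-1) N, μ.parts = D.parts := by
  refine ⟨⟨D.parts, fun {i} hi => Nat.pos_of_ne_zero fun h => D.zero_notMem_parts (h ▸ hi), ?_⟩,
    fun m hm => D.even_count_parts hm, rfl⟩
  rw [hN]
  rfl

theorem exists_stringData_of_mem_signedPartitions {N : ℕ} {μ : N.Partition}
    (hμ : μ ∈ signedPartitions (-1) N) :
    ∃ D : StringData, D.parts = μ.parts ∧ N = ∑ s, D.len s := by
  obtain ⟨D, hD⟩ := StringData.exists_parts_eq μ.zero_notMem_parts hμ
  refine ⟨D, hD, ?_⟩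
  rw [← μ.parts_sum, ← hD]
  rfl

theorem unipotentClasses_eq (h2 : (2 : K) ≠ 0) (hsq : ∀ x : K, IsSquare x)
    (hB : B.IsAlt) (hBn : B.Nondegenerate) {N : ℕ} (hN : Module.finrank K V = N) :
    unipotentClasses B = {O | ∃ μ ∈ signedPartitions (-1) N, O = jordanClass B μ} := by
  ext O
  constructor
  · rintro ⟨u, hu, rfl⟩
    obtain ⟨e, D, v, he, hc, hv, hj⟩ := exists_isNormalForm_of_unipotent h2 hsq hB hBn hu
    obtain ⟨μ, hμ, hμD⟩ := D.exists_partition (hN.symm.trans hv.finrank_eq)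
    have hu' : u ∈ jordanClass B μ := ⟨hu.1, by rwa [hμD]⟩
    exact ⟨μ, hμ, (jordanClass_eq_conj h2 hsq hB hBn hu').symm⟩
  · rintro ⟨μ, hμ, rfl⟩
    obtain ⟨D, hD, hDN⟩ := exists_stringData_of_mem_signedPartitions hμ
    obtain ⟨e, v, he, hv⟩ := exists_isNormalForm_of_sum_len h2 hB hBn D (hN.trans hDN)
    obtain ⟨u, hu, hc⟩ := exists_isCayley_of_nilpotent he (hv.isNilpotent he)
    have hu' : u ∈ jordanClass B μ := ⟨hu.1, by
      rw [← hD]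
      exact hc.hasJordanType h2 he hv⟩
    exact ⟨u, hu, jordanClass_eq_conj h2 hsq hB hBn hu'⟩

end Classification

/-! ### Rational structures -/

section Rational

variable {k K V₀ : Type*} [Field k] [Field K] [Algebra k K] [AddCommGroup V₀] [Module k V₀]
  {B₀ : LinearMap.BilinForm k V₀}

theorem IsSkew.baseChange {e₀ : Module.End k V₀} (h : IsSkew B₀ e₀) :
    IsSkew (LinearMap.BilinForm.baseChange K B₀) (LinearMap.baseChange K e₀) := by
  intro v w
  induction v with
  | zero => simp
  | add x y hx hy => simp only [map_add, LinearMap.add_apply, hx, hy, neg_add]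
  | tmul a v =>
    induction w with
    | zero => simp
    | add x y hx hy => simp only [map_add, hx, hy, neg_add]
    | tmul b w =>
      rw [LinearMap.baseChange_tmul, LinearMap.baseChange_tmul,
        LinearMap.BilinForm.baseChange_tmul, LinearMap.BilinForm.baseChange_tmul, h, neg_smul]

theorem IsNormalForm.baseChange {e₀ : Module.End k V₀} {D : StringData} {v₀ : D.Str → V₀}
    (h : IsNormalForm B₀ e₀ D v₀) :
    IsNormalForm (LinearMap.BilinForm.baseChange K B₀) (LinearMap.baseChange K e₀) D
      fun s => (1 : K) ⊗ₜ[k] v₀ s := by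
  have hpow : ∀ n (v : V₀), ((LinearMap.baseChange K e₀) ^ n) ((1 : K) ⊗ₜ[k] v) =
      (1 : K) ⊗ₜ[k] (e₀ ^ n) v := by
    intro n v
    rw [← LinearMap.baseChange_pow, LinearMap.baseChange_tmul]
  refine ⟨⟨fun s => ?_, fun s s' n => ?_⟩, ?_⟩
  · rw [hpow, h.pow_eq_zero, TensorProduct.tmul_zero]
  · rw [hpow, LinearMap.BilinForm.baseChange_tmul, h.form]
    split_ifs <;> simp [Algebra.smul_def]
  · rw [Module.finrank_baseChange, h.finrank_eq]

theorem baseChange_isAlt_nondegenerate [FiniteDimensional k V₀] (h2 : (2 : k) ≠ 0)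
    (hB : B₀.IsAlt) (hBn : B₀.Nondegenerate) :
    (LinearMap.BilinForm.baseChange K B₀).IsAlt ∧
      (LinearMap.BilinForm.baseChange K B₀).Nondegenerate := by
  have hz : IsSkew B₀ 0 := fun v w => by simp
  obtain ⟨D, v, hv⟩ := exists_isNormalForm h2 _ rfl hB hBn hz IsNilpotent.zero (Or.inr rfl)
  have h2' : (2 : K) ≠ 0 := by
    rw [← map_ofNat (algebraMap k K) 2]
    simpa using h2
  have halt := (hv.baseChange (K := K)).isAlt hz.baseChange h2'
  exact ⟨halt, hv.baseChange.nondegenerate hz.baseChange halt⟩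

end Rational

section Frobenius

variable {k K V₀ : Type*} [Field k] [Fintype k] [Field K] [Algebra k K]
  [Algebra.IsAlgebraic k K] [AddCommGroup V₀] [Module k V₀]

theorem frobEnd_apply (x : Module.End K (K ⊗[k] V₀)) (v : K ⊗[k] V₀) :
    frobEnd k K V₀ x (frobV k K V₀ v) = frobV k K V₀ (x v) := by
  change frobV k K V₀ (x ((frobV k K V₀).symm (frobV k K V₀ v))) = _
  rw [LinearEquiv.symm_apply_apply]

theorem eq_frobEnd_iff {x y : Module.End K (K ⊗[k] V₀)} :
    frobEnd k K V₀ x = y ↔ ∀ v, y (frobV k K V₀ v) = frobV k K V₀ (x v) := by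
  constructor
  · rintro rfl v
    exact frobEnd_apply x v
  · intro h
    ext v
    obtain ⟨w, hw⟩ := (frobV k K V₀).surjective ((1 : K) ⊗ₜ[k] v)
    change frobEnd k K V₀ x ((1 : K) ⊗ₜ[k] v) = y ((1 : K) ⊗ₜ[k] v)
    rw [← hw, frobEnd_apply, h]

theorem eq_frobGL_iff {x y : LinearMap.GeneralLinearGroup K (K ⊗[k] V₀)} :
    frobGL k K V₀ x = y ↔ ∀ v, y.val (frobV k K V₀ v) = frobV k K V₀ (x.val v) := by
  rw [← eq_frobEnd_iff, Units.ext_iff]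
  rfl

theorem frobEnd_injective : Function.Injective (frobEnd k K V₀) := by
  intro x y h
  ext v
  apply (frobV k K V₀).injective
  change frobV k K V₀ (x _) = frobV k K V₀ (y _)
  rw [← frobEnd_apply, ← frobEnd_apply, h]

theorem frobEnd_surjective : Function.Surjective (frobEnd k K V₀) := by
  intro y
  refine ⟨{ toFun := fun v => (frobV k K V₀).symm (y (frobV k K V₀ v))
            map_add' := fun v w => by simp
            map_smul' := fun c v => ?_ }, eq_frobEnd_iff.2 fun v => ?_⟩
  · rw [frobV_smul, map_smul, RingHom.id_apply, LinearEquiv.symm_apply_eq, frobV_smul,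
      LinearEquiv.apply_symm_apply]
  · simp

theorem frobGL_surjective : Function.Surjective (frobGL k K V₀) := by
  intro g
  obtain ⟨x, hx⟩ := frobEnd_surjective g.val
  obtain ⟨y, hy⟩ := frobEnd_surjective g⁻¹.val
  refine ⟨⟨x, y, frobEnd_injective ?_, frobEnd_injective ?_⟩, Units.ext hx⟩
  · rw [map_mul, hx, hy, map_one, Units.mul_inv]
  · rw [map_mul, hx, hy, map_one, Units.inv_mul]

variable {B₀ : LinearMap.BilinForm k V₀}

theorem baseChange_frobV (v w : K ⊗[k] V₀) :
    LinearMap.BilinForm.baseChange K B₀ (frobV k K V₀ v) (frobV k K V₀ w) =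
      FiniteField.frobeniusAlgEquivOfAlgebraic k K (LinearMap.BilinForm.baseChange K B₀ v w) := by
  induction v with
  | zero => simp
  | add x y hx hy => simp only [map_add, LinearMap.add_apply, hx, hy]
  | tmul a v =>
    induction w with
    | zero => simp
    | add x y hx hy => simp only [map_add, hx, hy]
    | tmul b w =>
      rw [LinearMap.BilinForm.baseChange_tmul, map_smul, frobV_tmul, frobV_tmul,
        LinearMap.BilinForm.baseChange_tmul, ← mul_pow]
      rfl

theorem frobGL_mem_Sp_iff {g : LinearMap.GeneralLinearGroup K (K ⊗[k] V₀)} :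
    frobGL k K V₀ g ∈ Sp (LinearMap.BilinForm.baseChange K B₀) ↔
      g ∈ Sp (LinearMap.BilinForm.baseChange K B₀) := by
  have key : ∀ v, (frobGL k K V₀ g).val (frobV k K V₀ v) = frobV k K V₀ (g.val v) :=
    eq_frobGL_iff.1 rfl
  constructor
  · intro h v w
    apply (FiniteField.frobeniusAlgEquivOfAlgebraic k K).injective
    rw [← baseChange_frobV, ← baseChange_frobV, ← key, ← key]
    exact h _ _
  · intro h v w
    obtain ⟨v, rfl⟩ := (frobV k K V₀).surjective v
    obtain ⟨w, rfl⟩ := (frobV k K V₀).surjective w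
    rw [key, key, baseChange_frobV, baseChange_frobV, h]

theorem frobV_baseChange (e₀ : Module.End k V₀) (v : K ⊗[k] V₀) :
    LinearMap.baseChange K e₀ (frobV k K V₀ v) = frobV k K V₀ (LinearMap.baseChange K e₀ v) := by
  induction v with
  | zero => simp
  | add x y hx hy => simp only [map_add, hx, hy]
  | tmul a v => rw [frobV_tmul, LinearMap.baseChange_tmul, LinearMap.baseChange_tmul, frobV_tmul]

/-- The Cayley transform of a rational nilpotent element is rational. -/
theorem IsCayley.frobGL_eq {u : LinearMap.GeneralLinearGroup K (K ⊗[k] V₀)}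
    {e : Module.End K (K ⊗[k] V₀)} (h : IsCayley u e) (hnil : IsNilpotent e)
    (he : ∀ v, e (frobV k K V₀ v) = frobV k K V₀ (e v)) : frobGL k K V₀ u = u := by
  rw [eq_frobGL_iff]
  intro v
  apply injective_one_sub hnil
  have h1 := LinearMap.congr_fun h.mul_eq (frobV k K V₀ v)
  have h3 := LinearMap.congr_fun h.mul_eq v
  rw [Module.End.mul_apply] at h1 h3
  rw [h1]
  have h4 : (1 - e) (frobV k K V₀ (u.val v)) = frobV k K V₀ ((1 - e) (u.val v)) := by
    simp [he]
  rw [h4, h3]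
  simp [he]

variable (B₀) in
/-- The image under the Frobenius endomorphism of the conjugacy class of a rational element. -/
theorem image_frobGL_conj {u : LinearMap.GeneralLinearGroup K (K ⊗[k] V₀)}
    (hu : frobGL k K V₀ u = u) :
    frobGL k K V₀ '' {x | ∃ g ∈ Sp (LinearMap.BilinForm.baseChange K B₀), x = g * u * g⁻¹} =
      {x | ∃ g ∈ Sp (LinearMap.BilinForm.baseChange K B₀), x = g * u * g⁻¹} := by
  ext x
  constructor
  · rintro ⟨_, ⟨g, hg, rfl⟩, rfl⟩
    exact ⟨frobGL k K V₀ g, frobGL_mem_Sp_iff.2 hg, by rw [map_mul, map_mul, map_inv, hu]⟩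
  · rintro ⟨g, hg, rfl⟩
    obtain ⟨g, rfl⟩ := frobGL_surjective g
    exact ⟨_, ⟨g, frobGL_mem_Sp_iff.1 hg, rfl⟩, by rw [map_mul, map_mul, map_inv, hu]⟩

end Frobenius

/-! ### Gradings and diagonal operators -/

section Grading

variable {K : Type*} [Field K] {V : Type*} [AddCommGroup V] [Module K V] {ι : Type*}
  (b : Module.Basis ι K V) (w : ι → ℤ)

/-- The span of the basis vectors of weight `i`. -/
def wtSpace (i : ℤ) : Submodule K V where
  carrier := {v | ∀ x, w x ≠ i → b.repr v x = 0}
  add_mem' := fun hv hv' x hx => by simp [hv x hx, hv' x hx]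
  zero_mem' := fun x _ => by simp
  smul_mem' := fun c v hv x hx => by simp [hv x hx]

/-- `z` shifts weights by `j`. -/
def HasDeg (z : Module.End K V) (j : ℤ) : Prop := ∀ x, z (b x) ∈ wtSpace b w (w x + j)

variable {b w}

theorem basis_mem_wtSpace (x : ι) : b x ∈ wtSpace b w (w x) := by
  intro y hy
  rw [b.repr_self, Finsupp.single_eq_of_ne]
  rintro rfl
  exact hy rfl

variable (b w) in
/-- The projection onto the weight space of weight `i`. -/
def wtProj (i : ℤ) : Module.End K V :=
  b.constr K fun x => if w x = i then b x else 0

theorem wtProj_basis (i : ℤ) (x : ι) :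
    wtProj b w i (b x) = if w x = i then b x else 0 := by
  rw [wtProj, Module.Basis.constr_basis]

variable (b) in
/-- The operators that are diagonal in the basis `b`. -/
def diagGL : (ι → Kˣ) →* LinearMap.GeneralLinearGroup K V where
  toFun d :=
    { val := b.constr K fun x => (d x : K) • b x
      inv := b.constr K fun x => ((d x)⁻¹ : Kˣ).val • b x
      val_inv := b.ext fun x => by
        rw [Module.End.mul_apply, b.constr_basis, map_smul, b.constr_basis, smul_smul,
          Units.inv_mul, one_smul, Module.End.one_apply]
      inv_val := b.ext fun x => by
        rw [Module.End.mul_apply, b.constr_basis, map_smul, b.constr_basis, smul_smul,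
          Units.mul_inv, one_smul, Module.End.one_apply] }
  map_one' := Units.ext (b.ext fun x => by
    rw [b.constr_basis, Pi.one_apply, Units.val_one, one_smul]
    rfl)
  map_mul' d d' := Units.ext (b.ext fun x => by
    rw [Units.val_mul, Module.End.mul_apply, b.constr_basis, b.constr_basis, map_smul,
      b.constr_basis, smul_smul, Pi.mul_apply, Units.val_mul, mul_comm])

@[simp] theorem diagGL_basis (d : ι → Kˣ) (x : ι) :
    (diagGL b d).val (b x) = (d x : K) • b x :=
  b.constr_basis K _ x

variable (b w) in
/-- The one-parameter group acting by `t ^ w x` on the basis vector `b x`. -/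
def wtCochar : Kˣ →* LinearMap.GeneralLinearGroup K V :=
  (diagGL b).comp
    { toFun := fun t x => t ^ w x
      map_one' := by ext; simp
      map_mul' := fun s t => by ext; simp [mul_zpow] }

@[simp] theorem wtCochar_basis (t : Kˣ) (x : ι) :
    (wtCochar b w t).val (b x) = ((t ^ w x : Kˣ) : K) • b x :=
  diagGL_basis _ x

variable [Fintype ι]

theorem wtSpace_le {i : ℤ} {S : Submodule K V} (h : ∀ x, w x = i → b x ∈ S) :
    wtSpace b w i ≤ S := by
  intro v hv
  rw [← b.sum_repr v]
  refine S.sum_mem fun x _ => ?_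
  by_cases hx : w x = i
  · exact S.smul_mem _ (h x hx)
  · rw [hv x hx, zero_smul]
    exact S.zero_mem

theorem HasDeg.map {z : Module.End K V} {j : ℤ} (hz : HasDeg b w z j) {i : ℤ} {v : V}
    (hv : v ∈ wtSpace b w i) : z v ∈ wtSpace b w (i + j) := by
  have : wtSpace b w i ≤ (wtSpace b w (i + j)).comap z := wtSpace_le fun x hx => by
    subst hx
    exact hz x
  exact this hv

theorem HasDeg.pow {z : Module.End K V} {j : ℤ} (hz : HasDeg b w z j) (n : ℕ) :
    HasDeg b w (z ^ n) (n * j) := by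
  induction n with
  | zero => intro x; simpa using basis_mem_wtSpace x
  | succ n ih =>
    intro x
    rw [pow_succ', Module.End.mul_apply]
    have := hz.map (ih x)
    rwa [show w x + n * j + j = w x + (n + 1 : ℕ) * j by push_cast; ring] at this

theorem apply_eq_zero_of_wt {B : LinearMap.BilinForm K V}
    (hB : ∀ x y, w x + w y ≠ 0 → B (b x) (b y) = 0) {i j : ℤ} (hij : i + j ≠ 0) {v v' : V}
    (hv : v ∈ wtSpace b w i) (hv' : v' ∈ wtSpace b w j) : B v v' = 0 := by
  have h1 : ∀ x, w x = i → B (b x) v' = 0 := fun x hx => by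
    have : wtSpace b w j ≤ LinearMap.ker (B (b x)) := wtSpace_le fun y hy => by
      rw [LinearMap.mem_ker]
      exact hB x y (by rw [hx, hy]; exact hij)
    exact this hv'
  have : wtSpace b w i ≤ LinearMap.ker (B.flip v') := wtSpace_le h1
  exact this hv

theorem wtProj_mem (i : ℤ) (v : V) : wtProj b w i v ∈ wtSpace b w i := by
  rw [← b.sum_repr v, map_sum]
  refine Submodule.sum_mem _ fun x _ => ?_
  rw [map_smul, wtProj_basis]
  refine Submodule.smul_mem _ _ ?_
  split_ifs with h
  · rw [← h]
    exact basis_mem_wtSpace x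
  · exact Submodule.zero_mem _

theorem wtProj_of_mem {i : ℤ} {v : V} (hv : v ∈ wtSpace b w i) : wtProj b w i v = v := by
  have : wtSpace b w i ≤ LinearMap.eqLocus (wtProj b w i) LinearMap.id := wtSpace_le fun x hx => by
    rw [LinearMap.mem_eqLocus, wtProj_basis, if_pos hx, LinearMap.id_apply]
  exact this hv

theorem wtProj_of_mem_ne {i j : ℤ} (hij : j ≠ i) {v : V} (hv : v ∈ wtSpace b w j) :
    wtProj b w i v = 0 := by
  have : wtSpace b w j ≤ LinearMap.ker (wtProj b w i) := wtSpace_le fun x hx => by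
    rw [LinearMap.mem_ker, wtProj_basis, if_neg (by rw [hx]; exact hij)]
  exact this hv

theorem sum_wtProj (v : V) : ∑ i ∈ Finset.univ.image w, wtProj b w i v = v := by
  have : ∑ i ∈ Finset.univ.image w, wtProj b w i = LinearMap.id := by
    refine b.ext fun x => ?_
    rw [LinearMap.sum_apply, Finset.sum_eq_single (w x)]
    · rw [wtProj_basis, if_pos rfl, LinearMap.id_apply]
    · intro i _ hi
      rw [wtProj_basis, if_neg hi.symm]
    · intro h
      exact absurd (Finset.mem_image_of_mem w (Finset.mem_univ x)) h
  simpa using LinearMap.congr_fun this v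

theorem wtProj_eq_zero_of_notMem {i : ℤ} (hi : i ∉ Finset.univ.image w) (v : V) :
    wtProj b w i v = 0 := by
  rw [← b.sum_repr v, map_sum]
  refine Finset.sum_eq_zero fun x _ => ?_
  rw [map_smul, wtProj_basis, if_neg, smul_zero]
  rintro rfl
  exact hi (Finset.mem_image_of_mem w (Finset.mem_univ x))

theorem HasDeg.map_wtProj {z : Module.End K V} {j : ℤ} (hz : HasDeg b w z j) (i : ℤ) (v : V) :
    z (wtProj b w i v) = wtProj b w (i + j) (z v) := by
  have : z ∘ₗ wtProj b w i = wtProj b w (i + j) ∘ₗ z := by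
    refine b.ext fun x => ?_
    rw [LinearMap.comp_apply, LinearMap.comp_apply, wtProj_basis]
    split_ifs with h
    · rw [wtProj_of_mem]
      rw [← h]
      exact hz x
    · rw [map_zero, wtProj_of_mem_ne _ (hz x)]
      intro h'
      exact h (by omega)
  exact LinearMap.congr_fun this v

/-- The dimension of a weight space can be computed from any homogeneous basis. -/
theorem finrank_wtSpace [DecidableEq ι] {ι' : Type*} [Fintype ι'] (b' : Module.Basis ι' K V)
    (w' : ι' → ℤ) (hb' : ∀ x, b' x ∈ wtSpace b w (w' x)) (i : ℤ) :
    Module.finrank K (wtSpace b w i) = Fintype.card {x // w' x = i} := by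
  have hspan : wtSpace b w i = Submodule.span K (Set.range fun x : {x // w' x = i} => b' x) := by
    apply le_antisymm
    · intro v hv
      rw [← wtProj_of_mem hv, ← b'.sum_repr v, map_sum]
      refine Submodule.sum_mem _ fun x _ => ?_
      rw [map_smul]
      refine Submodule.smul_mem _ _ ?_
      by_cases hx : w' x = i
      · rw [wtProj_of_mem (hx ▸ hb' x)]
        exact Submodule.subset_span ⟨⟨x, hx⟩, rfl⟩
      · rw [wtProj_of_mem_ne hx (hb' x)]
        exact Submodule.zero_mem _
    · rw [Submodule.span_le]
      rintro _ ⟨⟨x, rfl⟩, rfl⟩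
      exact hb' x
  rw [hspan, finrank_span_eq_card]
  exact b'.linearIndependent.comp _ Subtype.val_injective

theorem diagGL_repr (d : ι → Kˣ) (v : V) (x : ι) :
    b.repr ((diagGL b d).val v) x = d x * b.repr v x := by
  classical
  conv_lhs => rw [← b.sum_repr v]
  simp only [map_sum, map_smul, diagGL_basis, b.repr_self, Finsupp.coe_finsetSum,
    Finset.sum_apply, Finsupp.coe_smul, Pi.smul_apply, smul_eq_mul]
  rw [Finset.sum_eq_single x]
  · simp [mul_comm]
  · intro y _ hy
    rw [Finsupp.single_eq_of_ne hy.symm]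
    simp
  · simp

theorem eq_zero_of_forall_zpow_eq_one [Infinite K] {n : ℤ} (h : ∀ t : Kˣ, t ^ n = 1) :
    n = 0 := by
  by_contra hn
  have hm : ∀ t : Kˣ, t ^ n.natAbs = 1 := fun t => by
    rcases Int.natAbs_eq n with h' | h'
    · rw [← zpow_natCast, ← h', h]
    · have h1 := h t
      rw [h', zpow_neg, inv_eq_one, zpow_natCast] at h1
      exact h1
  have hp : (Polynomial.X * (Polynomial.X ^ n.natAbs - 1) : Polynomial K) = 0 := by
    refine Polynomial.funext fun r => ?_
    by_cases hr : r = 0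
    · simp [hr]
    · have := congrArg Units.val (hm (Units.mk0 r hr))
      simp only [Units.val_pow_eq_pow_val, Units.val_mk0, Units.val_one] at this
      simp [this]
  rcases mul_eq_zero.1 hp with h1 | h1
  · exact Polynomial.X_ne_zero h1
  · exact Polynomial.X_pow_sub_C_ne_zero (Int.natAbs_pos.2 hn) (1 : K) (by simpa using h1)

/-- Being homogeneous for the cocharacter is the same as shifting weights. -/
theorem hasDeg_iff_conj [Infinite K] {z : Module.End K V} {j : ℤ} :
    HasDeg b w z j ↔ ∀ t : Kˣ,
      (wtCochar b w t).val * z * (wtCochar b w t)⁻¹.val = ((t ^ j : Kˣ) : K) • z := by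
  have key : ∀ t : Kˣ, ∀ x x', b.repr (((wtCochar b w t).val * z * (wtCochar b w t)⁻¹.val) (b x)) x'
      = ((t ^ (w x' - w x) : Kˣ) : K) * b.repr (z (b x)) x' := by
    intro t x x'
    have h1 : (wtCochar b w t)⁻¹.val (b x) = ((t ^ (-w x) : Kˣ) : K) • b x := by
      rw [← map_inv, wtCochar_basis, inv_zpow']
    rw [Module.End.mul_apply, Module.End.mul_apply, h1, map_smul, map_smul, map_smul,
      Finsupp.smul_apply, smul_eq_mul]
    change _ * b.repr ((diagGL b _).val _) x' = _
    rw [diagGL_repr, ← mul_assoc, ← Units.val_mul]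
    congr 2
    change t ^ (-w x) * t ^ w x' = _
    rw [← zpow_add]
    congr 1
    ring
  constructor
  · intro h t
    refine b.ext fun x => b.ext_elem fun x' => ?_
    rw [key, LinearMap.smul_apply, map_smul, Finsupp.smul_apply, smul_eq_mul]
    by_cases hx : w x' = w x + j
    · rw [show w x' - w x = j by omega]
    · rw [h x x' hx, mul_zero, mul_zero]
  · intro h x x' hx
    by_contra hne
    have : ∀ t : Kˣ, t ^ (w x' - w x - j) = 1 := fun t => by
      have h1 := key t x x'
      rw [h, LinearMap.smul_apply, map_smul, Finsupp.smul_apply, smul_eq_mul] at h1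
      have h3 := Units.ext (mul_right_cancel₀ hne h1)
      rw [zpow_sub, ← h3, mul_inv_cancel]
    have := eq_zero_of_forall_zpow_eq_one this
    exact hx (by omega)

theorem mem_leviOf_iff [Infinite K] {B : LinearMap.BilinForm K V}
    {g : LinearMap.GeneralLinearGroup K V} :
    g ∈ leviOf B (wtCochar b w) ↔ g ∈ Sp B ∧ HasDeg b w g.val 0 := by
  refine and_congr_right fun _ => ?_
  change g ∈ Subgroup.centralizer _ ↔ _
  rw [hasDeg_iff_conj, Subgroup.mem_centralizer_iff]
  simp only [Set.forall_mem_range, zpow_zero, Units.val_one, one_smul]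
  refine forall_congr' fun t => ?_
  rw [← Units.val_mul, ← Units.val_mul, ← Units.ext_iff, mul_inv_eq_iff_eq_mul]

theorem mem_weightSpace_iff [Infinite K] {B : LinearMap.BilinForm K V} {z : Module.End K V}
    {j : ℤ} : z ∈ weightSpace B (wtCochar b w) j ↔ IsSkew B z ∧ HasDeg b w z j := by
  rw [hasDeg_iff_conj]
  refine and_congr_left fun _ => ?_
  change z ∈ B.skewAdjointSubmodule ↔ _
  rw [LinearMap.mem_skewAdjointSubmodule]
  refine forall_congr' fun v => forall_congr' fun w => ?_
  rw [Pi.neg_apply, map_neg]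

theorem isCocharacter_wtCochar {H : Subgroup (LinearMap.GeneralLinearGroup K V)}
    (h : ∀ t, wtCochar b w t ∈ H) : IsCocharacter H (wtCochar b w) := by
  refine ⟨h, fun ξ v => ⟨∑ x, LaurentPolynomial.C (b.repr v x * ξ (b x)) *
    LaurentPolynomial.T (w x), fun t => ?_⟩⟩
  conv_lhs => rw [← b.sum_repr v]
  simp only [map_sum, map_smul, wtCochar_basis, map_mul, LaurentPolynomial.eval₂_C,
    LaurentPolynomial.eval₂_T, RingHom.id_apply, smul_eq_mul]
  refine Finset.sum_congr rfl fun x _ => ?_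
  ring

end Grading

/-! ### Polynomial functions -/

section PolyFun

variable {K : Type*} [Field K] {E : Type*} [AddCommGroup E] [Module K E]

/-- `f` is a polynomial in linear functionals. -/
def IsPolyFun (f : E → K) : Prop :=
  ∃ P : MvPolynomial (Module.Dual K E) K, ∀ v, f v = MvPolynomial.eval (fun ξ => ξ v) P

theorem IsPolyFun.const (c : K) : IsPolyFun fun _ : E => c :=
  ⟨MvPolynomial.C c, fun v => by simp⟩

theorem IsPolyFun.dual (ξ : Module.Dual K E) : IsPolyFun fun v : E => ξ v :=
  ⟨MvPolynomial.X ξ, fun v => by simp⟩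

theorem IsPolyFun.mul {f g : E → K} (hf : IsPolyFun f) (hg : IsPolyFun g) :
    IsPolyFun fun v => f v * g v := by
  obtain ⟨P, hP⟩ := hf
  obtain ⟨Q, hQ⟩ := hg
  exact ⟨P * Q, fun v => by simp [hP, hQ]⟩

theorem IsPolyFun.sum {α : Type*} (s : Finset α) {f : α → E → K} (hf : ∀ a, IsPolyFun (f a)) :
    IsPolyFun fun v => ∑ a ∈ s, f a v := by
  choose P hP using hf
  exact ⟨∑ a ∈ s, P a, fun v => by simp [hP]⟩

theorem IsPolyFun.prod {α : Type*} (s : Finset α) {f : α → E → K} (hf : ∀ a, IsPolyFun (f a)) :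
    IsPolyFun fun v => ∏ a ∈ s, f a v := by
  choose P hP using hf
  exact ⟨∏ a ∈ s, P a, fun v => by simp [hP]⟩

theorem IsPolyFun.det {n : Type*} [Fintype n] [DecidableEq n] {M : E → Matrix n n K}
    (hM : ∀ i j, IsPolyFun fun v => M v i j) : IsPolyFun fun v => (M v).det := by
  simp only [Matrix.det_apply']
  exact IsPolyFun.sum _ fun σ => (IsPolyFun.const _).mul (IsPolyFun.prod _ fun i => hM _ _)

/-- The restriction of a polynomial function to a line is a polynomial in the parameter. -/
theorem IsPolyFun.exists_polynomial {f : E → K} (hf : IsPolyFun f) (a c : E) :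
    ∃ Q : Polynomial K, ∀ t, f (a + t • c) = Q.eval t := by
  obtain ⟨P, hP⟩ := hf
  refine ⟨MvPolynomial.eval₂ Polynomial.C
    (fun ξ : Module.Dual K E => Polynomial.C (ξ a) + Polynomial.X * Polynomial.C (ξ c)) P,
    fun t => ?_⟩
  rw [hP]
  have : Polynomial.eval t (MvPolynomial.eval₂ Polynomial.C
      (fun ξ : Module.Dual K E => Polynomial.C (ξ a) + Polynomial.X * Polynomial.C (ξ c)) P) =
      Polynomial.evalRingHom t (MvPolynomial.eval₂ Polynomial.C
      (fun ξ : Module.Dual K E => Polynomial.C (ξ a) + Polynomial.X * Polynomial.C (ξ c)) P) := rfl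
  rw [this, MvPolynomial.hom_eval₂, ← MvPolynomial.eval₂_id]
  congr 1
  · ext x; simp
  · ext ξ
    simp only [Polynomial.coe_evalRingHom, map_add, map_smul, Polynomial.eval_mul,
      Polynomial.eval_C, Polynomial.eval_X, smul_eq_mul]

theorem IsPolyFun.isOpen_ne_zero {f : E → K} (hf : IsPolyFun f) :
    IsOpen[zariski K E] {v | f v ≠ 0} := by
  obtain ⟨P, hP⟩ := hf
  rw [← @isClosed_compl_iff _ (zariski K E), isClosed_zariski_iff]
  refine ⟨{P}, ?_⟩
  ext v
  simp [zeros, hP]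

/-- In an affine subspace over an infinite field, here given by the lines through `a` that it
contains, a set that contains the nonvanishing locus of a polynomial function is dense. -/
theorem mem_closure_of_isPolyFun [Infinite K] {f : E → K} (hf : IsPolyFun f) {S : Set E}
    {a c : E} (ha : f a ≠ 0) (hS : ∀ t : K, f (a + t • (c - a)) ≠ 0 → a + t • (c - a) ∈ S) :
    c ∈ @closure _ (zariski K E) S := by
  by_contra hc
  obtain ⟨T, hT⟩ := isClosed_zariski_iff.1 (@isClosed_closure _ (zariski K E) S)
  rw [hT] at hc
  simp only [zeros, Set.mem_ofPred_eq, not_forall] at hc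
  obtain ⟨P, hPT, hP⟩ := hc
  obtain ⟨Q, hQ⟩ := hf.exists_polynomial a (c - a)
  obtain ⟨Q', hQ'⟩ := IsPolyFun.exists_polynomial ⟨P, fun v => rfl⟩ a (c - a)
  have hQ0 : Q ≠ 0 := by
    rintro rfl
    have := hQ 0
    simp [ha] at this
  have hQ0' : Q' ≠ 0 := by
    rintro rfl
    have := hQ' 1
    simp [hP] at this
  obtain ⟨t, ht⟩ : ∃ t, (Q * Q').eval t ≠ 0 := by
    by_contra! h
    exact mul_ne_zero hQ0 hQ0' (Polynomial.funext fun t => by rw [h, Polynomial.eval_zero])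
  rw [Polynomial.eval_mul, mul_ne_zero_iff] at ht
  have hmem := @subset_closure _ (zariski K E) S _ (hS t (by rw [hQ]; exact ht.1))
  rw [hT] at hmem
  exact ht.2 (by rw [← hQ']; exact hmem P hPT)

end PolyFun

/-! ### The dense orbit of the Levi subgroup -/

theorem StringData.card_wt (D : StringData) (n : ℕ) :
    Fintype.card {x : D.Idx // D.wt x = n} =
      Fintype.card {s : D.Str // n + 1 ≤ D.len s ∧ (D.len s + n + 1) % 2 = 0} := by
  refine Fintype.card_of_bijective (f := fun x => ⟨x.1.1, ?_⟩) ⟨?_, ?_⟩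
  · have h1 := x.2
    have h2 := x.1.2.2
    simp only [StringData.wt] at h1
    omega
  · rintro ⟨x, hx⟩ ⟨y, hy⟩ hxy
    have h1 : x.1 = y.1 := congrArg Subtype.val hxy
    have h2 : D.len x.1 = D.len y.1 := by rw [h1]
    simp only [StringData.wt] at hx hy
    exact Subtype.ext (StringData.idx_ext h1 (by change (x.2 : ℕ) = (y.2 : ℕ); omega))
  · rintro ⟨s, h1, h2⟩
    refine ⟨⟨⟨s, ⟨(D.len s + n - 1) / 2, by omega⟩⟩, ?_⟩, rfl⟩
    simp only [StringData.wt]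
    omega

/-- The number of strings of a given length is determined by the dimensions of the weight
spaces. -/
theorem StringData.card_len_of_card_wt {D D' : StringData}
    (h : ∀ i, Fintype.card {x : D.Idx // D.wt x = i} = Fintype.card {x : D'.Idx // D'.wt x = i})
    (n : ℕ) : Fintype.card {s // D.len s = n} = Fintype.card {s // D'.len s = n} := by
  have key : ∀ (E : StringData) (n : ℕ), Fintype.card {s // E.len s = n + 1} +
      Fintype.card {x : E.Idx // E.wt x = ((n + 2 : ℕ) : ℤ)} =
        Fintype.card {x : E.Idx // E.wt x = n} := by
    intro E n
    rw [E.card_wt, E.card_wt, Fintype.card_subtype, Fintype.card_subtype, Fintype.card_subtype,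
      Finset.card_filter, Finset.card_filter, Finset.card_filter, ← Finset.sum_add_distrib]
    refine Finset.sum_congr rfl fun s _ => ?_
    split_ifs <;> omega
  rcases n with _ | n
  · have h0 : ∀ E : StringData, Fintype.card {s // E.len s = 0} = 0 := fun E => by
      rw [Fintype.card_eq_zero_iff]
      exact ⟨fun s => (E.len_pos s.1).ne' s.2⟩
    rw [h0, h0]
  · have h1 := key D n
    have h2 := key D' n
    rw [h, h] at h1
    omega

section Orbit

variable {K : Type*} [Field K] {V : Type*} [AddCommGroup V] [Module K V]
  {B : LinearMap.BilinForm K V}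

/-- The hard Lefschetz property: `y ^ n` is injective on the weight space of weight `-n`. -/
def IsLefschetz {ι : Type*} (b : Module.Basis ι K V) (w : ι → ℤ) (y : Module.End K V) : Prop :=
  ∀ (n : ℕ) (v : V), v ∈ wtSpace b w (-n) → (y ^ n) v = 0 → v = 0

section Basis

variable {ι : Type*} [Fintype ι] {b : Module.Basis ι K V} {w : ι → ℤ}

/-- Projecting the string heads of an element `y` of degree two to their middle weights gives a
homogeneous normal form of `y`. -/
theorem IsNormalForm.homogenize (hBw : ∀ x y, w x + w y ≠ 0 → B (b x) (b y) = 0)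
    {y : Module.End K V} (hy : IsSkew B y) (hdeg : HasDeg b w y 2) (hL : IsLefschetz b w y)
    {D : StringData} {v : D.Str → V} (h : IsNormalForm B y D v) :
    IsNormalForm B y D fun s => wtProj b w (1 - D.len s) (v s) := by
  have hpow : ∀ (n : ℕ) (i : ℤ) (u : V), (y ^ n) (wtProj b w i u) =
      wtProj b w (i + n * 2) ((y ^ n) u) := fun n i u =>
    (hdeg.pow n).map_wtProj i u
  have hz : ∀ s, (y ^ D.len s) (wtProj b w (1 - D.len s) (v s)) = 0 :=
    fun s => by rw [hpow, h.pow_eq_zero, map_zero]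
  have hz' : ∀ s n, D.len s ≤ n →
      (y ^ n) (wtProj b w (1 - D.len s) (v s)) = 0 := by
    intro s n hn
    obtain ⟨c, rfl⟩ := Nat.exists_eq_add_of_le hn
    rw [add_comm, pow_add, Module.End.mul_apply, hz, map_zero]
  -- a string head has no components of weight below the middle weight
  have hlow : ∀ s i, i < 1 - (D.len s : ℤ) → wtProj b w i (v s) = 0 := by
    intro s i hi
    obtain ⟨c, hc⟩ : ∃ c : ℕ, i = -((D.len s + c : ℕ) : ℤ) :=
      ⟨(-i).toNat - D.len s, by push_cast; omega⟩
    apply hL (D.len s + c)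
    · rw [← hc]
      exact wtProj_mem _ _
    · rw [hpow, add_comm (D.len s), pow_add, Module.End.mul_apply, h.pow_eq_zero, map_zero,
        map_zero]
  refine ⟨⟨hz, fun s s' n => ?_⟩, h.finrank_eq⟩
  by_cases hn : 2 * (n + 1) = D.len s + D.len s'
  swap
  · have h1 : (y ^ n) (wtProj b w (1 - D.len s') (v s')) ∈
        wtSpace b w (1 - D.len s' + n * 2) := (hdeg.pow n).map (wtProj_mem _ _)
    rw [apply_eq_zero_of_wt hBw (by omega) (wtProj_mem _ _) h1, if_neg]
    rintro ⟨rfl, h3⟩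
    rw [D.len_swap] at hn
    omega
  rcases lt_trichotomy (D.len s) (D.len s') with hlt | heq | hgt
  · have h1 := hy.pow_left n (wtProj b w (1 - D.len s) (v s))
      (wtProj b w (1 - D.len s') (v s'))
    rw [hz' s n (by omega), map_zero, LinearMap.zero_apply] at h1
    rw [(mul_eq_zero.1 h1.symm).resolve_left (by simp), if_neg]
    rintro ⟨rfl, h3⟩
    rw [D.len_swap] at hlt
    omega
  · rw [← h.form]
    conv_rhs => rw [← sum_wtProj (b := b) (w := w) (v s), ← sum_wtProj (b := b) (w := w) (v s')]
    simp only [map_sum, LinearMap.sum_apply]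
    have hterm : ∀ i j, i ≠ 1 - (D.len s : ℤ) ∨ j ≠ 1 - (D.len s' : ℤ) →
        B (wtProj b w i (v s))
          ((y ^ n) (wtProj b w j (v s'))) = 0 := by
      intro i j hij
      have h1 : (y ^ n) (wtProj b w j (v s')) ∈ wtSpace b w (j + n * 2) :=
        (hdeg.pow n).map (wtProj_mem _ _)
      by_cases hsum : i + (j + n * 2) = 0
      · rcases lt_or_ge i (1 - (D.len s : ℤ)) with h3 | h3
        · rw [hlow s i h3, map_zero, LinearMap.zero_apply]
        · rw [hlow s' j (by omega), map_zero, map_zero]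
      · exact apply_eq_zero_of_wt hBw hsum (wtProj_mem _ _) h1
    rw [Finset.sum_comm, Finset.sum_eq_single (1 - (D.len s : ℤ)),
      Finset.sum_eq_single (1 - (D.len s' : ℤ))]
    · exact fun j _ hj => hterm _ _ (Or.inr hj)
    · intro hnot
      rw [wtProj_eq_zero_of_notMem hnot, map_zero, map_zero]
    · exact fun i _ hi => Finset.sum_eq_zero fun j _ => hterm _ _ (Or.inl hi)
    · intro hnot
      refine Finset.sum_eq_zero fun j _ => ?_
      rw [wtProj_eq_zero_of_notMem hnot, map_zero, LinearMap.zero_apply]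
  · rw [hz' s' n (by omega), map_zero, if_neg]
    rintro ⟨rfl, h3⟩
    rw [D.len_swap] at hgt
    omega

open Classical in
variable (B b w) in
/-- A matrix that is block diagonal along the weights; the block of weight `-n < 0` is the Gram
matrix of the form `B u (y ^ n v)`. -/
def lefschetzMatrix (y : Module.End K V) : Matrix ι ι K := Matrix.of fun x' x =>
  if w x' = w x ∧ w x < 0 then B (b x') ((y ^ (-w x).toNat) (b x)) else if x' = x then 1 else 0

theorem isPolyFun_repr_pow (n : ℕ) (x x' : ι) :
    IsPolyFun fun y : Module.End K V => b.repr ((y ^ n) (b x)) x' := by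
  induction n generalizing x' with
  | zero => simpa using IsPolyFun.const (b.repr (b x) x')
  | succ n ih =>
    have : ∀ y : Module.End K V, b.repr ((y ^ (n + 1)) (b x)) x' =
        ∑ z, b.repr ((y ^ n) (b x)) z * (b.coord x' ∘ₗ LinearMap.applyₗ (b z)) y := by
      intro y
      rw [pow_succ', Module.End.mul_apply]
      conv_lhs => rw [← b.sum_repr ((y ^ n) (b x))]
      simp only [map_sum, map_smul, Finsupp.coe_finsetSum, Finset.sum_apply, Finsupp.coe_smul,
        Pi.smul_apply, smul_eq_mul]
      rfl
    simp only [this]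
    exact IsPolyFun.sum _ fun z => (ih z).mul (IsPolyFun.dual _)

theorem isPolyFun_det_lefschetzMatrix [DecidableEq ι] :
    IsPolyFun fun y : Module.End K V => (lefschetzMatrix B b w y).det := by
  refine IsPolyFun.det fun x' x => ?_
  simp only [lefschetzMatrix, Matrix.of_apply]
  split_ifs
  · have : ∀ y : Module.End K V, B (b x') ((y ^ (-w x).toNat) (b x)) =
        ∑ z, b.repr ((y ^ (-w x).toNat) (b x)) z * B (b x') (b z) := by
      intro y
      conv_lhs => rw [← b.sum_repr ((y ^ (-w x).toNat) (b x))]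
      simp only [map_sum, map_smul, smul_eq_mul]
    simp only [this]
    exact IsPolyFun.sum _ fun z => (isPolyFun_repr_pow _ _ _).mul (IsPolyFun.const _)
  · exact IsPolyFun.const _
  · exact IsPolyFun.const _

theorem det_lefschetzMatrix_ne_zero_iff [DecidableEq ι] (hBn : B.Nondegenerate)
    (hBw : ∀ x y, w x + w y ≠ 0 → B (b x) (b y) = 0) {y : Module.End K V}
    (hdeg : HasDeg b w y 2) : (lefschetzMatrix B b w y).det ≠ 0 ↔ IsLefschetz b w y := by
  classical
  constructor
  · intro hdet n v hv hyv
    rcases Nat.eq_zero_or_pos n with rfl | hn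
    · simpa using hyv
    have : (lefschetzMatrix B b w y).mulVec (fun x => b.repr v x) = 0 := by
      ext x'
      simp only [Matrix.mulVec, dotProduct, Pi.zero_apply, lefschetzMatrix, Matrix.of_apply]
      by_cases hx' : w x' = -n
      · have h1 : B (b x') ((y ^ n) v) = 0 := by rw [hyv, map_zero]
        rw [← b.sum_repr v] at h1
        simp only [map_sum, map_smul, smul_eq_mul] at h1
        rw [← h1]
        refine Finset.sum_congr rfl fun x _ => ?_
        by_cases hx : w x = -n
        · rw [if_pos ⟨by rw [hx, hx'], by omega⟩, hx, neg_neg, Int.toNat_natCast, mul_comm]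
        · rw [hv x hx, mul_zero, zero_mul]
      · refine Finset.sum_eq_zero fun x _ => ?_
        by_cases hx : w x = -n
        · rw [if_neg (by rw [hx]; exact fun h => hx' h.1), if_neg, zero_mul]
          rintro rfl
          exact hx' hx
        · rw [hv x hx, mul_zero]
    have h0 := Matrix.eq_zero_of_mulVec_eq_zero hdet this
    exact b.ext_elem fun x => by simpa using congrFun h0 x
  · intro hL hdet
    obtain ⟨c, hc0, hc⟩ := Matrix.exists_mulVec_eq_zero_iff.2 hdet
    apply hc0
    have hnonneg : ∀ x, 0 ≤ w x → c x = 0 := by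
      intro x hx
      have h1 := congrFun hc x
      simp only [Matrix.mulVec, dotProduct, Pi.zero_apply, lefschetzMatrix, Matrix.of_apply] at h1
      rw [Finset.sum_eq_single x] at h1
      · rwa [if_neg (by omega), if_pos rfl, one_mul] at h1
      · intro z _ hz
        rw [if_neg (by omega), if_neg hz.symm, zero_mul]
      · simp
    ext x₀
    rcases le_or_gt 0 (w x₀) with h0 | h0
    · exact hnonneg x₀ h0
    obtain ⟨n, hn⟩ : ∃ n : ℕ, w x₀ = -n := ⟨(-w x₀).toNat, by omega⟩
    let v : V := ∑ x, (if w x = -n then c x else 0) • b x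
    have hrepr : ∀ x, b.repr v x = if w x = -n then c x else 0 := fun x => by
      rw [show v = ∑ x, (if w x = -n then c x else 0) • b x from rfl, b.repr_sum_self]
    have hv : v ∈ wtSpace b w (-n) := fun x hx => by rw [hrepr, if_neg hx]
    have hyv : (y ^ n) v = 0 := by
      refine hBn.2 _ fun u => ?_
      rw [← b.sum_repr u]
      simp only [map_sum, map_smul, LinearMap.sum_apply, LinearMap.smul_apply]
      refine Finset.sum_eq_zero fun x' _ => ?_
      rw [smul_eq_zero]
      right
      by_cases hx' : w x' = -n
      · have h1 := congrFun hc x'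
        simp only [Matrix.mulVec, dotProduct, Pi.zero_apply, lefschetzMatrix, Matrix.of_apply] at h1
        rw [← h1, ← b.sum_repr v]
        simp only [map_sum, map_smul, smul_eq_mul, hrepr]
        refine Finset.sum_congr rfl fun x _ => ?_
        by_cases hx : w x = -n
        · rw [if_pos hx, if_pos ⟨by rw [hx, hx'], by omega⟩, hx, neg_neg, Int.toNat_natCast,
            mul_comm]
        · rw [if_neg hx, if_neg (by rw [hx']; exact fun h => hx h.1.symm), if_neg, zero_mul,
            zero_mul]
          rintro rfl
          exact hx hx'
      · refine apply_eq_zero_of_wt hBw ?_ (basis_mem_wtSpace x') ((hdeg.pow n).map hv)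
        omega
    have := hrepr x₀
    rw [hL n v hv hyv, if_pos hn] at this
    simpa using this.symm

end Basis

theorem mem_Sp_of_basis {ι : Type*} (b : Module.Basis ι K V)
    {g : LinearMap.GeneralLinearGroup K V}
    (h : ∀ x y, B (g.val (b x)) (g.val (b y)) = B (b x) (b y)) : g ∈ Sp B := by
  have : B.comp g.val g.val = B := b.ext fun x => b.ext fun y => h x y
  intro u u'
  conv_rhs => rw [← this]
  rfl

theorem IsSkew.conj {y : Module.End K V} (hy : IsSkew B y)
    {g : LinearMap.GeneralLinearGroup K V} (hg : g ∈ Sp B) :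
    IsSkew B (g.val * y * g⁻¹.val) := by
  intro v w
  have h1 := hg (y (g⁻¹.val v)) (g⁻¹.val w)
  have h2 := hg (g⁻¹.val v) (y (g⁻¹.val w))
  have h3 : ∀ u, g.val (g⁻¹.val u) = u := fun u => by
    rw [← Module.End.mul_apply, Units.mul_inv, Module.End.one_apply]
  rw [h3] at h1 h2
  simp only [Module.End.mul_apply]
  rw [h1, h2, hy]

section NormalForm

variable [FiniteDimensional K V] {e : Module.End K V} {D : StringData} {v : D.Str → V}

theorem IsNormalForm.form_basis (h : IsNormalForm B e D v) (he : IsSkew B e) (x y : D.Idx) :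
    B (h.basis he x) (h.basis he y) = if y = D.opp x then ((D.eta x : ℤ) : K) else 0 := by
  rw [h.basis_apply, h.basis_apply, h.form_chain he]

theorem IsNormalForm.form_basis_opp (h : IsNormalForm B e D v) (he : IsSkew B e) (u : V)
    (x : D.Idx) : B u (h.basis he (D.opp x)) = (h.basis he).repr u x * ((D.eta x : ℤ) : K) := by
  conv_lhs => rw [← (h.basis he).sum_repr u]
  simp only [map_sum, map_smul, LinearMap.sum_apply, LinearMap.smul_apply, h.form_basis,
    smul_eq_mul]
  rw [Finset.sum_eq_single x, if_pos rfl]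
  · intro y _ hy
    rw [if_neg, mul_zero]
    intro h4
    exact hy (by rw [← D.opp_opp y, ← h4, D.opp_opp])
  · simp

theorem IsNormalForm.form_basis_eq_zero (h : IsNormalForm B e D v) (he : IsSkew B e)
    (x y : D.Idx) (hxy : D.wt x + D.wt y ≠ 0) : B (h.basis he x) (h.basis he y) = 0 := by
  rw [h.form_basis, if_neg]
  rintro rfl
  exact hxy (by rw [D.wt_opp]; ring)

theorem IsNormalForm.diagGL_mem_Sp (h : IsNormalForm B e D v) (he : IsSkew B e)
    {d : D.Idx → Kˣ} (hd : ∀ x, d x * d (D.opp x) = 1) : diagGL (h.basis he) d ∈ Sp B := by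
  refine mem_Sp_of_basis (h.basis he) fun x y => ?_
  rw [diagGL_basis, diagGL_basis, map_smul, map_smul, LinearMap.smul_apply, smul_smul,
    h.form_basis]
  split_ifs with hxy
  · rw [hxy, mul_comm, ← Units.val_mul, hd, Units.val_one, one_smul]
  · rw [smul_zero]

theorem IsNormalForm.wtCochar_mem_Sp (h : IsNormalForm B e D v) (he : IsSkew B e) (t : Kˣ) :
    wtCochar (h.basis he) D.wt t ∈ Sp B :=
  h.diagGL_mem_Sp he fun x => by
    change t ^ D.wt x * t ^ D.wt (D.opp x) = 1
    rw [D.wt_opp, zpow_neg, mul_inv_cancel]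

theorem IsNormalForm.hasDeg (h : IsNormalForm B e D v) (he : IsSkew B e) :
    HasDeg (h.basis he) D.wt e 2 := by
  intro x
  rw [h.basis_apply, chain, ← Module.End.mul_apply, ← pow_succ']
  have hx := x.2.2
  by_cases hlt : (x.2 : ℕ) + 1 < D.len x.1
  · have h1 := basis_mem_wtSpace (b := h.basis he) (w := D.wt) ⟨x.1, ⟨x.2 + 1, hlt⟩⟩
    rw [h.basis_apply] at h1
    have h2 : D.wt ⟨x.1, ⟨x.2 + 1, hlt⟩⟩ = D.wt x + 2 := by
      simp only [StringData.wt]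
      push_cast
      ring
    rwa [h2] at h1
  · rw [show (x.2 : ℕ) + 1 = D.len x.1 by omega, h.pow_eq_zero]
    exact Submodule.zero_mem _

theorem IsNormalForm.isLefschetz (h : IsNormalForm B e D v) (he : IsSkew B e) :
    IsLefschetz (h.basis he) D.wt e := by
  intro n u hu hnu
  refine (h.basis he).ext_elem fun x => ?_
  rw [map_zero, Finsupp.zero_apply]
  by_cases hx : D.wt x = -n
  swap
  · exact hu x hx
  -- the vector dual to the basis vector `x` is in the image of `e ^ n`
  have hlt := x.2.2
  obtain ⟨z, hz⟩ : ∃ z, h.basis he (D.opp x) = (e ^ n) z := by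
    have h2 : ((D.opp x).2 : ℕ) = n + ((D.opp x).2 - n) := by
      simp only [StringData.wt] at hx
      simp only [StringData.opp]
      omega
    refine ⟨(e ^ ((D.opp x).2 - n : ℕ)) (v (D.opp x).1), ?_⟩
    rw [h.basis_apply, chain, ← Module.End.mul_apply, ← pow_add, ← h2]
  have h3 : B u (h.basis he (D.opp x)) = 0 := by
    have h4 := he.pow_left n u z
    rw [hnu, map_zero, LinearMap.zero_apply] at h4
    rw [hz]
    exact (mul_eq_zero.1 h4.symm).resolve_left (by simp)
  rw [h.form_basis_opp] at h3
  exact (mul_eq_zero.1 h3).resolve_right (intUnit_cast_ne_zero _)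

/-- Elements of degree two with the Lefschetz property form a single orbit under the Levi
subgroup. -/
theorem IsNormalForm.mem_leviOrbit [Infinite K] (h2 : (2 : K) ≠ 0) (hsq : ∀ x : K, IsSquare x)
    (hB : B.IsAlt) (hBn : B.Nondegenerate) (h : IsNormalForm B e D v) (he : IsSkew B e)
    {y : Module.End K V} (hy : IsSkew B y) (hdeg : HasDeg (h.basis he) D.wt y 2)
    (hL : IsLefschetz (h.basis he) D.wt y) :
    y ∈ leviOrbit B (wtCochar (h.basis he) D.wt) e := by
  have hnil : IsNilpotent y := by
    -- large powers of `y` leave the range of the weights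
    let N : ℕ := ∑ s, D.len s
    have hwt : ∀ x, -(N : ℤ) < D.wt x ∧ D.wt x < N := fun x => by
      have h1 : D.len x.1 ≤ N := Finset.single_le_sum (fun _ _ => Nat.zero_le _)
        (Finset.mem_univ _)
      have h3 := x.2.2
      simp only [StringData.wt]
      omega
    refine ⟨N, (h.basis he).ext fun x => (h.basis he).ext_elem fun x' => ?_⟩
    rw [LinearMap.zero_apply, map_zero, Finsupp.zero_apply]
    apply hdeg.pow N x x'
    have h1 := hwt x
    have h3 := hwt x'
    omega
  obtain ⟨D', v', hv'⟩ := exists_isNormalForm h2 _ rfl hB hBn hy hnil (Or.inl hsq)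
  have hv'' := hv'.homogenize (h.form_basis_eq_zero he) hy hdeg hL
  have hmem : ∀ x : D'.Idx, chain y (fun s => wtProj (h.basis he) D.wt (1 - D'.len s) (v' s)) x ∈
      wtSpace (h.basis he) D.wt (D'.wt x) := by
    intro x
    have h1 := (hdeg.pow x.2).map (wtProj_mem (b := h.basis he) (w := D.wt) (1 - D'.len x.1)
      (v' x.1))
    rwa [show (1 : ℤ) - D'.len x.1 + (x.2 : ℕ) * 2 = D'.wt x by
      simp only [StringData.wt]; ring] at h1
  have hcard : ∀ i, Fintype.card {x : D'.Idx // D'.wt x = i} =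
      Fintype.card {x : D.Idx // D.wt x = i} := by
    intro i
    rw [← finrank_wtSpace (h.basis he) D.wt basis_mem_wtSpace i,
      ← finrank_wtSpace (hv''.basis hy) D'.wt (fun x => by
        rw [hv''.basis_apply]; exact hmem x) i]
  obtain ⟨f, hf, hf'⟩ := hv''.reindex (StringData.card_len_of_card_wt hcard)
  obtain ⟨g, hg, hge, hgc⟩ := h.exists_isometry he hf' hy
  refine ⟨toGL g, mem_leviOf_iff.2 ⟨hg, fun x => ?_⟩, eq_conj_iff.2 fun u => (hge u).symm⟩
  rw [toGL_val, h.basis_apply, hgc, add_zero]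
  have h1 := hmem ⟨f x.1, ⟨x.2, by rw [hf]; exact x.2.2⟩⟩
  have h3 : D'.wt ⟨f x.1, ⟨x.2, by rw [hf]; exact x.2.2⟩⟩ = D.wt x := by
    simp only [StringData.wt, hf]
  rw [h3] at h1
  exact h1

theorem IsLefschetz.conj [Infinite K] (h : IsNormalForm B e D v) (he : IsSkew B e)
    {l : LinearMap.GeneralLinearGroup K V} (hl : l ∈ leviOf B (wtCochar (h.basis he) D.wt))
    {y : Module.End K V} (hy : IsLefschetz (h.basis he) D.wt y) :
    IsLefschetz (h.basis he) D.wt (l.val * y * l⁻¹.val) := by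
  intro n u hu hn
  have hl' := (mem_leviOf_iff.1 (Subgroup.inv_mem _ hl)).2.map hu
  rw [add_zero] at hl'
  have hpow : (l.val * y * l⁻¹.val) ^ n = l.val * y ^ n * l⁻¹.val :=
    Units.conj_pow l y n
  rw [hpow, Module.End.mul_apply, Module.End.mul_apply] at hn
  have h1 : ∀ (g : LinearMap.GeneralLinearGroup K V) z, g.val z = 0 → z = 0 := by
    intro g z hz
    have := congrArg g⁻¹.val hz
    rwa [← Module.End.mul_apply, Units.inv_mul, map_zero] at this
  exact h1 _ _ (hy n _ hl' (h1 _ _ hn))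

/-- The nilpotent element of a normal form lies in the dense orbit of the Levi subgroup. -/
theorem IsNormalForm.mem_regularPart [Infinite K] (h2 : (2 : K) ≠ 0)
    (hsq : ∀ x : K, IsSquare x) (hB : B.IsAlt) (hBn : B.Nondegenerate)
    (h : IsNormalForm B e D v) (he : IsSkew B e) :
    e ∈ regularPart B (wtCochar (h.basis he) D.wt) 2 := by
  have hmem : e ∈ weightSpace B (wtCochar (h.basis he) D.wt) 2 :=
    mem_weightSpace_iff.2 ⟨he, h.hasDeg he⟩
  have hiff : ∀ {y : Module.End K V}, HasDeg (h.basis he) D.wt y 2 →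
      ((lefschetzMatrix B (h.basis he) D.wt y).det ≠ 0 ↔ IsLefschetz (h.basis he) D.wt y) :=
    fun hdeg => det_lefschetzMatrix_ne_zero_iff hBn (h.form_basis_eq_zero he) hdeg
  have hpoly : IsPolyFun fun y : Module.End K V =>
    (lefschetzMatrix B (h.basis he) D.wt y).det := isPolyFun_det_lefschetzMatrix
  refine ⟨hmem, ⟨_, hpoly.isOpen_ne_zero, ?_⟩, ?_⟩
  · ext y
    constructor
    · rintro ⟨l, hl, rfl⟩
      have hw : l.val * e * l⁻¹.val ∈ weightSpace B (wtCochar (h.basis he) D.wt) 2 := by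
        refine mem_weightSpace_iff.2 ⟨he.conj (mem_leviOf_iff.1 hl).1, fun x => ?_⟩
        have h3 := (mem_leviOf_iff.1 hl).2.map ((h.hasDeg he).map
          ((mem_leviOf_iff.1 (Subgroup.inv_mem _ hl)).2 x))
        rwa [add_zero, add_zero] at h3
      exact ⟨(hiff (mem_weightSpace_iff.1 hw).2).2 ((h.isLefschetz he).conj h he hl), hw⟩
    · rintro ⟨hy, hyw⟩
      obtain ⟨hy1, hy2⟩ := mem_weightSpace_iff.1 hyw
      exact h.mem_leviOrbit h2 hsq hB hBn he hy1 hy2 ((hiff hy2).1 hy)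
  · intro y hy
    obtain ⟨hy1, hy2⟩ := mem_weightSpace_iff.1 hy
    refine mem_closure_of_isPolyFun hpoly
      ((hiff (h.hasDeg he)).2 (h.isLefschetz he)) fun t ht => ?_
    have hs : IsSkew B (e + t • (y - e)) := fun u u' => by
      simp only [LinearMap.add_apply, LinearMap.smul_apply, LinearMap.sub_apply, map_add, map_smul,
        map_sub, smul_eq_mul, he u u', hy1 u u']
      ring
    have hd : HasDeg (h.basis he) D.wt (e + t • (y - e)) 2 := fun x =>
      Submodule.add_mem _ (h.hasDeg he x) (Submodule.smul_mem _ _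
        (Submodule.sub_mem _ (hy2 x) (h.hasDeg he x)))
    exact h.mem_leviOrbit h2 hsq hB hBn he hs hd ((hiff hd).1 ht)

end NormalForm

end Orbit

/-! ### Rational curves in linear groups -/

section Curves

variable {K : Type*} [Field K] {V : Type*} [AddCommGroup V] [Module K V]

/-- `f` is regular on the locus where `P` does not vanish: it is the quotient of a polynomial by a
power of `P`. -/
def IsRegularOn (P : Polynomial K) (f : K → K) : Prop :=
  ∃ (Q : Polynomial K) (n : ℕ), ∀ t, P.eval t ≠ 0 → f t * P.eval t ^ n = Q.eval t

theorem IsRegularOn.const (P : Polynomial K) (c : K) : IsRegularOn P fun _ => c :=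
  ⟨Polynomial.C c, 0, fun t _ => by simp⟩

theorem IsRegularOn.mul {P : Polynomial K} {f g : K → K} (hf : IsRegularOn P f)
    (hg : IsRegularOn P g) : IsRegularOn P fun t => f t * g t := by
  obtain ⟨Q, n, hQ⟩ := hf
  obtain ⟨R, m, hR⟩ := hg
  refine ⟨Q * R, n + m, fun t ht => ?_⟩
  rw [Polynomial.eval_mul, ← hQ t ht, ← hR t ht]
  ring

theorem IsRegularOn.add {P : Polynomial K} {f g : K → K} (hf : IsRegularOn P f)
    (hg : IsRegularOn P g) : IsRegularOn P fun t => f t + g t := by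
  obtain ⟨Q, n, hQ⟩ := hf
  obtain ⟨R, m, hR⟩ := hg
  refine ⟨Q * P ^ m + R * P ^ n, n + m, fun t ht => ?_⟩
  rw [Polynomial.eval_add, Polynomial.eval_mul, Polynomial.eval_mul, Polynomial.eval_pow,
    Polynomial.eval_pow, ← hQ t ht, ← hR t ht]
  ring

theorem IsRegularOn.sum {P : Polynomial K} {α : Type*} (s : Finset α) {f : α → K → K}
    (hf : ∀ a, IsRegularOn P (f a)) : IsRegularOn P fun t => ∑ a ∈ s, f a t := by
  classical
  induction s using Finset.induction with
  | empty => simpa using IsRegularOn.const P 0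
  | insert a s ha ih =>
    simp only [Finset.sum_insert ha]
    exact (hf a).add ih

theorem IsRegularOn.mvPolynomial {P : Polynomial K} {σ : Type*} {f : σ → K → K}
    (hf : ∀ a, IsRegularOn P (f a)) (R : MvPolynomial σ K) :
    IsRegularOn P fun t => MvPolynomial.eval (fun a => f a t) R := by
  induction R using MvPolynomial.induction_on with
  | C c => simpa using IsRegularOn.const P c
  | add R S hR hS => simpa using hR.add hS
  | mul_X R a hR => simpa using hR.mul (hf a)

theorem IsRegularOn.dual {P : Polynomial K} {ι : Type*} [Fintype ι] (b : Module.Basis ι K V)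
    {γ : K → LinearMap.GeneralLinearGroup K V}
    (hγ : ∀ x x', IsRegularOn P fun t => b.repr ((γ t).val (b x)) x')
    (ξ : Module.Dual K (Module.End K V)) : IsRegularOn P fun t => ξ (γ t).val := by
  classical
  have key : ∀ z : Module.End K V, z = ∑ x, ∑ x', b.repr (z (b x)) x' •
      b.constr K (fun y => if y = x then b x' else 0) := by
    intro z
    refine b.ext fun y => ?_
    simp only [LinearMap.sum_apply, LinearMap.smul_apply, Module.Basis.constr_basis]
    rw [Finset.sum_eq_single y]
    · simp only [if_true]
      rw [b.sum_repr]
    · intro x _ hx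
      exact Finset.sum_eq_zero fun x' _ => by rw [if_neg hx.symm, smul_zero]
    · simp
  have : (fun t => ξ (γ t).val) = fun t => ∑ x, ∑ x', b.repr ((γ t).val (b x)) x' *
      ξ (b.constr K (fun y => if y = x then b x' else 0)) := by
    funext t
    conv_lhs => rw [key (γ t).val]
    simp only [map_sum, map_smul, smul_eq_mul]
  rw [this]
  exact IsRegularOn.sum _ fun x => IsRegularOn.sum _ fun x' => (hγ x x').mul (IsRegularOn.const _ _)

/-- A rational curve in `H` through the identity stays in the identity component. -/
theorem mem_identityComponent_of_curve [Infinite K] {ι : Type*} [Fintype ι]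
    (b : Module.Basis ι K V) {H : Subgroup (LinearMap.GeneralLinearGroup K V)}
    (P : Polynomial K) (γ : K → LinearMap.GeneralLinearGroup K V)
    (hH : ∀ t, P.eval t ≠ 0 → γ t ∈ H)
    (hγ : ∀ x x', IsRegularOn P fun t => b.repr ((γ t).val (b x)) x')
    {t₀ t₁ : K} (h₀ : P.eval t₀ ≠ 0) (h₁ : P.eval t₁ ≠ 0) (h1 : γ t₀ = 1) :
    γ t₁ ∈ identityComponent H := by
  let _ := zariskiGL K V
  have hP : P ≠ 0 := by rintro rfl; simp at h₀
  have hpre : IsPreconnected (γ '' {t | P.eval t ≠ 0}) := by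
    rw [isPreconnected_closed_iff]
    rintro Z Z' hZ hZ' hsub ⟨_, ⟨a, ha, rfl⟩, haZ⟩ ⟨_, ⟨a', ha', rfl⟩, haZ'⟩
    obtain ⟨T, hT, rfl⟩ := (@isClosed_induced_iff _ _ (zariski K (Module.End K V)) _ _).1 hZ
    obtain ⟨T', hT', rfl⟩ := (@isClosed_induced_iff _ _ (zariski K (Module.End K V)) _ _).1 hZ'
    obtain ⟨S, rfl⟩ := isClosed_zariski_iff.1 hT
    obtain ⟨S', rfl⟩ := isClosed_zariski_iff.1 hT'
    by_contra hne
    -- neither closed set contains the curve, so two polynomials do not vanish identically on it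
    have h3 : γ a ∉ Units.val ⁻¹' zeros K (Module.End K V) S' := fun h =>
      hne ⟨γ a, ⟨a, ha, rfl⟩, haZ, h⟩
    have h4 : γ a' ∉ Units.val ⁻¹' zeros K (Module.End K V) S := fun h =>
      hne ⟨γ a', ⟨a', ha', rfl⟩, h, haZ'⟩
    simp only [Set.mem_preimage, zeros, Set.mem_ofPred_eq, not_forall] at h3 h4
    obtain ⟨R', hR', h3⟩ := h3
    obtain ⟨R, hR, h4⟩ := h4
    obtain ⟨Q, n, hQ⟩ := IsRegularOn.mvPolynomial (fun ξ => IsRegularOn.dual b hγ ξ) R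
    obtain ⟨Q', n', hQ'⟩ := IsRegularOn.mvPolynomial (fun ξ => IsRegularOn.dual b hγ ξ) R'
    simp only at hQ hQ'
    have hzero : Q * Q' * P = 0 := by
      refine Polynomial.funext fun t => ?_
      rw [Polynomial.eval_mul, Polynomial.eval_mul, Polynomial.eval_zero]
      by_cases ht : P.eval t = 0
      · rw [ht, mul_zero]
      rw [← hQ t ht, ← hQ' t ht]
      rcases hsub ⟨t, ht, rfl⟩ with h | h
      · rw [h R hR]; ring
      · rw [h R' hR']; ring
    rcases mul_eq_zero.1 hzero with h | h
    · rcases mul_eq_zero.1 h with rfl | rfl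
      · have := hQ a' ha'
        rw [Polynomial.eval_zero] at this
        exact (mul_ne_zero h4 (pow_ne_zero _ ha')) this
      · have := hQ' a ha
        rw [Polynomial.eval_zero] at this
        exact (mul_ne_zero h3 (pow_ne_zero _ ha)) this
    · exact hP h
  have := hpre.subset_connectedComponentIn (F := (H : Set (LinearMap.GeneralLinearGroup K V)))
    (x := 1) ⟨t₀, h₀, h1⟩ (by rintro _ ⟨t, ht, rfl⟩; exact hH t ht)
  exact this ⟨t₁, h₁, rfl⟩

/-- One-parameter subgroups of diagonal operators are connected. -/
theorem diagGL_mem_identityComponent [Infinite K] {ι : Type*} [Fintype ι] (b : Module.Basis ι K V)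
    {H : Subgroup (LinearMap.GeneralLinearGroup K V)} (n : ι → ℤ)
    (hH : ∀ t : Kˣ, diagGL b (fun x => t ^ n x) ∈ H) (t : Kˣ) :
    diagGL b (fun x => t ^ n x) ∈ identityComponent H := by
  classical
  let γ : K → LinearMap.GeneralLinearGroup K V := fun c =>
    if hc : c = 0 then 1 else diagGL b fun x => (Units.mk0 c hc) ^ n x
  have hγ : ∀ (c : K) (hc : c ≠ 0), γ c = diagGL b fun x => (Units.mk0 c hc) ^ n x :=
    fun c hc => dif_neg hc
  have h1 : γ t.val = diagGL b fun x => t ^ n x := by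
    rw [hγ _ t.ne_zero, Units.mk0_val]
  rw [← h1]
  refine mem_identityComponent_of_curve b Polynomial.X γ (fun c hc => ?_) (fun x x' => ?_)
    (t₀ := 1) (by simp) (by simp) ?_
  · rw [hγ c (by simpa using hc)]
    exact hH _
  · refine ⟨Polynomial.C (b.repr (b x) x') *
      Polynomial.X ^ (n x' + (n x').natAbs).toNat, (n x').natAbs, fun c hc => ?_⟩
    have hc' : c ≠ 0 := by simpa using hc
    simp only
    rw [hγ c hc', diagGL_repr]
    simp only [Polynomial.eval_mul, Polynomial.eval_C, Polynomial.eval_pow, Polynomial.eval_X,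
      Units.val_zpow_eq_zpow_val, Units.val_mk0]
    have h3 : c ^ n x' * c ^ (n x').natAbs = c ^ (n x' + (n x').natAbs).toNat := by
      rw [← zpow_natCast, ← zpow_natCast, ← zpow_add₀ hc', Int.toNat_of_nonneg (by omega)]
    rw [← h3]
    ring
  · rw [hγ 1 one_ne_zero]
    have : (fun x => Units.mk0 (1 : K) one_ne_zero ^ n x) = 1 := by
      funext x; ext; simp
    rw [this, map_one]

/-- An element `g` of a centraliser in `Sp(V)` without the eigenvalue `-1` lies in the identity
component: the curve `c ↦ (g + c) (1 + c g)⁻¹` leads from `g` to `1`. -/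
theorem mem_identityComponent_of_isUnit [Infinite K] [FiniteDimensional K V]
    {B : LinearMap.BilinForm K V} (hBn : B.Nondegenerate)
    {S : Set (LinearMap.GeneralLinearGroup K V)} {g : LinearMap.GeneralLinearGroup K V}
    (hg : g ∈ centralizerIn (Sp B) S) (hunit : IsUnit (1 + g.val)) :
    g ∈ identityComponent (centralizerIn (Sp B) S) := by
  classical
  let b := Module.finBasis K V
  let G := LinearMap.toMatrix b b g.val
  let M : Matrix (Fin (Module.finrank K V)) (Fin (Module.finrank K V)) (Polynomial K) :=
    1 + (Polynomial.X : Polynomial K) • G.map (Polynomial.C : K →+* Polynomial K)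
  let N : Matrix (Fin (Module.finrank K V)) (Fin (Module.finrank K V)) (Polynomial K) :=
    G.map (Polynomial.C : K →+* Polynomial K) + (Polynomial.X : Polynomial K) • 1
  have hM : ∀ c, (Polynomial.evalRingHom c).mapMatrix M =
      LinearMap.toMatrix b b (1 + c • g.val) := by
    intro c
    have : LinearMap.toMatrix b b (1 + c • g.val) = 1 + c • G := by
      rw [map_add, LinearMap.toMatrix_one, map_smul]
    rw [this]
    ext i j
    simp only [M, map_add, map_one, Matrix.add_apply, RingHom.mapMatrix_apply, Matrix.map_apply,
      Matrix.smul_apply, smul_eq_mul, Polynomial.coe_evalRingHom, Polynomial.eval_mul,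
      Polynomial.eval_X, Polynomial.eval_C]
  have hN : ∀ c, (Polynomial.evalRingHom c).mapMatrix N =
      LinearMap.toMatrix b b (g.val + c • 1) := by
    intro c
    have : LinearMap.toMatrix b b (g.val + c • (1 : Module.End K V)) = G + c • 1 := by
      rw [map_add, map_smul, LinearMap.toMatrix_one]
    rw [this]
    ext i j
    simp only [N, map_add, Matrix.add_apply, RingHom.mapMatrix_apply, Matrix.map_apply,
      Matrix.smul_apply, smul_eq_mul, Polynomial.coe_evalRingHom, Polynomial.eval_mul,
      Polynomial.eval_X, Polynomial.eval_C, Matrix.one_apply]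
    split_ifs <;> simp
  have hdet : ∀ c, M.det.eval c = LinearMap.det (1 + c • g.val) := by
    intro c
    rw [← LinearMap.det_toMatrix b, ← hM, ← RingHom.map_det]
    rfl
  have hunit1 : ∀ c, M.det.eval c ≠ 0 → IsUnit (1 + c • g.val) := by
    intro c hc
    rw [LinearMap.isUnit_iff_isUnit_det, ← hdet]
    exact isUnit_iff_ne_zero.2 hc
  have hform : ∀ (c : K) (v w : V),
      B ((g.val + c • 1 : Module.End K V) v) ((g.val + c • 1 : Module.End K V) w) =
        B ((1 + c • g.val : Module.End K V) v) ((1 + c • g.val : Module.End K V) w) := by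
    intro c v w
    have := hg.1 v w
    simp only [LinearMap.add_apply, LinearMap.smul_apply, Module.End.one_apply, map_add, map_smul,
      smul_eq_mul, this]
    ring
  have hunit2 : ∀ c, M.det.eval c ≠ 0 → IsUnit (g.val + c • (1 : Module.End K V)) := by
    intro c hc
    obtain ⟨a, ha⟩ := hunit1 c hc
    rw [LinearMap.isUnit_iff_ker_eq_bot, LinearMap.ker_eq_bot']
    intro v hv
    have h1 : (1 + c • g.val : Module.End K V) v = 0 := by
      refine hBn.1 _ fun w => ?_
      have h3 := hform c v (a⁻¹.val w)
      rw [hv, map_zero, LinearMap.zero_apply, ← ha, ← Module.End.mul_apply a.val a⁻¹.val,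
        Units.mul_inv, Module.End.one_apply] at h3
      rw [← ha]
      exact h3.symm
    rw [← ha] at h1
    have := congrArg a⁻¹.val h1
    rwa [← Module.End.mul_apply, Units.inv_mul, map_zero, Module.End.one_apply] at this
  let γ : K → LinearMap.GeneralLinearGroup K V := fun c =>
    if hc : M.det.eval c ≠ 0 then (hunit2 c hc).unit * (hunit1 c hc).unit⁻¹ else 1
  have hγ : ∀ c, M.det.eval c ≠ 0 → (γ c).val * (1 + c • g.val) = g.val + c • 1 := by
    intro c hc
    simp only [γ, dif_pos hc]
    have := congrArg Units.val (inv_mul_cancel_right (hunit2 c hc).unit (hunit1 c hc).unit)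
    rwa [Units.val_mul, IsUnit.unit_spec, IsUnit.unit_spec] at this
  have h0 : M.det.eval 0 ≠ 0 := by
    rw [hdet, zero_smul, add_zero]
    simp
  have h1 : M.det.eval 1 ≠ 0 := by
    rw [hdet, one_smul]
    exact (LinearMap.isUnit_iff_isUnit_det _).1 hunit |>.ne_zero
  have hg0 : γ 0 = g := by
    have := hγ 0 h0
    rw [zero_smul, zero_smul, add_zero, add_zero, mul_one] at this
    exact Units.ext this
  rw [← hg0]
  refine mem_identityComponent_of_curve b M.det γ (fun c hc => ?_) (fun x x' => ?_) h1 h0 ?_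
  · obtain ⟨a, ha⟩ := hunit1 c hc
    have hval := hγ c hc
    refine ⟨fun v w => ?_, ?_⟩
    · have hsurj : ∀ v, ∃ v', (1 + c • g.val : Module.End K V) v' = v := fun v => ⟨a⁻¹.val v, by
        rw [← ha, ← Module.End.mul_apply, Units.mul_inv, Module.End.one_apply]⟩
      obtain ⟨v', rfl⟩ := hsurj v
      obtain ⟨w', rfl⟩ := hsurj w
      rw [← Module.End.mul_apply, ← Module.End.mul_apply, hval, hform]
    · change γ c ∈ Subgroup.centralizer S
      rw [Subgroup.mem_centralizer_iff]
      intro s hs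
      have hgs : s * g = g * s := Subgroup.mem_centralizer_iff.1 hg.2 s hs
      have hgs' : Commute s.val g.val := congrArg Units.val hgs
      have h3 : Commute s.val a.val := by
        rw [ha]
        exact (Commute.one_right _).add_right (hgs'.smul_right c)
      have h4 : Commute s.val (g.val + c • (1 : Module.End K V)) :=
        hgs'.add_right ((Commute.one_right _).smul_right c)
      have h5 : (γ c).val = (g.val + c • 1) * a⁻¹.val := by
        rw [← hval, ← ha, mul_assoc, Units.mul_inv, mul_one]
      apply Units.ext
      rw [Units.val_mul, Units.val_mul, h5]
      exact (h4.mul_right h3.units_inv_right).eq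
  · refine ⟨(N * M.adjugate) x' x, 1, fun c hc => ?_⟩
    have h3 := congrArg (LinearMap.toMatrix b b) (hγ c hc)
    rw [LinearMap.toMatrix_mul, ← hM, ← hN] at h3
    have h4 := congrArg (· * (Polynomial.evalRingHom c).mapMatrix M.adjugate) h3
    simp only [Matrix.mul_assoc, ← map_mul, Matrix.mul_adjugate] at h4
    have h5 := congrFun (congrFun h4 x') x
    have h6 : (Polynomial.evalRingHom c).mapMatrix (M.det • (1 : Matrix (Fin (Module.finrank K V))
        (Fin (Module.finrank K V)) (Polynomial K))) = M.det.eval c • 1 := by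
      ext i j
      by_cases hij : i = j <;> simp [hij]
    rw [h6, Matrix.mul_smul, Matrix.mul_one, Matrix.smul_apply, LinearMap.toMatrix_apply] at h5
    rw [pow_one, mul_comm]
    exact h5
  · have := hγ 1 h1
    rw [one_smul, one_smul, add_comm g.val] at this
    exact Units.ext ((hunit.mul_left_inj).1 (by rw [this, Units.val_one, one_mul]))

end Curves

/-! ### Invertible perturbations of block diagonal matrices -/

section Blocks

variable {K : Type*} [Field K]

theorem det_bool {R : Type*} [CommRing R] (M : Matrix Bool Bool R) :
    M.det = M false false * M true true - M false true * M true false := by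
  rw [← Matrix.det_submatrix_equiv_self finTwoEquiv M, Matrix.det_fin_two]
  rfl

/-- If every `κ × κ` matrix becomes invertible after adding a suitable element of `S`, then every
matrix becomes invertible after adding a suitable block diagonal matrix with blocks in `S`.  The
blocks are chosen one at a time, each for a Schur complement. -/
theorem exists_det_blockDiagonal_add_ne_zero {κ : Type*} [Fintype κ] [DecidableEq κ]
    {S : Set (Matrix κ κ K)} (hS : ∀ q : Matrix κ κ K, ∃ c ∈ S, (c + q).det ≠ 0)
    (β : Type) [Fintype β] [DecidableEq β] (Q : Matrix (κ × β) (κ × β) K) :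
    ∃ c : β → Matrix κ κ K, (∀ i, c i ∈ S) ∧ (Matrix.blockDiagonal c + Q).det ≠ 0 := by
  revert Q
  let P : ∀ (β : Type) [Fintype β], Prop := fun β _ => ∀ [DecidableEq β]
    (Q : Matrix (κ × β) (κ × β) K),
    ∃ c : β → Matrix κ κ K, (∀ i, c i ∈ S) ∧ (Matrix.blockDiagonal c + Q).det ≠ 0
  suffices h : P β from h
  refine Fintype.induction_empty_option (P := P) ?_ ?_ ?_ β
  · intro α β _ f h _ Q
    classical
    let _ : Fintype α := Fintype.ofEquiv β f.symm
    obtain ⟨c, hc, hdet⟩ := h (Q.submatrix (Prod.map id f) (Prod.map id f))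
    refine ⟨fun i => c (f.symm i), fun i => hc _, ?_⟩
    rw [← Matrix.det_submatrix_equiv_self (Equiv.prodCongr (Equiv.refl κ) f)]
    convert hdet using 2
    ext ⟨k, i⟩ ⟨l, j⟩
    simp [Matrix.blockDiagonal_apply]
  · intro _ Q
    refine ⟨fun i => i.elim, fun i => i.elim, ?_⟩
    rw [Matrix.det_isEmpty]
    exact one_ne_zero
  · intro β _ h _ Q
    classical
    let f : κ ⊕ κ × β ≃ κ × Option β :=
      { toFun := Sum.elim (fun k => (k, none)) fun x => (x.1, some x.2)
        invFun := fun x => x.2.elim (Sum.inl x.1) fun i => Sum.inr (x.1, i)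
        left_inv := by rintro (k | ⟨k, i⟩) <;> rfl
        right_inv := by rintro ⟨k, _ | i⟩ <;> rfl }
    let Q' := Q.submatrix f f
    obtain ⟨c, hc, hdet⟩ := h Q'.toBlocks₂₂
    set E := Matrix.blockDiagonal c + Q'.toBlocks₂₂
    let _ := Matrix.invertibleOfIsUnitDet E (isUnit_iff_ne_zero.2 hdet)
    obtain ⟨c₀, hc₀, hdet₀⟩ := hS (Q'.toBlocks₁₁ - Q'.toBlocks₁₂ * ⅟E * Q'.toBlocks₂₁)
    refine ⟨fun i => i.elim c₀ c, fun i => by cases i; exacts [hc₀, hc _], ?_⟩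
    rw [← Matrix.det_submatrix_equiv_self f]
    have : (Matrix.blockDiagonal (fun i : Option β => i.elim c₀ c) + Q).submatrix f f =
        Matrix.fromBlocks (c₀ + Q'.toBlocks₁₁) Q'.toBlocks₁₂ Q'.toBlocks₂₁ E := by
      ext (k | ⟨k, i⟩) (l | ⟨l, j⟩) <;>
        simp [f, E, Q', Matrix.blockDiagonal_apply, Matrix.toBlocks₁₁, Matrix.toBlocks₁₂,
          Matrix.toBlocks₂₁, Matrix.toBlocks₂₂]
    rw [this, Matrix.det_fromBlocks₂₂]
    refine mul_ne_zero hdet ?_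
    rwa [add_sub_assoc]

theorem exists_sign_add_ne_zero (h2 : (2 : K) ≠ 0) (q : Matrix Unit Unit K) :
    ∃ c ∈ Set.range fun ε : ℤˣ => (Matrix.of fun _ _ => ((ε : ℤ) : K) : Matrix Unit Unit K),
      (c + q).det ≠ 0 := by
  by_contra! h
  have h1 := h _ ⟨1, rfl⟩
  have h3 := h _ ⟨-1, rfl⟩
  simp only [Matrix.det_unique, Matrix.add_apply, Matrix.of_apply, Units.val_one, Int.cast_one,
    Units.val_neg, Int.cast_neg] at h1 h3
  exact h2 (by linear_combination h1 - h3)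

theorem exists_specialLinear_add_ne_zero [Infinite K] (h2 : (2 : K) ≠ 0)
    (q : Matrix Bool Bool K) :
    ∃ c ∈ {M : Matrix Bool Bool K | M.det = 1 ∧ (1 + M).det ≠ 0}, (c + q).det ≠ 0 := by
  by_contra! h
  -- the matrix with the given diagonal `x, y` and off-diagonal entries `z, t`
  let m : K → K → K → K → Matrix Bool Bool K := fun x y z t => Matrix.of fun i j =>
    if i then (if j then y else t) else (if j then z else x)
  have hm : ∀ x y z t, x * y - z * t = 1 → (1 + x) * (1 + y) - z * t ≠ 0 →
      (x + q false false) * (y + q true true) - (z + q false true) * (t + q true false) = 0 := by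
    intro x y z t h1 h3
    have := h (m x y z t) ⟨by simpa [det_bool, m] using h1, by simpa [det_bool, m] using h3⟩
    simpa [det_bool, m] using this
  have h4 : (2 : K) * 2 ≠ 0 := mul_ne_zero h2 h2
  have e1 := hm 1 1 0 0 (by ring) (by ring_nf; ring_nf at h4; exact h4)
  have e2 := hm 1 1 1 0 (by ring) (by ring_nf; ring_nf at h4; exact h4)
  have e3 := hm 1 1 0 1 (by ring) (by ring_nf; ring_nf at h4; exact h4)
  have hc : q true false = 0 := by linear_combination e1 - e2
  have hb : q false true = 0 := by linear_combination e1 - e3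
  obtain ⟨t, ht⟩ : ∃ t : K, (Polynomial.X * (Polynomial.X + 1) *
      (Polynomial.X + Polynomial.C (q false false)) *
      (1 + Polynomial.C (q true true) * Polynomial.X)).eval t ≠ 0 := by
    by_contra! h0
    have h1 := Polynomial.funext (q := 0) fun t => by rw [h0 t, Polynomial.eval_zero]
    rcases mul_eq_zero.1 h1 with h1 | h1
    · refine ((Polynomial.monic_X.mul (Polynomial.monic_X_add_C (1 : K))).mul
        (Polynomial.monic_X_add_C (q false false))).ne_zero ?_
      simpa using h1
    · have := congrArg (Polynomial.eval 0) h1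
      simp at this
  simp only [Polynomial.eval_mul, Polynomial.eval_add, Polynomial.eval_X, Polynomial.eval_one,
    Polynomial.eval_C, mul_ne_zero_iff] at ht
  obtain ⟨⟨⟨ht0, ht1⟩, ht2⟩, ht3⟩ := ht
  have e4 := hm t t⁻¹ 0 0 (by field_simp; ring) (by
    have : (1 + t) * (1 + t⁻¹) - 0 * 0 = (t + 1) * (t + 1) * t⁻¹ := by field_simp; ring
    rw [this]
    exact mul_ne_zero (mul_ne_zero ht1 ht1) (inv_ne_zero ht0))
  rw [hb, hc] at e4
  have : (t + q false false) * (1 + q true true * t) = 0 := by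
    have h5 : t * t⁻¹ = 1 := mul_inv_cancel₀ ht0
    linear_combination t * e4 - (t + q false false) * h5
  exact mul_ne_zero ht2 ht3 this

variable {I J : Type} [Fintype I] [Fintype J] [DecidableEq I] [DecidableEq J]

/-- The block diagonal matrix with a scalar block `c i` for each `i : I` and a `2 × 2` block
`M j` for each `j : J`. -/
def blockMat (c : I → K) (M : J → Matrix Bool Bool K) :
    Matrix (I ⊕ J × Bool) (I ⊕ J × Bool) K :=
  Matrix.fromBlocks (Matrix.diagonal c) 0 0
    ((Matrix.blockDiagonal M).submatrix (Equiv.prodComm J Bool) (Equiv.prodComm J Bool))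

theorem det_blockMat (c : I → K) (M : J → Matrix Bool Bool K) :
    (blockMat c M).det = (∏ i, c i) * ∏ j, (M j).det := by
  rw [blockMat, Matrix.det_fromBlocks_zero₂₁, Matrix.det_diagonal,
    Matrix.det_submatrix_equiv_self, Matrix.det_blockDiagonal]

omit [Fintype I] [Fintype J] in
theorem blockMat_add (c c' : I → K) (M M' : J → Matrix Bool Bool K) :
    blockMat c M + blockMat c' M' = blockMat (c + c') (M + M') := by
  rw [blockMat, blockMat, blockMat, Matrix.fromBlocks_add, Matrix.diagonal_add,
    Matrix.blockDiagonal_add, zero_add, zero_add]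
  rfl

theorem exists_det_blockMat_add_ne_zero [Infinite K] (h2 : (2 : K) ≠ 0)
    (Q : Matrix (I ⊕ J × Bool) (I ⊕ J × Bool) K) :
    ∃ (ε : I → ℤˣ) (M : J → Matrix Bool Bool K), (∀ j, (M j).det = 1) ∧
      (∀ j, (1 + M j).det ≠ 0) ∧ (blockMat (fun i => ((ε i : ℤ) : K)) M + Q).det ≠ 0 := by
  obtain ⟨M, hM, hdet⟩ := exists_det_blockDiagonal_add_ne_zero
    (exists_specialLinear_add_ne_zero (K := K) h2) J
    (Q.toBlocks₂₂.submatrix (Equiv.prodComm Bool J) (Equiv.prodComm Bool J))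
  set E := (Matrix.blockDiagonal M).submatrix (Equiv.prodComm J Bool) (Equiv.prodComm J Bool) +
    Q.toBlocks₂₂ with hE
  have hE' : E.det ≠ 0 := by
    rw [← Matrix.det_submatrix_equiv_self (Equiv.prodComm Bool J)]
    exact hdet
  let _ := Matrix.invertibleOfIsUnitDet E (isUnit_iff_ne_zero.2 hE')
  set Q₁ := Q.toBlocks₁₁ - Q.toBlocks₁₂ * ⅟E * Q.toBlocks₂₁
  obtain ⟨c, hc, hdet'⟩ := exists_det_blockDiagonal_add_ne_zero (exists_sign_add_ne_zero h2) I
    (Q₁.submatrix (Equiv.punitProd I) (Equiv.punitProd I))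
  choose ε hε using hc
  refine ⟨ε, M, fun j => (hM j).1, fun j => (hM j).2, ?_⟩
  have h1 : blockMat (fun i => ((ε i : ℤ) : K)) M + Q = Matrix.fromBlocks
      (Matrix.diagonal (fun i => ((ε i : ℤ) : K)) + Q.toBlocks₁₁) Q.toBlocks₁₂ Q.toBlocks₂₁ E := by
    conv_lhs => rw [← Matrix.fromBlocks_toBlocks Q, blockMat, Matrix.fromBlocks_add]
    rw [zero_add, zero_add]
  rw [h1, Matrix.det_fromBlocks₂₂, add_sub_assoc]
  refine mul_ne_zero hE' ?_
  rw [← Matrix.det_submatrix_equiv_self (Equiv.punitProd I)]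
  convert hdet' using 2
  ext ⟨_, i⟩ ⟨_, j⟩
  simp only [Matrix.submatrix_apply, Matrix.add_apply, Equiv.punitProd_apply,
    Matrix.blockDiagonal_apply, Matrix.diagonal_apply, ← hε, Matrix.of_apply, Q₁]

end Blocks

/-! ### The component group of a centraliser -/

section Centralizer

variable {K : Type*} [Field K] {V : Type*} [AddCommGroup V] [Module K V] [FiniteDimensional K V]
  {B : LinearMap.BilinForm K V} {e : Module.End K V} {D : StringData} {v : D.Str → V}

/-- The index of the last element of a string. -/
def StringData.top (D : StringData) (s : D.Str) : D.Idx :=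
  ⟨s, ⟨D.len s - 1, Nat.sub_lt (D.len_pos s) one_pos⟩⟩

theorem IsNormalForm.apply_basis (h : IsNormalForm B e D v) (he : IsSkew B e) (x : D.Idx) :
    e (h.basis he x) = 0 ∨ ∃ y : D.Idx, y.1 = x.1 ∧ e (h.basis he x) = h.basis he y := by
  have hx := x.2.2
  rw [h.basis_apply, chain, ← Module.End.mul_apply, ← pow_succ']
  by_cases hlt : (x.2 : ℕ) + 1 < D.len x.1
  · exact Or.inr ⟨⟨x.1, ⟨x.2 + 1, hlt⟩⟩, rfl, by rw [h.basis_apply]; rfl⟩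
  · left
    rw [show (x.2 : ℕ) + 1 = D.len x.1 by omega, h.pow_eq_zero]

/-- The kernel of `e` is spanned by the last elements of the strings. -/
theorem IsNormalForm.repr_eq_zero (h : IsNormalForm B e D v) (he : IsSkew B e) {u : V}
    (hu : e u = 0) {x : D.Idx} (hx : x ≠ D.top x.1) : (h.basis he).repr u x = 0 := by
  have hlt := x.2.2
  have hx' : (x.2 : ℕ) + 1 ≠ D.len x.1 := fun h' =>
    hx (StringData.idx_ext rfl (by simp only [StringData.top]; omega))
  have h1 := h.form_basis_opp he u x
  have h2 : ((D.opp x).2 : ℕ) = (D.len x.1 - 2 - x.2) + 1 := by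
    simp only [StringData.opp]
    omega
  rw [h.basis_apply, chain, h2, pow_succ', Module.End.mul_apply] at h1
  have h3 := he u ((e ^ (D.len x.1 - 2 - x.2 : ℕ)) (v (D.opp x).1))
  rw [hu, map_zero, LinearMap.zero_apply] at h3
  rw [neg_eq_zero.1 h3.symm] at h1
  exact (mul_eq_zero.1 h1.symm).resolve_right (intUnit_cast_ne_zero _)

/-- The matrix of the action of `z` on the kernel of `e`. -/
def topMat (b : Module.Basis D.Idx K V) (z : Module.End K V) : Matrix D.Str D.Str K :=
  Matrix.of fun s' s => b.repr (z (b (D.top s))) (D.top s')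

omit [FiniteDimensional K V] in
theorem repr_top (b : Module.Basis D.Idx K V) (s s' : D.Str) :
    b.repr (b (D.top s)) (D.top s') = if s' = s then 1 else 0 := by
  rw [Module.Basis.repr_self]
  split_ifs with h
  · rw [h, Finsupp.single_eq_same]
  · exact Finsupp.single_eq_of_ne fun h' => h (congrArg Sigma.fst h')

omit [FiniteDimensional K V] in
theorem topMat_add (b : Module.Basis D.Idx K V) (z z' : Module.End K V) :
    topMat b (z + z') = topMat b z + topMat b z' := by
  ext
  simp [topMat]

/-- An endomorphism that commutes with the nilpotent `e` is invertible once it is invertible on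
the kernel of `e`. -/
theorem IsNormalForm.isUnit_of_topMat (h : IsNormalForm B e D v) (he : IsSkew B e)
    {z : Module.End K V} (hz : Commute z e) (hdet : (topMat (h.basis he) z).det ≠ 0) :
    IsUnit z := by
  have hze : ∀ u, z (e u) = e (z u) := fun u => LinearMap.congr_fun hz u
  have h1 : ∀ u, e u = 0 → z u = 0 → u = 0 := by
    intro u hu hzu
    have hsum : u = ∑ s, (h.basis he).repr u (D.top s) • h.basis he (D.top s) := by
      refine (h.basis he).ext_elem fun x => ?_
      simp only [map_sum, map_smul, Module.Basis.repr_self, Finsupp.coe_finsetSum,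
        Finset.sum_apply, Finsupp.coe_smul, Pi.smul_apply, smul_eq_mul]
      rw [Finset.sum_eq_single x.1]
      · by_cases hx : x = D.top x.1
        · rw [← hx, Finsupp.single_eq_same, mul_one]
        · rw [Finsupp.single_eq_of_ne hx, mul_zero, h.repr_eq_zero he hu hx]
      · intro s _ hs
        rw [Finsupp.single_eq_of_ne, mul_zero]
        intro h'
        exact hs (congrArg Sigma.fst h').symm
      · simp
    have hvec : (topMat (h.basis he) z).mulVec
        (fun s => (h.basis he).repr u (D.top s)) = 0 := by
      ext s'
      have h3 : (h.basis he).repr (z u) (D.top s') = 0 := by rw [hzu]; simp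
      rw [hsum] at h3
      simp only [map_sum, map_smul, Finsupp.coe_finsetSum, Finset.sum_apply, Finsupp.coe_smul,
        Pi.smul_apply, smul_eq_mul] at h3
      rw [Pi.zero_apply, ← h3]
      exact Finset.sum_congr rfl fun s _ => mul_comm _ _
    have h0 := Matrix.eq_zero_of_mulVec_eq_zero hdet hvec
    rw [hsum]
    exact Finset.sum_eq_zero fun s _ => by rw [congrFun h0 s, Pi.zero_apply, zero_smul]
  have h2 : ∀ (n : ℕ) (u : V), (e ^ n) u = 0 → z u = 0 → u = 0 := by
    intro n
    induction n with
    | zero => intro u hu _; simpa using hu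
    | succ n ih =>
      intro u hu hzu
      rw [pow_succ, Module.End.mul_apply] at hu
      exact h1 u (ih (e u) hu (by rw [hze, hzu, map_zero])) hzu
  rw [LinearMap.isUnit_iff_ker_eq_bot, LinearMap.ker_eq_bot']
  intro u hu
  obtain ⟨n, hn⟩ := h.isNilpotent he
  exact h2 n u (by rw [hn, LinearMap.zero_apply]) hu

/-- The operators that act by the sign `ε i` on the strings of even length and trivially on the
strings of odd length. -/
def signGL (b : Module.Basis D.Idx K V) : (D.I → ℤˣ) →* LinearMap.GeneralLinearGroup K V :=
  (diagGL b).comp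
    { toFun := fun ε x => Sum.elim (fun i => Units.map (Int.castRingHom K).toMonoidHom (ε i))
        (fun _ => 1) x.1
      map_one' := by ext ⟨i | j, a⟩ <;> simp
      map_mul' := fun ε ε' => by ext ⟨i | j, a⟩ <;> simp }

omit [FiniteDimensional K V] in
theorem signGL_basis (b : Module.Basis D.Idx K V) (ε : D.I → ℤˣ) (x : D.Idx) :
    (signGL b ε).val (b x) =
      Sum.elim (fun i => ((ε i : ℤ) : K)) (fun _ => (1 : K)) x.1 • b x := by
  rw [signGL, MonoidHom.comp_apply, diagGL_basis]
  obtain ⟨i | j, a⟩ := x <;> rfl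

theorem signGL_mem_Sp (h : IsNormalForm B e D v) (he : IsSkew B e) (ε : D.I → ℤˣ) :
    signGL (h.basis he) ε ∈ Sp B := by
  refine h.diagGL_mem_Sp he fun x => ?_
  obtain ⟨i | j, a⟩ := x
  · change Units.map _ (ε i) * Units.map _ (ε i) = 1
    rw [← map_mul, Int.units_mul_self, map_one]
  · exact one_mul 1

theorem commute_signGL (h : IsNormalForm B e D v) (he : IsSkew B e) (ε : D.I → ℤˣ) :
    Commute (signGL (h.basis he) ε).val e := by
  refine (h.basis he).ext fun x => ?_
  rw [Module.End.mul_apply, Module.End.mul_apply, signGL_basis, map_smul]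
  rcases h.apply_basis he x with h0 | ⟨y, hy, h0⟩
  · rw [h0, map_zero, smul_zero]
  · rw [h0, signGL_basis, hy]

/-- String heads obtained by a change of sign for each string of even length and a change of basis
for each pair of strings of odd length. -/
def twistHeads (v : D.Str → V) (ε : D.I → ℤˣ) (M : D.J → Matrix Bool Bool K) : D.Str → V :=
  Sum.elim (fun i => ((ε i : ℤ) : K) • v (Sum.inl i)) fun j =>
    M j.1 false j.2 • v (Sum.inr (j.1, false)) + M j.1 true j.2 • v (Sum.inr (j.1, true))

omit [FiniteDimensional K V] in
theorem IsNormalForm.twistHeads (h : IsNormalForm B e D v) (ε : D.I → ℤˣ)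
    {M : D.J → Matrix Bool Bool K} (hM : ∀ j, (M j).det = 1) :
    IsNormalForm B e D (twistHeads v ε M) := by
  refine ⟨⟨fun s => ?_, fun s s' n => ?_⟩, h.finrank_eq⟩
  · rcases s with i | ⟨j, x⟩
    · simp only [SymplecticAdmissible.twistHeads, Sum.elim_inl, map_smul, h.pow_eq_zero, smul_zero]
    · have h1 : ∀ y, (e ^ D.len (Sum.inr (j, x))) (v (Sum.inr (j, y))) = 0 := fun y =>
        h.pow_eq_zero (Sum.inr (j, y))
      simp only [SymplecticAdmissible.twistHeads, Sum.elim_inr, map_add, map_smul, h1, smul_zero,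
        add_zero]
  · have hdet := fun j => (det_bool (M j)).symm.trans (hM j)
    rcases s with i | ⟨j, x⟩ <;> rcases s' with i' | ⟨j', x'⟩
    · simp only [SymplecticAdmissible.twistHeads, Sum.elim_inl, map_smul, LinearMap.smul_apply,
        h.form, smul_eq_mul, StringData.swap, Sum.map_inl, id_eq, Sum.inl.injEq]
      by_cases hi : i' = i
      · subst hi
        rw [← mul_assoc, intUnit_cast_mul_self, one_mul]
      · simp [hi]
    · simp [SymplecticAdmissible.twistHeads, h.form, StringData.swap]
    · simp [SymplecticAdmissible.twistHeads, h.form, StringData.swap]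
    · by_cases hj : j' = j
      · subst hj
        have := hdet j'
        by_cases hn : n = 2 * D.q j'
        · cases x <;> cases x' <;>
            simp [SymplecticAdmissible.twistHeads, h.form, StringData.swap, StringData.sgn,
              StringData.len, hn] <;>
          first | ring1 | linear_combination this | linear_combination -this
        · simp [SymplecticAdmissible.twistHeads, h.form, StringData.swap, StringData.len, hn]
      · simp [SymplecticAdmissible.twistHeads, h.form, StringData.swap, hj]

omit [FiniteDimensional K V] in
theorem topMat_signGL (b : Module.Basis D.Idx K V) (ε : D.I → ℤˣ) :
    topMat b (signGL b ε).val = blockMat (fun i => ((ε i : ℤ) : K)) 1 := by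
  ext s' s
  rw [topMat, Matrix.of_apply, signGL_basis, map_smul, Finsupp.smul_apply, smul_eq_mul, repr_top]
  rcases s with i | ⟨j, x⟩ <;> rcases s' with i' | ⟨j', x'⟩
  · by_cases hi : i' = i <;> simp [blockMat, StringData.top, hi]
  · simp [blockMat]
  · simp [blockMat]
  · by_cases hj : j' = j <;> simp [blockMat, StringData.top, hj, Matrix.one_apply]

/-- The centraliser of `e` contains elements that act on the kernel of `e` by a given sign for each
string of even length and a given element of `SL₂` for each pair of strings of odd length. -/
theorem IsNormalForm.exists_mem_Sp_topMat (h : IsNormalForm B e D v) (he : IsSkew B e)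
    (ε : D.I → ℤˣ) {M : D.J → Matrix Bool Bool K} (hM : ∀ j, (M j).det = 1) :
    ∃ g ∈ Sp B, Commute g.val e ∧
      topMat (h.basis he) g.val = blockMat (fun i => ((ε i : ℤ) : K)) M := by
  obtain ⟨f, hf, hfe, hfc⟩ := h.exists_isometry he (h.twistHeads ε hM) he
  refine ⟨toGL f, hf, LinearMap.ext hfe, ?_⟩
  ext s' s
  rw [topMat, Matrix.of_apply, toGL_val, h.basis_apply, hfc]
  rcases s with i | ⟨j, x⟩
  · have : chain e (SymplecticAdmissible.twistHeads v ε M) (D.top (Sum.inl i)) =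
        ((ε i : ℤ) : K) • h.basis he (D.top (Sum.inl i)) := by
      rw [h.basis_apply]
      exact map_smul _ _ _
    rw [this, map_smul, Finsupp.smul_apply, smul_eq_mul, repr_top]
    rcases s' with i' | ⟨j', x'⟩
    · by_cases hi : i' = i <;> simp [blockMat, hi]
    · simp [blockMat]
  · have : chain e (SymplecticAdmissible.twistHeads v ε M) (D.top (Sum.inr (j, x))) =
        M j false x • h.basis he (D.top (Sum.inr (j, false))) +
          M j true x • h.basis he (D.top (Sum.inr (j, true))) := by
      rw [h.basis_apply, h.basis_apply]
      refine (map_add (e ^ _) _ _).trans ?_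
      rw [map_smul, map_smul]
      rfl
    rw [this, map_add, map_smul, map_smul, Finsupp.add_apply, Finsupp.smul_apply,
      Finsupp.smul_apply, smul_eq_mul, smul_eq_mul, repr_top, repr_top]
    rcases s' with i' | ⟨j', x'⟩
    · simp [blockMat]
    · by_cases hj : j' = j
      · subst hj
        cases x' <;> simp [blockMat]
      · simp [blockMat, Matrix.blockDiagonal_apply_ne _ _ _ hj, hj]

theorem inv_mul_mem_identityComponent [Infinite K] (hBn : B.Nondegenerate)
    {S : Set (LinearMap.GeneralLinearGroup K V)} {g g' : LinearMap.GeneralLinearGroup K V}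
    (hg : g ∈ centralizerIn (Sp B) S) (hg' : g' ∈ centralizerIn (Sp B) S)
    (hunit : IsUnit (g.val + g'.val)) :
    g⁻¹ * g' ∈ identityComponent (centralizerIn (Sp B) S) := by
  refine mem_identityComponent_of_isUnit hBn (Subgroup.mul_mem _ (Subgroup.inv_mem _ hg) hg') ?_
  have : 1 + (g⁻¹ * g').val = g⁻¹.val * (g.val + g'.val) := by
    rw [mul_add, Units.inv_mul, Units.val_mul]
  rw [this]
  exact (Units.isUnit _).mul hunit

/-- The sign operators meet all components of the centraliser of `e`: an arbitrary element `x` is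
compared with an element `g` that acts on the kernel of `e` through blocks with
`det (g + x) ≠ 0`, and `g` with a sign operator. -/
theorem IsNormalForm.exists_signGL_inv_mul_mem [Infinite K] (h2 : (2 : K) ≠ 0)
    (hBn : B.Nondegenerate) (h : IsNormalForm B e D v) (he : IsSkew B e)
    {S : Set (LinearMap.GeneralLinearGroup K V)}
    (hS : ∀ g ∈ Sp B, g ∈ centralizerIn (Sp B) S ↔ Commute g.val e)
    {x : LinearMap.GeneralLinearGroup K V} (hx : x ∈ centralizerIn (Sp B) S) :
    ∃ ε, (signGL (h.basis he) ε)⁻¹ * x ∈ identityComponent (centralizerIn (Sp B) S) := by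
  obtain ⟨ε, M, hM, hM', hdet⟩ :=
    exists_det_blockMat_add_ne_zero h2 (topMat (h.basis he) x.val)
  obtain ⟨g, hg, hge, hgm⟩ := h.exists_mem_Sp_topMat he ε hM
  have hxe := (hS x hx.1).1 hx
  have hae := commute_signGL h he ε
  have haS := signGL_mem_Sp h he ε
  have hgS := (hS g hg).2 hge
  refine ⟨ε, ?_⟩
  have h1 := inv_mul_mem_identityComponent hBn hgS hx
    (h.isUnit_of_topMat he (hge.add_left hxe) (by rwa [topMat_add, hgm]))
  have h3 := inv_mul_mem_identityComponent hBn ((hS _ haS).2 hae) hgS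
    (h.isUnit_of_topMat he (hae.add_left hge) (by
      rw [topMat_add, hgm, topMat_signGL, blockMat_add, det_blockMat]
      refine mul_ne_zero (Finset.prod_ne_zero_iff.2 fun i _ => ?_)
        (Finset.prod_ne_zero_iff.2 fun j _ => hM' j)
      rw [Pi.add_apply, ← two_mul]
      exact mul_ne_zero h2 (intUnit_cast_ne_zero _)))
  have h4 := Subgroup.mul_mem _ h3 h1
  rwa [mul_assoc, mul_inv_cancel_left] at h4

end Centralizer

/-! ### The group of sign operators -/

section Signs

variable {K : Type*} [Field K] {V : Type*} [AddCommGroup V] [Module K V]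
  {B : LinearMap.BilinForm K V} {D : StringData}

theorem diagGL_commute {ι : Type*} (b : Module.Basis ι K V) (d d' : ι → Kˣ) :
    diagGL b d * diagGL b d' = diagGL b d' * diagGL b d := by
  rw [← map_mul, ← map_mul, mul_comm]

theorem diagGL_mem_leviOf [Infinite K] {ι : Type*} [Fintype ι] {b : Module.Basis ι K V}
    {w : ι → ℤ} {d : ι → Kˣ} (hd : diagGL b d ∈ Sp B) : diagGL b d ∈ leviOf B (wtCochar b w) := by
  refine mem_leviOf_iff.2 ⟨hd, fun x => ?_⟩
  rw [diagGL_basis, add_zero]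
  exact Submodule.smul_mem _ _ (basis_mem_wtSpace x)

theorem signGL_mul_self (b : Module.Basis D.Idx K V) (ε : D.I → ℤˣ) :
    signGL b ε * signGL b ε = 1 := by
  rw [← map_mul, show ε * ε = 1 from funext fun i => Int.units_mul_self _, map_one]

theorem isSemisimple_signGL (h2 : (2 : K) ≠ 0) (b : Module.Basis D.Idx K V) (ε : D.I → ℤˣ) :
    Module.End.IsSemisimple (signGL b ε).val := by
  have hsep : (Polynomial.X ^ 2 - Polynomial.C (1 : K)).Separable :=
    Polynomial.separable_X_pow_sub_C 1 (by exact_mod_cast h2) one_ne_zero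
  refine Module.End.isSemisimple_of_squarefree_aeval_eq_zero hsep.squarefree ?_
  have := congrArg Units.val (signGL_mul_self b ε)
  rw [Units.val_mul, Units.val_one] at this
  simp [pow_two, this]

theorem isPGroup_range_signGL (b : Module.Basis D.Idx K V) : IsPGroup 2 (signGL b).range := by
  rintro ⟨_, ε, rfl⟩
  refine ⟨1, Subtype.ext ?_⟩
  simp only [pow_one, pow_two, Subgroup.coe_mul, Subgroup.coe_one]
  exact signGL_mul_self b ε

theorem commute_of_mem_range_signGL {b : Module.Basis D.Idx K V}
    {a a' : LinearMap.GeneralLinearGroup K V} (ha : a ∈ (signGL b).range)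
    (ha' : a' ∈ (signGL b).range) : a * a' = a' * a := by
  obtain ⟨ε, rfl⟩ := ha
  obtain ⟨ε', rfl⟩ := ha'
  exact diagGL_commute _ _ _

variable [FiniteDimensional K V] {e : Module.End K V} {v : D.Str → V}

/-- The sign operator `ε` lies on the one-parameter group that acts by `t` on the lower half and by
`t⁻¹` on the upper half of each string of even length with sign `-1`; this group centralises all
sign operators. -/
theorem IsNormalForm.signGL_mem_identityComponent [Infinite K] (h : IsNormalForm B e D v)
    (he : IsSkew B e) (ε : D.I → ℤˣ) :
    signGL (h.basis he) ε ∈ identityComponent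
      (centralizerIn (leviOf B (wtCochar (h.basis he) D.wt))
        (centralizerIn (signGL (h.basis he)).range {signGL (h.basis he) ε} : Set _)) := by
  let n : D.Idx → ℤ := fun x => Sum.elim
    (fun i => if ε i = 1 then 0 else if 2 * (x.2 : ℕ) + 1 < D.len x.1 then 1 else -1)
    (fun _ => 0) x.1
  have hn : ∀ x, n x + n (D.opp x) = 0 := by
    rintro ⟨i | j, a⟩
    · have ha := a.2
      by_cases hi : ε i = 1
      · simp [n, hi, StringData.opp, StringData.swap]
      · have h1 : D.len (Sum.inl i) = 2 * D.p i + 2 := rfl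
        simp only [n, StringData.opp, StringData.swap, Sum.map_inl, id_eq, Sum.elim_inl, if_neg hi]
        split_ifs <;> omega
    · simp [n, StringData.opp, StringData.swap]
  have hone : diagGL (h.basis he) (fun x => (-1 : Kˣ) ^ n x) = signGL (h.basis he) ε := by
    change _ = diagGL _ _
    congr 1
    ext ⟨i | j, a⟩
    · rcases Int.units_eq_one_or (ε i) with hi | hi
      · simp [n, hi]
      · by_cases hlt : 2 * (a : ℕ) + 1 < D.len (Sum.inl i) <;> simp [n, hi, hlt]
    · simp [n]
  rw [← hone]
  refine diagGL_mem_identityComponent _ n (fun t => ?_) (-1)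
  refine ⟨diagGL_mem_leviOf
    (h.diagGL_mem_Sp he fun x => by rw [← zpow_add, hn, zpow_zero]), ?_⟩
  change _ ∈ Subgroup.centralizer _
  rw [Subgroup.mem_centralizer_iff]
  rintro _ ⟨⟨ε', rfl⟩, _⟩
  exact diagGL_commute _ _ _

end Signs

/-! ### Rationality -/

section Rational

variable {k K V₀ : Type*} [Field k] [Fintype k] [Field K] [Algebra k K]
  [Algebra.IsAlgebraic k K] [AddCommGroup V₀] [Module k V₀]

/-- Operators that are diagonal in a rational basis are raised to the `q`-th power by the
Frobenius endomorphism. -/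
theorem frobGL_diagGL {ι : Type*} [Fintype ι] {b : Module.Basis ι K (K ⊗[k] V₀)}
    (hb : ∀ x, frobV k K V₀ (b x) = b x) (d : ι → Kˣ) :
    frobGL k K V₀ (diagGL b d) = diagGL b (d ^ Fintype.card k) := by
  rw [eq_frobGL_iff]
  intro u
  rw [← b.sum_repr u]
  simp only [map_sum, map_smul, frobV_smul, hb, diagGL_basis, Pi.pow_apply,
    Units.val_pow_eq_pow_val]

theorem frobGL_signGL {D : StringData} {b : Module.Basis D.Idx K (K ⊗[k] V₀)}
    (hb : ∀ x, frobV k K V₀ (b x) = b x) (ε : D.I → ℤˣ) :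
    frobGL k K V₀ (signGL b ε) = signGL b ε := by
  refine (frobGL_diagGL hb _).trans ?_
  change diagGL _ _ = diagGL _ _
  congr 1
  ext ⟨i | j, a⟩
  · exact map_intCast (FiniteField.frobeniusAlgEquivOfAlgebraic k K) (ε i : ℤ)
  · exact one_pow _

theorem isRationalCocharacter_wtCochar {ι : Type*} [Fintype ι]
    {b : Module.Basis ι K (K ⊗[k] V₀)} (hb : ∀ x, frobV k K V₀ (b x) = b x) (w : ι → ℤ) :
    IsRationalCocharacter (wtCochar b w) := by
  intro t
  refine (frobGL_diagGL hb _).trans ?_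
  change diagGL _ _ = diagGL _ _
  congr 1
  funext x
  change (t ^ w x) ^ Fintype.card k = (t ^ Fintype.card k) ^ w x
  rw [← zpow_natCast, ← zpow_natCast, zpow_comm]

end Rational

/-! ### Weighted Dynkin diagrams -/

/-- The basis indices can be enumerated so that the dual indices come in the second half and the
weights in the first half are non-negative and decreasing. -/
theorem StringData.exists_enumeration (D : StringData) :
    ∃ (n : ℕ) (E : Fin n ⊕ Fin n ≃ D.Idx), (∀ i, E (Sum.inr i) = D.opp (E (Sum.inl i))) ∧
      (∀ i, 0 ≤ D.wt (E (Sum.inl i))) ∧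
      ∀ i j, i ≤ j → D.wt (E (Sum.inl j)) ≤ D.wt (E (Sum.inl i)) := by
  classical
  let P : D.Idx → Prop := fun x => 0 < D.wt x ∨ D.wt x = 0 ∧ D.eta x = 1
  have hP : ∀ x, P x ↔ ¬ P (D.opp x) := by
    intro x
    have h1 : (-D.eta x = 1) ↔ ¬ D.eta x = 1 := by
      rcases Int.units_eq_one_or (D.eta x) with h | h <;> rw [h] <;> decide
    simp only [P, D.wt_opp, D.eta_opp, h1]
    by_cases h3 : D.eta x = 1 <;> simp only [h3, and_true, not_true_eq_false, and_false,
      or_false, not_false_eq_true] <;> omega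
  let g := (Fintype.equivFin {x // P x}).symm
  let σ := Tuple.sort fun i => -D.wt (g i).1
  let oppE : D.Idx ≃ D.Idx := ⟨D.opp, D.opp, D.opp_opp, D.opp_opp⟩
  let E := (Equiv.sumCongr (σ.trans g)
    ((σ.trans g).trans (oppE.subtypeEquiv hP))).trans (Equiv.sumCompl P)
  have hE : ∀ i, E (Sum.inl i) = (g (σ i)).1 := fun i => rfl
  refine ⟨_, E, fun i => rfl, fun i => ?_, fun i j hij => ?_⟩
  · rw [hE]
    rcases (g (σ i)).2 with h | h
    · exact h.le
    · exact h.1.ge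
  · rw [hE, hE]
    exact neg_le_neg_iff.1 (Tuple.monotone_sort (fun i => -D.wt (g i).1) hij)

section Symplectic

variable {K : Type*} [Field K] {V : Type*} [AddCommGroup V] [Module K V] [FiniteDimensional K V]
  {B : LinearMap.BilinForm K V} {e : Module.End K V} {D : StringData} {v : D.Str → V}

/-- The symplectic basis that arises from a normal form and an enumeration of its basis. -/
def IsNormalForm.sympBasis (h : IsNormalForm B e D v) (he : IsSkew B e) {n : ℕ}
    (E : Fin n ⊕ Fin n ≃ D.Idx) : Module.Basis (Fin n ⊕ Fin n) K V :=
  ((h.basis he).reindex E.symm).unitsSMul (Sum.elim (fun _ => 1) fun i =>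
    Units.map (Int.castRingHom K).toMonoidHom (D.eta (E (Sum.inl i))))

theorem IsNormalForm.sympBasis_inl (h : IsNormalForm B e D v) (he : IsSkew B e) {n : ℕ}
    (E : Fin n ⊕ Fin n ≃ D.Idx) (i : Fin n) :
    h.sympBasis he E (Sum.inl i) = h.basis he (E (Sum.inl i)) := by
  rw [sympBasis, Module.Basis.unitsSMul_apply, Module.Basis.reindex_apply]
  exact one_smul _ _

theorem IsNormalForm.sympBasis_inr (h : IsNormalForm B e D v) (he : IsSkew B e) {n : ℕ}
    (E : Fin n ⊕ Fin n ≃ D.Idx) (i : Fin n) :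
    h.sympBasis he E (Sum.inr i) =
      ((D.eta (E (Sum.inl i)) : ℤ) : K) • h.basis he (E (Sum.inr i)) := by
  rw [sympBasis, Module.Basis.unitsSMul_apply, Module.Basis.reindex_apply]
  rfl

theorem IsNormalForm.isSymplecticBasis (h : IsNormalForm B e D v) (he : IsSkew B e) {n : ℕ}
    {E : Fin n ⊕ Fin n ≃ D.Idx} (hE : ∀ i, E (Sum.inr i) = D.opp (E (Sum.inl i))) :
    IsSymplecticBasis B (h.sympBasis he E) := by
  intro i j
  have h1 : ∀ i j, ¬ E (Sum.inl j) = E (Sum.inr i) := fun i j h' =>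
    Sum.inl_ne_inr (E.injective h')
  refine ⟨?_, ?_, ?_⟩
  · rw [h.sympBasis_inl, h.sympBasis_inl, h.form_basis, if_neg]
    rw [← hE]
    exact h1 i j
  · rw [h.sympBasis_inr, h.sympBasis_inr, map_smul, map_smul, LinearMap.smul_apply, h.form_basis,
      if_neg, smul_zero, smul_zero]
    rw [hE i, D.opp_opp]
    exact fun h' => h1 j i h'.symm
  · rw [h.sympBasis_inl, h.sympBasis_inr, map_smul, h.form_basis, ← hE]
    by_cases hij : i = j
    · subst hij
      rw [if_pos rfl, if_pos rfl, smul_eq_mul, intUnit_cast_mul_self]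
    · rw [if_neg, if_neg hij, smul_zero]
      exact fun h' => hij (Sum.inr_injective (E.injective h')).symm

omit [FiniteDimensional K V] in
/-- The matrix, in a symplectic basis, of a skew-adjoint endomorphism. -/
theorem IsSymplecticBasis.toMatrix_mem_sp {n : ℕ} {b : Module.Basis (Fin n ⊕ Fin n) K V}
    (hb : IsSymplecticBasis B b) (hB : B.IsAlt) {z : Module.End K V} (hz : IsSkew B z) :
    LinearMap.toMatrix b b z ∈ LieAlgebra.Symplectic.sp (Fin n) K := by
  have hG : LinearMap.BilinForm.toMatrix b B = -Matrix.J (Fin n) K := by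
    ext (i | i) (j | j)
    · simp [LinearMap.BilinForm.toMatrix_apply, Matrix.J, (hb i j).1]
    · simp [LinearMap.BilinForm.toMatrix_apply, Matrix.J, (hb i j).2.2, Matrix.one_apply]
    · rw [LinearMap.BilinForm.toMatrix_apply, ← LinearMap.IsAlt.neg hB, (hb j i).2.2]
      simp [Matrix.J, Matrix.one_apply, eq_comm]
    · simp [LinearMap.BilinForm.toMatrix_apply, Matrix.J, (hb i j).2.1]
  have hcomp : B.compLeft z = B.compRight (-z) := LinearMap.ext₂ fun v w =>
    (hz v w).trans (map_neg (B v) _).symm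
  have h1 := congrArg (LinearMap.BilinForm.toMatrix b) hcomp
  rw [LinearMap.BilinForm.toMatrix_compLeft, LinearMap.BilinForm.toMatrix_compRight, hG,
    Matrix.mul_neg, Matrix.neg_mul, neg_inj, map_neg] at h1
  rw [LieAlgebra.Symplectic.sp, mem_skewAdjointMatricesLieSubalgebra,
    mem_skewAdjointMatricesSubmodule, Matrix.IsSkewAdjoint, Matrix.IsAdjointPair]
  exact h1

/-- The endomorphism that acts on the weight spaces by their weights. -/
def wtEnd {ι : Type*} (b : Module.Basis ι K V) (w : ι → ℤ) : Module.End K V :=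
  b.constr K fun x => (w x : K) • b x

omit [FiniteDimensional K V] in
theorem wtEnd_basis {ι : Type*} (b : Module.Basis ι K V) (w : ι → ℤ) (x : ι) :
    wtEnd b w (b x) = (w x : K) • b x := b.constr_basis _ _ _

omit [FiniteDimensional K V] in
theorem HasDeg.lie_wtEnd {ι : Type*} [Fintype ι] {b : Module.Basis ι K V} {w : ι → ℤ}
    {z : Module.End K V} {j : ℤ} (hz : HasDeg b w z j) :
    wtEnd b w * z - z * wtEnd b w = (j : K) • z := by
  refine b.ext fun x => ?_
  have h1 : wtSpace b w (w x + j) ≤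
      LinearMap.eqLocus (wtEnd b w) (((w x + j : ℤ) : K) • LinearMap.id) :=
    wtSpace_le fun y hy => by
      rw [LinearMap.mem_eqLocus, wtEnd_basis, hy]
      rfl
  have h3 := h1 (hz x)
  rw [LinearMap.mem_eqLocus, LinearMap.smul_apply, LinearMap.id_apply] at h3
  rw [LinearMap.sub_apply, Module.End.mul_apply, Module.End.mul_apply, h3, wtEnd_basis, map_smul,
    ← sub_smul, LinearMap.smul_apply]
  congr 1
  push_cast
  ring

omit [FiniteDimensional K V] in
theorem IsSkew.of_basis {ι : Type*} (b : Module.Basis ι K V) {z : Module.End K V}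
    (hz : ∀ x y, B (z (b x)) (b y) = -B (b x) (z (b y))) : IsSkew B z := by
  have : B.comp z LinearMap.id = -B.comp LinearMap.id z := b.ext fun x => b.ext fun y => hz x y
  intro v w
  exact congrArg (fun C : LinearMap.BilinForm K V => C v w) this

/-- The lowering operator that completes a normal form to an `𝔰𝔩₂`-triple. -/
theorem IsNormalForm.exists_lower (h : IsNormalForm B e D v) (he : IsSkew B e) :
    ∃ f : Module.End K V, IsSkew B f ∧ HasDeg (h.basis he) D.wt f (-2) ∧
      e * f - f * e = wtEnd (h.basis he) D.wt := by
  let b := h.basis he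
  let f : Module.End K V := b.constr K fun x =>
    (((x.2 : ℕ) : K) * (((D.len x.1 : ℕ) : K) - ((x.2 : ℕ) : K))) •
      b ⟨x.1, ⟨x.2 - 1, (Nat.sub_le _ _).trans_lt x.2.2⟩⟩
  have hf0 : ∀ s (ha : 0 < D.len s), f (b ⟨s, ⟨0, ha⟩⟩) = 0 := fun s ha => by
    rw [b.constr_basis]
    simp
  have hf1 : ∀ s a (ha : a + 1 < D.len s), f (b ⟨s, ⟨a + 1, ha⟩⟩) =
      (((a + 1 : ℕ) : K) * (((D.len s : ℕ) : K) - ((a + 1 : ℕ) : K))) •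
        b ⟨s, ⟨a, Nat.lt_of_succ_lt ha⟩⟩ := fun s a ha => b.constr_basis _ _ _
  have he1 : ∀ s a (ha : a + 1 < D.len s),
      e (b ⟨s, ⟨a, Nat.lt_of_succ_lt ha⟩⟩) = b ⟨s, ⟨a + 1, ha⟩⟩ := fun s a ha => by
    rw [h.basis_apply, h.basis_apply, chain, ← Module.End.mul_apply, ← pow_succ']
    rfl
  have he0 : ∀ s a (ha : a < D.len s), a + 1 = D.len s → e (b ⟨s, ⟨a, ha⟩⟩) = 0 := by
    intro s a ha ha'
    have h1 := h.pow_eq_zero s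
    rw [← ha', pow_succ', Module.End.mul_apply] at h1
    rw [h.basis_apply]
    exact h1
  refine ⟨f, IsSkew.of_basis b ?_, ?_, b.ext ?_⟩
  · rintro ⟨s, ⟨a, ha⟩⟩ ⟨s', ⟨c, hc⟩⟩
    rcases a with _ | a <;> rcases c with _ | c
    · rw [hf0, hf0, map_zero, map_zero, LinearMap.zero_apply, neg_zero]
    · rw [hf0, hf1, map_smul, h.form_basis, if_neg, map_zero, LinearMap.zero_apply, smul_zero,
        neg_zero]
      rw [StringData.eq_opp_iff]
      rintro ⟨rfl, h'⟩
      simp only [D.len_swap] at hc h'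
      omega
    · rw [hf0, hf1, map_smul, LinearMap.smul_apply, h.form_basis, if_neg, map_zero, smul_zero,
        neg_zero]
      rw [StringData.eq_opp_iff]
      rintro ⟨rfl, h'⟩
      simp only at h'
      omega
    · rw [hf1, hf1, map_smul, map_smul, LinearMap.smul_apply, h.form_basis, h.form_basis]
      simp only [StringData.eq_opp_iff, StringData.eta]
      by_cases hs : s' = D.swap s ∧ a + (c + 1) + 1 = D.len s
      · obtain ⟨rfl, hl⟩ := hs
        rw [if_pos ⟨rfl, hl⟩, if_pos ⟨rfl, by omega⟩, D.len_swap, ← hl]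
        push_cast
        simp only [smul_eq_mul]
        ring
      · rw [if_neg hs, if_neg (fun h' => hs ⟨h'.1, by omega⟩), smul_zero, smul_zero, neg_zero]
  · rintro ⟨s, ⟨a, ha⟩⟩
    rcases a with _ | a
    · rw [hf0]
      exact Submodule.zero_mem _
    · rw [hf1]
      refine Submodule.smul_mem _ _ ?_
      have h1 := basis_mem_wtSpace (b := b) (w := D.wt) ⟨s, ⟨a, Nat.lt_of_succ_lt ha⟩⟩
      rwa [show D.wt ⟨s, ⟨a, Nat.lt_of_succ_lt ha⟩⟩ = D.wt ⟨s, ⟨a + 1, ha⟩⟩ + -2 by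
        simp only [StringData.wt]; push_cast; ring] at h1
  · rintro ⟨s, ⟨a, ha⟩⟩
    have h1 : e (f (b ⟨s, ⟨a, ha⟩⟩)) = ((a : K) * ((D.len s : ℕ) - (a : K))) • b ⟨s, ⟨a, ha⟩⟩ := by
      rcases a with _ | a
      · rw [hf0, map_zero, Nat.cast_zero, zero_mul, zero_smul]
      · rw [hf1, map_smul, he1]
    have h3 : f (e (b ⟨s, ⟨a, ha⟩⟩)) =
        (((a + 1 : ℕ) : K) * ((D.len s : ℕ) - ((a + 1 : ℕ) : K))) • b ⟨s, ⟨a, ha⟩⟩ := by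
      by_cases hlt : a + 1 < D.len s
      · rw [he1 s a hlt, hf1]
      · have hl : a + 1 = D.len s := by omega
        rw [he0 s a ha hl, map_zero, hl, sub_self, mul_zero, zero_smul]
    rw [LinearMap.sub_apply, Module.End.mul_apply, Module.End.mul_apply, h1, h3, wtEnd_basis,
      ← sub_smul]
    congr 1
    simp only [StringData.wt]
    push_cast
    ring

theorem IsNormalForm.isSkew_wtEnd (h : IsNormalForm B e D v) (he : IsSkew B e) :
    IsSkew B (wtEnd (h.basis he) D.wt) := by
  refine IsSkew.of_basis (h.basis he) fun x y => ?_
  rw [wtEnd_basis, wtEnd_basis, map_smul, map_smul, LinearMap.smul_apply, h.form_basis]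
  split_ifs with hxy
  · rw [hxy, D.wt_opp]
    push_cast
    simp
  · simp

end Symplectic

/-- The weights of a normal form, enumerated decreasingly, define a weighted Dynkin diagram: the
standard model over `ℂ` of the normal form completes to an `𝔰𝔩₂`-triple. -/
theorem StringData.isWeightedDynkinDiagram (D : StringData) {n : ℕ}
    {E : Fin n ⊕ Fin n ≃ D.Idx} (hE : ∀ i, E (Sum.inr i) = D.opp (E (Sum.inl i)))
    (hnn : ∀ i, 0 ≤ D.wt (E (Sum.inl i)))
    (hanti : ∀ i j, i ≤ j → D.wt (E (Sum.inl j)) ≤ D.wt (E (Sum.inl i))) :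
    IsWeightedDynkinDiagram n fun α => ∑ i, α.1 i * D.wt (E (Sum.inl i)) := by
  by_cases h0 : ∀ i, D.wt (E (Sum.inl i)) = 0
  · left
    funext α
    simp [h0]
  right
  have hs := isSkew_model ℂ D
  have h := isNormalForm_model ℂ D
  have hB := h.isAlt hs two_ne_zero
  obtain ⟨f, hf, hfdeg, hef⟩ := h.exists_lower hs
  let b := h.sympBasis hs E
  have hb : IsSymplecticBasis _ b := h.isSymplecticBasis hs hE
  let W := wtEnd (h.basis hs) D.wt
  let T := LinearMap.toMatrix b b
  have hmul : ∀ z z', T z * T z' - T z' * T z = T (z * z' - z' * z) := fun z z' => by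
    rw [map_sub, LinearMap.toMatrix_mul, LinearMap.toMatrix_mul]
  have hdiag : T W = Matrix.diagonal (Sum.elim (fun i => ((D.wt (E (Sum.inl i)) : ℤ) : ℂ))
      fun i => -((D.wt (E (Sum.inl i)) : ℤ) : ℂ)) := by
    have hW : ∀ x, W (b x) = (Sum.elim (fun i => ((D.wt (E (Sum.inl i)) : ℤ) : ℂ))
        (fun i => -((D.wt (E (Sum.inl i)) : ℤ) : ℂ)) x) • b x := by
      rintro (i | i)
      · rw [h.sympBasis_inl, wtEnd_basis]
        rfl
      · rw [h.sympBasis_inr, map_smul, wtEnd_basis, smul_comm, hE, D.wt_opp]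
        push_cast
        rfl
    ext x y
    rw [LinearMap.toMatrix_apply, hW, map_smul, Finsupp.smul_apply, Module.Basis.repr_self,
      Matrix.diagonal_apply, Finsupp.single_apply]
    by_cases hxy : x = y
    · simp [hxy]
    · simp [hxy, Ne.symm hxy]
  refine ⟨⟨T W, hb.toMatrix_mem_sp hB (h.isSkew_wtEnd hs)⟩, ⟨T _, hb.toMatrix_mem_sp hB hs⟩,
    ⟨T f, hb.toMatrix_mem_sp hB hf⟩, fun i => ((D.wt (E (Sum.inl i)) : ℤ) : ℂ),
    ⟨?_, ?_, ?_, ?_⟩, hdiag, fun α => by push_cast; rfl, ?_⟩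
  · intro hzero
    apply h0
    intro i
    have h1 := hdiag.symm.trans (congrArg Subtype.val hzero)
    have := congrFun (congrFun h1 (Sum.inl i)) (Sum.inl i)
    simpa using this
  · refine Subtype.ext ?_
    change T _ * T _ - T _ * T _ = T _
    rw [hmul, hef]
  · refine Subtype.ext ?_
    change T _ * T _ - T _ * T _ = 2 • T _
    rw [hmul, (h.hasDeg hs).lie_wtEnd, map_smul]
    simp [two_smul]
  · refine Subtype.ext ?_
    change T _ * T _ - T _ * T _ = -(2 • T _)
    rw [hmul, hfdeg.lie_wtEnd, map_smul]
    simp [two_smul]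
  · rintro ⟨α, hα⟩ (⟨i, j, hij, rfl⟩ | ⟨i, _, rfl⟩)
    · have := hanti i j (by rw [Fin.le_def]; omega)
      simp only [Pi.sub_apply, sub_mul, Finset.sum_sub_distrib, Pi.single_apply, ite_mul, one_mul,
        zero_mul, Finset.sum_ite_eq', Finset.mem_univ, if_true]
      omega
    · have := hnn i
      simp only [Pi.single_apply, ite_mul, zero_mul, Finset.sum_ite_eq', Finset.mem_univ, if_true]
      omega

/-- The cocharacter defined by the weights of a normal form is a Dynkin cocharacter. -/
theorem IsNormalForm.isDynkinCocharacter {K : Type*} [Field K] {V : Type*} [AddCommGroup V]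
    [Module K V] [FiniteDimensional K V] {B : LinearMap.BilinForm K V} {e : Module.End K V}
    {D : StringData} {v : D.Str → V} (h : IsNormalForm B e D v) (he : IsSkew B e) :
    IsDynkinCocharacter B (wtCochar (h.basis he) D.wt) := by
  obtain ⟨n, E, hE, hnn, hanti⟩ := D.exists_enumeration
  refine ⟨isCocharacter_wtCochar (h.wtCochar_mem_Sp he), n, h.sympBasis he E, _, _,
    h.isSymplecticBasis he hE, D.isWeightedDynkinDiagram hE hnn hanti, fun α => rfl,
    fun t i => ⟨?_, ?_⟩⟩
  · rw [h.sympBasis_inl, wtCochar_basis]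
  · rw [h.sympBasis_inr, map_smul, wtCochar_basis, smul_comm, hE, D.wt_opp]

/-! ### Admissible coverings -/

section Springer

theorem unipotentVariety_conj {K : Type*} [Field K] {V : Type*} [AddCommGroup V] [Module K V]
    {B : LinearMap.BilinForm K V} {u g : LinearMap.GeneralLinearGroup K V}
    (hu : u ∈ unipotentVariety B) (hg : g ∈ Sp B) : g * u * g⁻¹ ∈ unipotentVariety B := by
  refine ⟨(Sp B).mul_mem ((Sp B).mul_mem hg hu.1) ((Sp B).inv_mem hg), ?_⟩
  obtain ⟨n, hn⟩ := hu.2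
  refine ⟨n, ?_⟩
  have : (g * u * g⁻¹).val - 1 = g.val * (u.val - 1) * g⁻¹.val := by
    rw [Units.val_mul, Units.val_mul, mul_sub, sub_mul, mul_one, Units.mul_inv]
  rw [this, Units.conj_pow, hn, mul_zero, zero_mul]

variable {k K V₀ : Type*} [Field k] [Fintype k] [Field K] [Algebra k K]
  [Algebra.IsAlgebraic k K] [AddCommGroup V₀] [Module k V₀] {B₀ : LinearMap.BilinForm k V₀}

theorem frobGL_mem_unipotentVariety {u : LinearMap.GeneralLinearGroup K (K ⊗[k] V₀)}
    (hu : u ∈ unipotentVariety (LinearMap.BilinForm.baseChange K B₀)) :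
    frobGL k K V₀ u ∈ unipotentVariety (LinearMap.BilinForm.baseChange K B₀) := by
  refine ⟨frobGL_mem_Sp_iff.2 hu.1, ?_⟩
  obtain ⟨n, hn⟩ := hu.2
  have key : ∀ (m : ℕ) (v : K ⊗[k] V₀), (((frobGL k K V₀ u).val - 1) ^ m) (frobV k K V₀ v) =
      frobV k K V₀ (((u.val - 1) ^ m) v) := by
    intro m
    induction m with
    | zero => intro v; rfl
    | succ m ih =>
      intro v
      have h1 := eq_frobGL_iff.1 (rfl : frobGL k K V₀ u = _) v
      have h3 : ((frobGL k K V₀ u).val - 1) (frobV k K V₀ v) =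
          frobV k K V₀ ((u.val - 1) v) := by
        rw [LinearMap.sub_apply, LinearMap.sub_apply, h1, map_sub]
        rfl
      rw [pow_succ, pow_succ, Module.End.mul_apply, Module.End.mul_apply, h3, ih]
  refine ⟨n, LinearMap.ext fun v => ?_⟩
  obtain ⟨v, rfl⟩ := (frobV k K V₀).surjective v
  rw [key, hn, LinearMap.zero_apply, LinearMap.zero_apply, map_zero]

/-- A Springer homeomorphism identifies the centraliser of `u` with that of its image. -/
theorem SpringerHomeomorphism.mem_centralizerIn_iff
    {B : LinearMap.BilinForm K (K ⊗[k] V₀)} (φ : SpringerHomeomorphism B) (u : unipotentVariety B)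
    {g : LinearMap.GeneralLinearGroup K (K ⊗[k] V₀)} (hg : g ∈ Sp B) :
    g ∈ centralizerIn (Sp B) {u.1} ↔ Commute g.val (φ.toEquiv u).1 := by
  have h1 : g ∈ centralizerIn (Sp B) {u.1} ↔ g * u.1 * g⁻¹ = u.1 := by
    rw [mul_inv_eq_iff_eq_mul]
    constructor
    · rintro ⟨_, h⟩
      exact (Subgroup.mem_centralizer_iff.1 h u.1 rfl).symm
    · intro h
      refine ⟨hg, Subgroup.mem_centralizer_iff.2 ?_⟩
      rintro _ rfl
      exact h.symm
  have h2 := φ.map_conj g hg u ⟨_, unipotentVariety_conj u.2 hg⟩ rfl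
  have h3 : Commute g.val (φ.toEquiv u).1 ↔
      (φ.toEquiv u).1 = g.val * (φ.toEquiv u).1 * g⁻¹.val := by
    rw [eq_conj_iff]
    exact ⟨fun h v => (LinearMap.congr_fun h v).symm, fun h => LinearMap.ext fun v => (h v).symm⟩
  rw [h1, h3, ← h2]
  constructor
  · intro h
    exact congrArg (fun x => (φ.toEquiv x).1) (Subtype.ext h.symm)
  · intro h
    exact (congrArg Subtype.val (φ.toEquiv.injective (Subtype.ext h))).symm

/-- The elements of a normal form defined over `k` are fixed by Frobenius. -/
theorem frobV_chain {e₀ : Module.End k V₀} {D : StringData} (v₀ : D.Str → V₀) (x : D.Idx) :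
    frobV k K V₀ (chain (LinearMap.baseChange K e₀) (fun s => (1 : K) ⊗ₜ[k] v₀ s) x) =
      chain (LinearMap.baseChange K e₀) (fun s => (1 : K) ⊗ₜ[k] v₀ s) x := by
  have key : ∀ n : ℕ, ∀ s, frobV k K V₀ ((LinearMap.baseChange K e₀ ^ n) ((1 : K) ⊗ₜ[k] v₀ s)) =
      (LinearMap.baseChange K e₀ ^ n) ((1 : K) ⊗ₜ[k] v₀ s) := by
    intro n s
    induction n with
    | zero => simp [frobV_tmul]
    | succ n ih => rw [pow_succ', Module.End.mul_apply, ← frobV_baseChange, ih]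
  exact key _ _

variable [FiniteDimensional k V₀]

/-- The sign operators of a rational normal form of `φ(u)` form an admissible covering. -/
theorem IsNormalForm.isAdmissibleCovering [IsAlgClosed K] (h2 : (2 : K) ≠ 0)
    {B : LinearMap.BilinForm K (K ⊗[k] V₀)} (hB : B.IsAlt) (hBn : B.Nondegenerate)
    (φ : SpringerHomeomorphism B) (u : unipotentVariety B) (hu : frobGL k K V₀ u.1 = u.1)
    {e : Module.End K (K ⊗[k] V₀)} (hφ : (φ.toEquiv u).1 = e) {D : StringData}
    {v : D.Str → K ⊗[k] V₀} (h : IsNormalForm B e D v) (he : IsSkew B e)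
    (hrat : ∀ x, frobV k K V₀ (h.basis he x) = h.basis he x) :
    IsAdmissibleCovering φ u (signGL (h.basis he)).range (wtCochar (h.basis he) D.wt) := by
  have : Infinite K := IsAlgClosed.instInfinite
  have hsq : ∀ x : K, IsSquare x := fun x => by
    obtain ⟨z, hz⟩ := IsAlgClosed.exists_eq_mul_self x
    exact ⟨z, hz⟩
  have hcent : ∀ g ∈ Sp B, g ∈ centralizerIn (Sp B) {u.1} ↔ Commute g.val e := fun g hg => by
    rw [φ.mem_centralizerIn_iff u hg, hφ]
  have hcomm : ∀ a a' : (signGL (h.basis he)).range, a * a' = a' * a := fun a a' =>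
    Subtype.ext (commute_of_mem_range_signGL a.2 a'.2)
  have hpair : IsAdmissiblePair φ u (signGL (h.basis he)).range (wtCochar (h.basis he) D.wt) :=
    { rational := hu
      le_centralizer := by
        rintro _ ⟨ε, rfl⟩
        exact (hcent _ (signGL_mem_Sp h he ε)).2 (commute_signGL h he ε)
      dynkin := by
        refine ⟨⟨h.isDynkinCocharacter he, ?_⟩, isRationalCocharacter_wtCochar hrat _⟩
        rw [hφ]
        exact h.mem_regularPart h2 hsq hB hBn he
      le_levi := by
        rintro _ ⟨ε, rfl⟩
        exact ⟨diagGL_mem_leviOf (signGL_mem_Sp h he ε), frobGL_signGL hrat ε⟩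
      semisimple := by
        rintro _ ⟨ε, rfl⟩
        exact isSemisimple_signGL h2 _ ε
      mem_component := by
        rintro _ ⟨ε, rfl⟩
        exact h.signGL_mem_identityComponent he ε }
  refine { hpair with surjective := ?_, ker_le_center := ?_, ker_inf_commutator := ?_ }
  · intro y
    obtain ⟨x, rfl⟩ := QuotientGroup.mk_surjective y
    obtain ⟨ε, hε⟩ := h.exists_signGL_inv_mul_mem h2 hBn he hcent x.2
    exact ⟨⟨_, ε, rfl⟩, QuotientGroup.eq.2 hε⟩
  · intro a _
    exact Subgroup.mem_center_iff.2 fun a' => hcomm a' a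
  · have : commutator (signGL (h.basis he)).range = ⊥ := by
      rw [commutator_def, Subgroup.commutator_eq_bot_iff_le_centralizer]
      intro a _
      exact Subgroup.mem_centralizer_iff.2 fun a' _ => hcomm a' a
    rw [this, inf_bot_eq]

end Springer

end SymplecticAdmissible

end

theorem mainTheorem9 {k K V₀ : Type*} [Field k] [Fintype k] [Field K] [Algebra k K]
    [IsAlgClosure k K] [AddCommGroup V₀] [Module k V₀] [FiniteDimensional k V₀]
    (hchar : ringChar k ≠ 2)
    (B₀ : LinearMap.BilinForm k V₀) (halt : B₀.IsAlt) (hnondeg : B₀.Nondegenerate) :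
    (SymplecticAdmissible.unipotentClasses (LinearMap.BilinForm.baseChange K B₀) =
      {O | ∃ μ ∈ SymplecticAdmissible.signedPartitions (-1) (Module.finrank k V₀),
        O = SymplecticAdmissible.jordanClass (LinearMap.BilinForm.baseChange K B₀) μ}) ∧
    ∀ μ ∈ SymplecticAdmissible.signedPartitions (-1) (Module.finrank k V₀),
      SymplecticAdmissible.frobGL k K V₀ ''
          SymplecticAdmissible.jordanClass (LinearMap.BilinForm.baseChange K B₀) μ =
        SymplecticAdmissible.jordanClass (LinearMap.BilinForm.baseChange K B₀) μ ∧
      ∀ φ : SymplecticAdmissible.SpringerHomeomorphism (LinearMap.BilinForm.baseChange K B₀),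
        ∃ (u : SymplecticAdmissible.unipotentVariety (LinearMap.BilinForm.baseChange K B₀))
          (A : Subgroup (LinearMap.GeneralLinearGroup K (K ⊗[k] V₀)))
          (lam : Kˣ →* LinearMap.GeneralLinearGroup K (K ⊗[k] V₀)),
          u.1 ∈ SymplecticAdmissible.jordanClass (LinearMap.BilinForm.baseChange K B₀) μ ∧
          SymplecticAdmissible.frobGL k K V₀ u.1 = u.1 ∧
          Finite A ∧ IsPGroup 2 A ∧
          (∀ a ∈ A, a ∈ SymplecticAdmissible.centralizerIn
              (SymplecticAdmissible.Sp (LinearMap.BilinForm.baseChange K B₀)) {u.1} ∧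
            SymplecticAdmissible.frobGL k K V₀ a = a) ∧
          lam ∈ SymplecticAdmissible.rationalDynkinCocharacters φ u ∧
          SymplecticAdmissible.IsAdmissibleCovering φ u A lam := by
  open SymplecticAdmissible in
  have : IsAlgClosed K := IsAlgClosure.isAlgClosed k
  have : Infinite K := IsAlgClosed.instInfinite
  have h2k : (2 : k) ≠ 0 := Ring.two_ne_zero hchar
  have h2 : (2 : K) ≠ 0 := by
    rw [← map_ofNat (algebraMap k K) 2]
    exact (map_ne_zero (algebraMap k K)).2 h2k
  have hsq : ∀ x : K, IsSquare x := fun x => by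
    obtain ⟨z, hz⟩ := IsAlgClosed.exists_eq_mul_self x
    exact ⟨z, hz⟩
  obtain ⟨hB, hBn⟩ := baseChange_isAlt_nondegenerate (K := K) h2k halt hnondeg
  have hdim : Module.finrank K (K ⊗[k] V₀) = Module.finrank k V₀ := Module.finrank_baseChange
  refine ⟨unipotentClasses_eq h2 hsq hB hBn hdim, fun μ hμ => ?_⟩
  obtain ⟨D, hD, hDN⟩ := exists_stringData_of_mem_signedPartitions hμ
  obtain ⟨e₀, v₀, he₀, hv₀⟩ := exists_isNormalForm_of_sum_len h2k halt hnondeg D hDN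
  have he := he₀.baseChange (K := K)
  have hv := hv₀.baseChange (K := K)
  obtain ⟨u₀, hu₀, hc⟩ := exists_isCayley_of_nilpotent he (hv.isNilpotent he)
  have hu₀F : frobGL k K V₀ u₀ = u₀ := hc.frobGL_eq (hv.isNilpotent he) (frobV_baseChange e₀)
  have hu₀μ : u₀ ∈ jordanClass (LinearMap.BilinForm.baseChange K B₀) μ :=
    ⟨hu₀.1, by rw [← hD]; exact hc.hasJordanType h2 he hv⟩
  refine ⟨?_, fun φ => ?_⟩
  · rw [jordanClass_eq_conj h2 hsq hB hBn hu₀μ]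
    exact image_frobGL_conj B₀ hu₀F
  -- the normal form of `φ u₀` exists over `k`, so that a conjugate of `φ u₀` is rational
  obtain ⟨he', hnil'⟩ := mem_nilpotentCone_iff.1 (φ.toEquiv ⟨u₀, hu₀⟩).2
  obtain ⟨D', v', hv'⟩ := exists_isNormalForm h2 _ rfl hB hBn he' hnil' (Or.inl hsq)
  obtain ⟨e₁, v₁, he₁, hv₁⟩ := exists_isNormalForm_of_sum_len h2k halt hnondeg D'
    (hdim.symm.trans hv'.finrank_eq)
  have hs := he₁.baseChange (K := K)
  have h := hv₁.baseChange (K := K)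
  obtain ⟨g, hg, hge⟩ := hv'.exists_conj he' h hs
  let u : unipotentVariety (LinearMap.BilinForm.baseChange K B₀) :=
    ⟨g * u₀ * g⁻¹, unipotentVariety_conj hu₀ hg⟩
  have hφu : (φ.toEquiv u).1 = LinearMap.baseChange K e₁ := by
    rw [φ.map_conj g hg ⟨u₀, hu₀⟩ u rfl, ← hge]
  have hu : frobGL k K V₀ u.1 = u.1 := by
    have h1 := φ.map_frob u ⟨_, frobGL_mem_unipotentVariety u.2⟩ rfl
    rw [hφu, eq_frobEnd_iff.2 (frobV_baseChange e₁), ← hφu] at h1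
    exact congrArg Subtype.val (φ.toEquiv.injective (Subtype.ext h1))
  have hA := h.isAdmissibleCovering h2 hB hBn φ u hu hφu hs fun x => by
    rw [h.basis_apply]
    exact frobV_chain v₁ x
  refine ⟨u, _, _, jordanClass_conj hu₀μ hg, hu, ?_, isPGroup_range_signGL _,
    fun a ha => ⟨hA.le_centralizer ha, (hA.le_levi a ha).2⟩, hA.dynkin, hA⟩
  exact Set.finite_range (signGL (h.basis hs))
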